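/- Let $n\ge 1$, let $M=\{z\in\mathbb{C}^n : |z|<\epsilon\}$ be an open ball, and let $f,g,h$ be holomorphic functions on $M$. Put $V=\Omega_M$ with frame $e_i=dz_i$ and $s=df=f_1e_1+\cdots+f_ne_n$, $f_i=\partial f/\partial z_i$, and assume that the zero locus of $s$ in $M$ is exactly $Z=\{0\}$. Let $U=M\setminus Z$, $K_U=\det\Omega_U$ and $$\psi = gh\,dz_1\wedge\cdots\wedge dz_n\otimes e_1\wedge\cdots\wedge e_n\in\Gamma(M,K_M\otimes\det V).$$ *Virtual residue.* Over $U$ the Koszul complex $0\to K_U\to K_U\otimes V\to\cdots\to K_U\otimes\wedge^nV\to 0$ with differential $s\wedge$ is exact, and $\psi$ determines a class $[\eta_\psi]\in H^{n,n-1}_{\bar\partial}(U)\cong H^{n-1}(U,K_U)$, the image of $\psi$ under the iterated connecting homomorphism. Concretely, $\eta_\psi=\beta_{n-1}$ for smooth forms $\beta_k$ on $U$ of type $(n,k)$ with values in $\wedge^{n-1-k}V$ $(0\le k\le n-1)$ such that $s\wedge\beta_0=\psi$ and $s\wedge\beta_{k}=\bar\partial\beta_{k-1}$ for $1\le k\le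 n-1$, where products are taken in the graded commutative algebra generated by forms and sections of $\wedge^\bullet V$, so that $s\wedge(\omega\otimes e)=(-1)^{\deg\omega}\,\omega\otimes(s\wedge e)$. The virtual residue is $$\mathrm{Res}_Z\frac{\psi}{s}=\Big(\frac{1}{2\pi\sqrt{-1}}\Big)^n\int_N\eta_\psi,$$ where $N$ is a sphere around $0$ in $M$, oriented as the boundary of the ball. *Grothendieck residue.* Let $$\mathrm{res}_s(g,h)=\Big(\frac{1}{2\pi\sqrt{-1}}\Big)^n\int_{\Gamma}\frac{gh\,dz_1\wedge\cdots\wedge dz_n}{f_1\cdots f_n},\qquad \Gamma=\{|z|\le R,\ |f_1|=\delta_1,\ldots,|f_n|=\delta_n\},$$ where $0<R<\epsilon$, the numbers $\delta_i>0$ are so small that no point of $\{|z|=R\}$ satisfies $|f_i|\le\delta_i$ for all $i$, $\Gamma$ is a regular level set (the differentials $d\log|f_i|$ are linearly independent over $\mathbb{R}$ at every point of $\Gamma$), and $\Gamma$ is oriented by $d(\arg f_1)\wedge\cdots\wedge d(\arg f_n)\ge 0$. Then representatives $\eta_\psi$ exist, and for every such representative, every such sphere $N$ and every such $R,\delta_1,\dots,\delta_n$,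 $$\mathrm{Res}_Z\frac{\psi}{s}=(-1)^{\frac{n(n+1)}{2}}\,\mathrm{res}_s(g,h).$$ -/

import Mathlib

open MeasureTheory Metric
open scoped ContDiff

noncomputable section

namespace VirtualResidue

/-- `ℂⁿ` with its Hermitian norm. -/
abbrev Cn (n : ℕ) : Type := EuclideanSpace ℂ (Fin n)

/-- The fibre of `⋀ʲ Ω`: complex multilinear alternating `j`-forms on `ℂⁿ`
(`Ω` is the holomorphic cotangent bundle of an open subset of `ℂⁿ`). -/
abbrev CotExt (n j : ℕ) : Type := Cn n [⋀^Fin j]→L[ℂ] ℂ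

/-- Complex differential forms of total degree `p` with values in `⋀ʲ Ω`. -/
abbrev ExtForm (n p j : ℕ) : Type := Cn n → Cn n [⋀^Fin p]→L[ℝ] CotExt n j

/-- `dz₁ ∧ ⋯ ∧ dzₙ`, that is `(v₁, …, vₙ) ↦ det (dzᵢ(vₐ))`. -/
def topForm (n : ℕ) : CotExt n n :=
  { (EuclideanSpace.basisFun (Fin n) ℂ).toBasis.det with
    cont := by
      change Continuous fun v : Fin n → Cn n => (EuclideanSpace.basisFun (Fin n) ℂ).toBasis.det v
      simp only [Module.Basis.det_apply]
      refine Continuous.matrix_det (continuous_matrix fun i a => ?_)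
      simp only [Module.Basis.toMatrix_apply, OrthonormalBasis.coe_toBasis_repr_apply,
        EuclideanSpace.basisFun_repr]
      fun_prop }

/-- Exterior multiplication from the left by a covector, `e ↦ σ ∧ e`, from `⋀ʲ Ω` to `⋀ʲ⁺¹ Ω`:
`(σ ∧ e)(w₀, …, wⱼ) = ∑ₐ (-1)ᵃ σ(wₐ) e(w₀, …, ŵₐ, …, wⱼ)`. -/
def wedgeLeft {n : ℕ} (j : ℕ) (σ : Cn n →L[ℂ] ℂ) : CotExt n j →L[ℂ] CotExt n (j + 1) :=
  (ContinuousAlternatingMap.alternatizeUncurryFinCLM ℂ (Cn n) ℂ).comp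
    (ContinuousLinearMap.smulRightL ℂ (Cn n) (CotExt n j) σ)

/-- The Koszul differential `s ∧` on `⋀ʲ Ω`-valued `p`-forms, in the graded commutative algebra
generated by differential forms and sections of `⋀ Ω`, where `s` has degree one:
`s ∧ (ω ⊗ e) = (-1)ᵖ ω ⊗ (s ∧ e)`. -/
def koszul {n p j : ℕ} (s : Cn n → Cn n →L[ℂ] ℂ) (β : ExtForm n p j) : ExtForm n p (j + 1) :=
  fun z => (-1 : ℝ) ^ p •
    ((wedgeLeft j (s z)).restrictScalars ℝ).compContinuousAlternatingMap (β z)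

/-- The section `φ dz₁ ∧ ⋯ ∧ dzₙ ⊗ e₁ ∧ ⋯ ∧ eₙ` of `K ⊗ det Ω`, where `eᵢ = dzᵢ` is the
coordinate frame of `Ω`. -/
def topSection {n : ℕ} (φ : Cn n → ℂ) : ExtForm n n n := fun z =>
  ((ContinuousLinearMap.toSpanSingleton ℂ (φ z • topForm n)).restrictScalars ℝ).compContinuousAlternatingMap
    ((topForm n).restrictScalars ℝ)

/-- `β` is a lift of `ψ` through the Dolbeault resolution of the Koszul complex
`0 → K → K ⊗ Ω → ⋯ → K ⊗ ⋀ⁿ Ω → 0` with differential `s ∧` over the open set `U`: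
smooth `(n, k)`-forms `β k j` with values in `⋀ʲ Ω`, for `k + j = n - 1`, such that
`s ∧ β 0 (n - 1) = ψ` and `s ∧ β (k + 1) j = ∂̄ (β k (j + 1))`.
Then the class of `β (n - 1) 0` in the Dolbeault cohomology `H^{n, n-1}(U)` is the image of `ψ`
under the iterated connecting homomorphism `H⁰(U, K ⊗ ⋀ⁿ Ω) → Hⁿ⁻¹(U, K)`.
On forms of type `(n, k)` the operator `∂̄` equals the exterior derivative, because
there are no nonzero forms of type `(n + 1, k)`. Values at other indices `k, j` are irrelevant. -/
structure IsKoszulLift {n : ℕ} (U : Set (Cn n)) (s : Cn n → Cn n →L[ℂ] ℂ) (ψ : ExtForm n n n)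
    (β : ∀ k j : ℕ, ExtForm n (n + k) j) : Prop where
  smooth : ∀ k j, k + j + 1 = n → ContDiffOn ℝ ∞ (β k j) U
  /-- `β k j` has type `(n, k)`: a form of degree `n + k` has type `(n, k)` if and only if scaling
  all its arguments by `c` multiplies it by `cⁿ c̄ᵏ`. -/
  type : ∀ k j, k + j + 1 = n → ∀ z ∈ U, ∀ (c : ℂ) (v : Fin (n + k) → Cn n),
    β k j z (fun a => c • v a) = (c ^ n * (starRingEnd ℂ c) ^ k) • β k j z v
  start : ∀ j, ∀ hj : j + 1 = n, ∀ z ∈ U, ∀ (v : Fin n → Cn n) (w : Fin n → Cn n),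
    koszul s (β 0 j) z v (fun a => w (Fin.cast hj a)) = ψ z v w
  step : ∀ k j, k + 1 + j + 1 = n → ∀ z ∈ U,
    koszul s (β (k + 1) j) z = extDeriv (β k (j + 1)) z

/-- The scalar `(2n - 1)`-form `η_ψ = β (n - 1) 0` (`⋀⁰ Ω` is the trivial line bundle). -/
def lastForm {n : ℕ} (β : ∀ k j : ℕ, ExtForm n (n + k) j) :
    Cn n → (Fin (n + (n - 1)) → Cn n) → ℂ :=
  fun z v => β (n - 1) 0 z v Fin.elim0

/-- Lebesgue measure on `ℂⁿ = ℝ²ⁿ`. -/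
def lebesgue (n : ℕ) : Measure (Cn n) :=
  (volume : Measure (Fin n → ℂ)).map (WithLp.toLp 2)

/-- The real basis `∂/∂x₁, ∂/∂y₁, …, ∂/∂xₙ, ∂/∂yₙ` of `ℂⁿ`, indexed by `0 ≤ a < 2n`; it is
positive for the complex orientation. -/
def realBasisVec (n a : ℕ) : Cn n :=
  WithLp.toLp 2 fun i => if (i : ℕ) = a / 2 then (if Even a then 1 else Complex.I) else 0

/-- The integral of a `(2n - 1)`-form `η` over the sphere of radius `r` about `0`, oriented as the
boundary of the ball. For `x` on the unit sphere the sum is `(x♭ ∧ η)(∂x₁, ∂y₁, …, ∂xₙ, ∂yₙ)`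
at the point `r x`, which is the value of `η` on an orthonormal frame `τ` of the tangent space
such that `(x, τ)` is a positive frame of `ℂⁿ`. -/
def sphereIntegral {n : ℕ} (r : ℝ) (η : Cn n → (Fin (n + (n - 1)) → Cn n) → ℂ) : ℂ :=
  ∫ x : sphere (0 : Cn n) 1,
    (r : ℂ) ^ (n + (n - 1)) * ∑ a : Fin (n + (n - 1) + 1),
      (-1 : ℂ) ^ (a : ℕ) * ((inner ℂ (realBasisVec n a) (x : Cn n)).re : ℂ) *
        η (r • (x : Cn n)) (fun b => realBasisVec n (a.succAbove b))
    ∂(lebesgue n).toSphere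

/-- `w` is the virtual residue `Res_Z(ψ/s) = (1/2πi)ⁿ ∫_N η_ψ` over the ball of radius `ε`,
where `Z` is the zero locus of `s`, computed from some representative `η_ψ` on the complement of
`Z` and some sphere `N` about `0` in the ball. -/
def IsVirtualResidue {n : ℕ} (ε : ℝ) (s : Cn n → Cn n →L[ℂ] ℂ) (ψ : ExtForm n n n) (w : ℂ) :
    Prop :=
  ∃ β : ∀ k j : ℕ, ExtForm n (n + k) j,
    IsKoszulLift (ball 0 ε \ {z | s z = 0}) s ψ β ∧
    ∃ r : ℝ, 0 < r ∧ r < ε ∧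
      w = (1 / (2 * Real.pi * Complex.I)) ^ n * sphereIntegral r (lastForm β)

/-- A finite family of smooth local parametrizations covering a `k`-dimensional submanifold `Γ`,
with a partition of unity on `Γ` subordinate to it. -/
structure ParamPartition {n : ℕ} (k : ℕ) (Γ : Set (Cn n)) where
  card : ℕ
  dom : Fin card → Set (Fin k → ℝ)
  param : Fin card → (Fin k → ℝ) → Cn n
  bump : Fin card → Cn n → ℝ
  isOpen_dom : ∀ l, IsOpen (dom l)
  smooth : ∀ l, ContDiffOn ℝ ∞ (param l) (dom l)
  injOn : ∀ l, Set.InjOn (param l) (dom l)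
  immersion : ∀ l, ∀ x ∈ dom l, Function.Injective (fderiv ℝ (param l) x)
  /-- `param l` is a homeomorphism from `dom l` onto a relatively open subset of `Γ`. -/
  open_image : ∀ l, ∀ W ⊆ dom l, IsOpen W → ∃ O, IsOpen O ∧ param l '' W = Γ ∩ O
  bump_nonneg : ∀ l, ∀ z ∈ Γ, 0 ≤ bump l z
  bump_continuous : ∀ l, ContinuousOn (bump l) Γ
  bump_support : ∀ l, ∃ K ⊆ dom l, IsCompact K ∧ ∀ z ∈ Γ, bump l z ≠ 0 → z ∈ param l '' K
  bump_sum : ∀ z ∈ Γ, ∑ l, bump l z = 1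

/-- The coordinate tangent vector `∂ (param l) / ∂ xₐ`. -/
def ParamPartition.tangent {n k : ℕ} {Γ : Set (Cn n)} (P : ParamPartition k Γ) (l : Fin P.card)
    (x : Fin k → ℝ) (a : Fin k) : Cn n :=
  fderiv ℝ (P.param l) x (Pi.single a 1)

/-- The integral of a `k`-form over `Γ`, oriented by the parametrizations. -/
def ParamPartition.integral {n k : ℕ} {Γ : Set (Cn n)} (P : ParamPartition k Γ)
    (η : Cn n → (Fin k → Cn n) → ℂ) : ℂ :=
  ∑ l, ∫ x in P.dom l, (P.bump l (P.param l x) : ℂ) * η (P.param l x) (P.tangent l x)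

/-- The set `{|z| ≤ R, |F₁| = δ₁, …, |Fₙ| = δₙ}`. -/
def levelTorus {n : ℕ} (F : Fin n → Cn n → ℂ) (R : ℝ) (δ : Fin n → ℝ) : Set (Cn n) :=
  {z | ‖z‖ ≤ R ∧ ∀ i, ‖F i z‖ = δ i}

/-- `ρ` is the Grothendieck residue at `0` of `φ dz₁ ∧ ⋯ ∧ dzₙ / (F₁ ⋯ Fₙ)`, that is
`(1/2πi)ⁿ ∫_Γ φ dz₁ ∧ ⋯ ∧ dzₙ / (F₁ ⋯ Fₙ)` with `Γ = {|F₁| = δ₁, …, |Fₙ| = δₙ}` inside a closed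
ball of radius `R` contained in the open ball of radius `ε`. The `δᵢ > 0` are small, in the sense
that no point of the sphere of radius `R` satisfies `|Fᵢ| ≤ δᵢ` for all `i`, and `Γ` is a regular
level set: the differentials `d log |Fᵢ|` are linearly independent over `ℝ` at each of its points.
`Γ` is oriented by `d(arg F₁) ∧ ⋯ ∧ d(arg Fₙ) ≥ 0`. -/
def IsGrothendieckResidue {n : ℕ} (ε : ℝ) (F : Fin n → Cn n → ℂ) (φ : Cn n → ℂ) (ρ : ℂ) : Prop :=
  ∃ (R : ℝ) (δ : Fin n → ℝ) (P : ParamPartition n (levelTorus F R δ)),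
    0 < R ∧ R < ε ∧ (∀ i, 0 < δ i) ∧
    (∀ z, ‖z‖ = R → ∃ i, δ i < ‖F i z‖) ∧
    (∀ z ∈ levelTorus F R δ, Function.Surjective
      fun (v : Cn n) (i : Fin n) => (fderiv ℂ (F i) z v / F i z).re) ∧
    (∀ l, ∀ x ∈ P.dom l, 0 ≤ Matrix.det (Matrix.of fun i a : Fin n =>
      (fderiv ℂ (F i) (P.param l x) (P.tangent l x a) / F i (P.param l x)).im)) ∧
    ρ = (1 / (2 * Real.pi * Complex.I)) ^ n *
      P.integral (fun z v => φ z / (∏ i, F i z) * topForm n v)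

end VirtualResidue

end

/-! Write F_i = ∂f/∂z_i, φ = gh, J = det(∂F_m/∂z_l), and η for the last form β_{n-1} of a lift. Both
residues are compared with one integral over a ball, in which the sphere and the torus are smeared
out by cutoff functions.

From the sphere to the ball. The form η is closed off the origin, because s ∧ dη = -d(s ∧ η) = 0 and
s has no zero there. By Stokes, ∫ dχ ∧ η = -∫_N η for every compactly supported χ equal to one near
0 (`integral_wedge_cutoff`). Take χ = C_∅ from the family C_S = ∏_{l ∈ S} (-ρ_l(|F_l|²)) ∏_{l ∉ S}
κ_l(|F_l|²), where κ_l steps from one to zero near δ_l² and ρ_l = -κ_l' is a bump of integral one.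
Then dC_S is the sum of C_{S ∪ {m}} d|F_m|² over m ∉ S, modulo the differentials d|F_m|² with m ∈ S.
Forms of type (n, k) are killed by dF_m, so only F_m dF̄_m matters in d|F_m|². The factors F_m
assemble, after antisymmetrization, into s ∧ β_k, which equals dβ_{k-1}. Integration by parts moves
this derivative onto the cutoffs, and the process repeats: each round trades one antiholomorphic
degree of β for one factor dF̄_m (`integral_descentForm`). At the end s ∧ β_0 = ψ gives the exact
identity ∫_N η = (-1)^{n(n-1)/2} (2i)ⁿ ∫ C_S φ J̄ with S the full index set
(`sphereIntegral_lastForm`).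

From the ball to the torus. For the full index set, C_S is (-1)ⁿ ∏ ρ_l(|F_l|²) inside the ball of
radius R. As the bumps shrink, this product concentrates on Γ. In coordinates x + iτ with τ_i =
|F_i|² - δ_i² it is an approximate identity in τ, and (2i)ⁿ J̄ times the Jacobian of the chart is
the density of dz₁ ∧ ⋯ ∧ dzₙ / ∏ F_i on Γ; this uses the orientation of Γ (`conj_det_mul_abs_det`,
`tendsto_integral_levelTorus`). The sphere integral does not depend on the width of the bumps, so it
equals the limit, and the signs combine to (-1)^{n(n-1)/2 + n} = (-1)^{n(n+1)/2}.

Lifts exist because contraction with a smooth field h satisfying s(h) = 1 is a homotopy for the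
Koszul differential. Type arguments are made with the weight of a form under unit complex scalars:
type (a, b) has weight a - b and degree a + b. -/

noncomputable section

namespace VirtualResidue

/-! ### Holomorphic functions of several variables are smooth -/

section Holomorphic

variable {E : Type*} [NormedAddCommGroup E] [NormedSpace ℂ E]

theorem hasDerivAt_line {f : E → ℂ} {z v : E} {ζ : ℂ} (hf : DifferentiableAt ℂ f (z + ζ • v)) :
    HasDerivAt (fun ζ : ℂ => f (z + ζ • v)) (fderiv ℂ f (z + ζ • v) v) ζ := by
  have h1 : HasDerivAt (fun ζ : ℂ => z + ζ • v) v ζ := by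
    simpa using ((hasDerivAt_id ζ).smul_const v).const_add z
  exact hf.hasFDerivAt.comp_hasDerivAt ζ h1

/-- Cauchy estimate along complex lines. -/
theorem norm_fderiv_le_of_closedBall {f : E → ℂ} {z : E} {r C : ℝ} (hr : 0 < r) (hC : 0 ≤ C)
    (hf : ∀ w ∈ closedBall z r, DifferentiableAt ℂ f w) (hb : ∀ w ∈ closedBall z r, ‖f w‖ ≤ C) :
    ‖fderiv ℂ f z‖ ≤ C / r := by
  refine ContinuousLinearMap.opNorm_le_bound _ (by positivity) fun v => ?_
  rcases eq_or_ne v 0 with rfl | hv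
  · simp
  have hv' : 0 < ‖v‖ := norm_pos_iff.2 hv
  have hmem : ∀ ζ ∈ closedBall (0 : ℂ) (r / ‖v‖), z + ζ • v ∈ closedBall z r := by
    intro ζ hζ
    rw [mem_closedBall_zero_iff] at hζ
    rw [mem_closedBall, dist_eq_norm, add_sub_cancel_left, norm_smul]
    exact (le_div_iff₀ hv').1 hζ
  have hd : ∀ ζ ∈ closedBall (0 : ℂ) (r / ‖v‖),
      HasDerivAt (fun ζ : ℂ => f (z + ζ • v)) (fderiv ℂ f (z + ζ • v) v) ζ :=
    fun ζ hζ => hasDerivAt_line (hf _ (hmem ζ hζ))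
  have hR : 0 < r / ‖v‖ := by positivity
  have h := Complex.norm_deriv_le_of_forall_mem_sphere_norm_le (f := fun ζ : ℂ => f (z + ζ • v))
    (c := 0) (C := C) hR
    (DifferentiableOn.diffContOnCl fun ζ hζ =>
      (hd ζ (closure_ball_subset_closedBall hζ)).differentiableAt.differentiableWithinAt)
    fun ζ hζ => hb _ (hmem ζ (sphere_subset_closedBall hζ))
  rw [(hd 0 (by simp [hR.le])).deriv] at h
  simp only [zero_smul, add_zero] at h
  calc _ ≤ C / (r / ‖v‖) := h
    _ = _ := by field_simp

/-- Directional derivatives of a holomorphic function of several variables are holomorphic. -/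
theorem differentiableOn_fderiv_apply [FiniteDimensional ℂ E] {f : E → ℂ} {U : Set E} (hU : IsOpen U)
    (hf : DifferentiableOn ℂ f U) (v : E) : DifferentiableOn ℂ (fun z => fderiv ℂ f z v) U := by
  intro z₀ hz₀
  refine DifferentiableAt.differentiableWithinAt ?_
  let _ : MeasurableSpace E := borel E
  have : BorelSpace E := ⟨rfl⟩
  have : ProperSpace E := FiniteDimensional.proper ℂ E
  obtain ⟨R, hR, hRU⟩ := Metric.isOpen_iff.1 hU z₀ hz₀
  -- The points z + ζv stay within 2r of z₀, the Cauchy estimate around them needs a further r, and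
  -- 3r < R.
  set r := R / 4 with hr
  have hr0 : 0 < r := by positivity
  have hfd : ∀ w ∈ closedBall z₀ (3 * r), DifferentiableAt ℂ f w := fun w hw =>
    hf.differentiableAt (hU.mem_nhds (hRU (lt_of_le_of_lt (mem_closedBall.1 hw) (by linarith))))
  obtain ⟨C, hC⟩ := (isCompact_closedBall z₀ (3 * r)).exists_bound_of_continuousOn (f := f)
    (fun w hw => (hfd w hw).continuousAt.continuousWithinAt)
  have hC0 : 0 ≤ C := (norm_nonneg _).trans (hC z₀ (by simp; positivity))
  obtain ⟨δ, hδ, hδv⟩ : ∃ δ : ℝ, 0 < δ ∧ δ * ‖v‖ ≤ r :=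
    ⟨r / (‖v‖ + 1), by positivity, by
      rw [div_mul_eq_mul_div, div_le_iff₀ (by positivity)]; nlinarith⟩
  have hmem : ∀ z ∈ ball z₀ r, ∀ ζ ∈ closedBall (0 : ℂ) δ, z + ζ • v ∈ closedBall z₀ (2 * r) := by
    intro z hz ζ hζ
    rw [mem_closedBall_zero_iff] at hζ
    rw [mem_ball, dist_eq_norm] at hz
    rw [mem_closedBall, dist_eq_norm, add_sub_right_comm]
    refine (norm_add_le _ _).trans ?_
    rw [norm_smul]
    have : ‖ζ‖ * ‖v‖ ≤ δ * ‖v‖ := by gcongr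
    linarith
  have hbd : ∀ w ∈ closedBall z₀ (2 * r), ‖fderiv ℂ f w‖ ≤ C / r := by
    intro w hw
    have hsub : closedBall w r ⊆ closedBall z₀ (3 * r) :=
      closedBall_subset_closedBall' (by rw [mem_closedBall] at hw; linarith)
    exact norm_fderiv_le_of_closedBall hr0 hC0 (fun u hu => hfd u (hsub hu))
      fun u hu => hC u (hsub hu)
  have h23 : closedBall z₀ (2 * r) ⊆ closedBall z₀ (3 * r) :=
    closedBall_subset_closedBall (by linarith)
  let c : ℝ → ℂ := fun θ => deriv (circleMap 0 δ) θ * ((circleMap 0 δ θ) ^ 2)⁻¹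
  have hcm : ∀ θ, circleMap 0 δ θ ∈ closedBall (0 : ℂ) δ := circleMap_mem_closedBall 0 hδ.le
  have hcne : ∀ θ, circleMap 0 δ θ ≠ 0 := fun θ => circleMap_ne_center hδ.ne'
  have hcc : Continuous c := by
    simp only [c, deriv_circleMap]
    exact ((continuous_circleMap 0 δ).mul continuous_const).mul
      (((continuous_circleMap 0 δ).pow 2).inv₀ fun θ => pow_ne_zero 2 (hcne θ))
  -- The one-variable Cauchy formula on the line through z in direction v expresses the derivative
  -- by values of f alone. Hence it can be differentiated in z under the integral sign, dominated by
  -- the Cauchy estimate.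
  have key : ∀ z ∈ ball z₀ r, fderiv ℂ f z v =
      (2 * Real.pi * Complex.I : ℂ)⁻¹ •
        ∫ θ in (0 : ℝ)..2 * Real.pi, c θ * f (z + circleMap 0 δ θ • v) := by
    intro z hz
    have hc : Continuous fun ζ : ℂ => z + ζ • v := by fun_prop
    have h := Complex.two_pi_I_inv_smul_circleIntegral_sub_sq_inv_smul_of_differentiable
      (hU.preimage hc) (c := 0) (w₀ := 0) (R := δ) (f := fun ζ : ℂ => f (z + ζ • v))
      (fun ζ hζ => hRU (lt_of_le_of_lt (mem_closedBall.1 (hmem z hz ζ hζ)) (by linarith)))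
      (fun ζ hζ => (hasDerivAt_line
        (hf.differentiableAt (hU.mem_nhds hζ))).differentiableAt.differentiableWithinAt)
      (by simpa using hδ)
    have h0 := hasDerivAt_line (ζ := 0) (v := v) (z := z)
      (hfd _ (h23 (hmem z hz 0 (by simp [hδ.le]))))
    rw [h0.deriv] at h
    simp only [zero_smul, add_zero] at h
    rw [← h, circleIntegral]
    simp only [c, sub_zero, smul_eq_mul, mul_assoc]
  have hF : HasFDerivAt (fun z => ∫ θ in (0 : ℝ)..2 * Real.pi, c θ * f (z + circleMap 0 δ θ • v))
      (∫ θ in (0 : ℝ)..2 * Real.pi, c θ • fderiv ℂ f (z₀ + circleMap 0 δ θ • v)) z₀ := by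
    have hcont : ∀ z ∈ ball z₀ r, Continuous fun θ => c θ * f (z + circleMap 0 δ θ • v) := by
      intro z hz
      refine hcc.mul (continuous_iff_continuousAt.2 fun θ => ?_)
      exact ContinuousAt.comp (f := fun θ => z + circleMap 0 δ θ • v) (g := f)
        (hfd _ (h23 (hmem z hz _ (hcm θ)))).continuousAt
        (by have := continuous_circleMap 0 δ; fun_prop)
    refine intervalIntegral.hasFDerivAt_integral_of_dominated_of_fderiv_le (𝕜 := ℂ)
      (F' := fun z θ => c θ • fderiv ℂ f (z + circleMap 0 δ θ • v))
      (bound := fun θ => ‖c θ‖ * (C / r)) (ball_mem_nhds z₀ hr0) ?_ ?_ ?_ ?_ ?_ ?_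
    · filter_upwards [ball_mem_nhds z₀ hr0] with z hz
      exact (hcont z hz).aestronglyMeasurable
    · exact (hcont z₀ (mem_ball_self hr0)).intervalIntegrable _ _
    · refine AEStronglyMeasurable.smul hcc.aestronglyMeasurable ?_
      refine (Measurable.stronglyMeasurable ?_).aestronglyMeasurable
      have := continuous_circleMap 0 δ
      exact (measurable_fderiv ℂ f).comp (Continuous.measurable (by fun_prop))
    · refine Filter.Eventually.of_forall fun θ _ z hz => ?_
      rw [norm_smul]
      gcongr
      exact hbd _ (hmem z hz _ (hcm θ))
    · exact ((hcc.norm).mul continuous_const).intervalIntegrable _ _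
    · refine Filter.Eventually.of_forall fun θ _ z hz => ?_
      have h1 := (hfd _ (h23 (hmem z hz _ (hcm θ)))).hasFDerivAt
      have h2 : HasFDerivAt (fun z => z + circleMap 0 δ θ • v) (ContinuousLinearMap.id ℂ E) z :=
        (hasFDerivAt_id z).add_const _
      simpa using (h1.comp z h2).const_mul (c θ)
  refine (hF.differentiableAt.const_smul (2 * Real.pi * Complex.I : ℂ)⁻¹).congr_of_eventuallyEq ?_
  filter_upwards [ball_mem_nhds z₀ hr0] with z hz using key z hz

/-- A holomorphic function of several variables is smooth. -/
theorem contDiffOn_of_holomorphic [FiniteDimensional ℂ E] {f : E → ℂ} {U : Set E} (hU : IsOpen U)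
    (hf : DifferentiableOn ℂ f U) : ContDiffOn ℂ ∞ f U := by
  have : ∀ (m : ℕ) (f : E → ℂ), DifferentiableOn ℂ f U → ContDiffOn ℂ m f U := by
    intro m
    induction m with
    | zero => intro f hf; exact contDiffOn_zero.2 hf.continuousOn
    | succ m ih =>
      intro f hf
      push_cast
      rw [contDiffOn_succ_iff_fderiv_of_isOpen hU]
      refine ⟨hf, by simp, contDiffOn_clm_apply.2 fun v => ih _ (differentiableOn_fderiv_apply hU hf v)⟩
  exact contDiffOn_infty.2 fun m => this m f hf

end Holomorphic

/-! ### Types of differential forms through weights -/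

section Weight

/-- `α` has weight `m` under the action of unit complex numbers on its arguments. -/
def HasWeight {n p : ℕ} (m : ℤ) (α : Cn n [⋀^Fin p]→L[ℝ] ℂ) : Prop :=
  ∀ c : ℂ, ‖c‖ = 1 → ∀ v, α (fun a => c • v a) = c ^ m * α v

theorem exists_unit_zpow_eq_neg_one {m : ℤ} (hm : m ≠ 0) : ∃ c : ℂ, ‖c‖ = 1 ∧ c ^ m = -1 := by
  refine ⟨Complex.exp ((Real.pi / m : ℝ) * Complex.I), Complex.norm_exp_ofReal_mul_I _, ?_⟩
  rw [← Complex.exp_int_mul, ← Complex.exp_pi_mul_I]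
  congr 1
  have : (m : ℂ) ≠ 0 := by exact_mod_cast hm
  push_cast
  field_simp

theorem vecCons_apply_complex {n p : ℕ} (α : Cn n [⋀^Fin (p + 1)]→L[ℝ] ℂ) (v : Cn n) (a b : ℝ)
    (w : Fin p → Cn n) : α (Matrix.vecCons ((a + b * Complex.I : ℂ) • v) w) =
      a * α (Matrix.vecCons v w) + b * α (Matrix.vecCons (Complex.I • v) w) := by
  have h : (a + b * Complex.I : ℂ) • v = a • v + b • (Complex.I • v) := by
    rw [add_smul, mul_smul]; rfl
  simp only [← ContinuousAlternatingMap.curryLeft_apply_apply, h, map_add, map_smul]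
  simp

/-- With Jv = i • v, the vector v + iJv of the complexified tangent space is twice the (0,1)-part of
v. Contraction with it removes an antiholomorphic factor, so type (a, b) becomes (a, b - 1) and the
weight rises by one. -/
theorem HasWeight.curry {n p : ℕ} {m : ℤ} {α : Cn n [⋀^Fin (p + 1)]→L[ℝ] ℂ} (hα : HasWeight m α)
    (v : Cn n) :
    HasWeight (m + 1) (α.curryLeft v + Complex.I • α.curryLeft (Complex.I • v)) := by
  intro c hc w
  have hc0 : c ≠ 0 := fun h => by simp [h] at hc
  have hinv : c * (starRingEnd ℂ c) = 1 := by
    rw [Complex.mul_conj, Complex.normSq_eq_norm_sq, hc]; simp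
  have key : ∀ x : Cn n, α (Matrix.vecCons x fun a => c • w a) =
      c ^ m * α (Matrix.vecCons (starRingEnd ℂ c • x) w) := by
    intro x
    rw [← hα c hc]
    congr 1
    ext1 a
    refine Fin.cases ?_ (fun a => ?_) a
    · simp [smul_smul, hinv]
    · simp
  have hre : starRingEnd ℂ c = ((c.re : ℝ) + ((-c.im : ℝ)) * Complex.I : ℂ) := by
    apply Complex.ext <;> simp
  have h1 := key v
  have h2 := key (Complex.I • v)
  have hswap : starRingEnd ℂ c • (Complex.I • v) =
      ((c.im : ℝ) + (c.re : ℝ) * Complex.I : ℂ) • v := by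
    rw [smul_smul]; congr 1
    apply Complex.ext <;> simp
  rw [hre, vecCons_apply_complex] at h1
  rw [hswap, vecCons_apply_complex] at h2
  simp only [ContinuousAlternatingMap.add_apply, ContinuousAlternatingMap.smul_apply,
    ContinuousAlternatingMap.curryLeft_apply_apply, smul_eq_mul, h1, h2, zpow_add₀ hc0, zpow_one]
  have hc' : c = c.re + c.im * Complex.I := (Complex.re_add_im c).symm
  have : c ^ m * c = c ^ m * (c.re + c.im * Complex.I) := by rw [← hc']
  rw [this]
  push_cast
  linear_combination (-(c ^ m * c.im * α (Matrix.vecCons (Complex.I • v) w))) * Complex.I_sq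

/-- A form of degree `p` and weight `m` with `p + m > 2 n` vanishes. -/
theorem HasWeight.eq_zero {n : ℕ} : ∀ {p : ℕ} {m : ℤ} {α : Cn n [⋀^Fin p]→L[ℝ] ℂ},
    HasWeight m α → 2 * (n : ℤ) < p + m → α = 0
  | 0, m, α, hα, h => by
    ext v
    obtain ⟨c, hc, hcm⟩ := exists_unit_zpow_eq_neg_one (m := m) (by push_cast at h; omega)
    have := hα c hc v
    rw [hcm, Subsingleton.elim (fun a => c • v a) v] at this
    simp only [ContinuousAlternatingMap.coe_zero, Pi.zero_apply]
    linear_combination this / 2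
  | p + 1, m, α, hα, h => by
    -- Contraction with a (0,1)-vector lowers the degree by one and raises the weight by one, so the
    -- inequality is preserved and the induction applies. Its vanishing is complex linearity in the
    -- first argument, hence in all of them.
    have h0 : ∀ (v : Cn n) w, α (Matrix.vecCons (Complex.I • v) w) =
        Complex.I * α (Matrix.vecCons v w) := by
      intro v w
      have := congrArg (fun η => η w) (HasWeight.eq_zero (hα.curry v) (by push_cast at h ⊢; omega))
      simp only [ContinuousAlternatingMap.add_apply, ContinuousAlternatingMap.smul_apply,
        ContinuousAlternatingMap.curryLeft_apply_apply, smul_eq_mul,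
        ContinuousAlternatingMap.coe_zero, Pi.zero_apply] at this
      linear_combination (-Complex.I) * this + α (Matrix.vecCons (Complex.I • v) w) * Complex.I_sq
    have h1 : ∀ (c : ℂ) (v : Cn n) w, α (Matrix.vecCons (c • v) w) =
        c * α (Matrix.vecCons v w) := by
      intro c v w
      conv_lhs => rw [← Complex.re_add_im c]
      rw [vecCons_apply_complex, h0]
      conv_rhs => rw [← Complex.re_add_im c]
      ring
    let Ω : Cn n [⋀^Fin (p + 1)]→ₗ[ℂ] ℂ :=
      { toFun := α
        map_update_add' := by
          intro inst v j x y
          have := α.map_update_add v j x y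
          convert this
        map_update_smul' := by
          intro inst v j c x
          have hi : ∀ y, Function.update v j y = j.insertNth y (j.removeNth v) := fun y => by
            rw [Fin.insertNth_removeNth]; congr!
          simp only [hi, ContinuousAlternatingMap.map_insertNth, h1, smul_eq_mul]
          simp [mul_left_comm]
        map_eq_zero_of_eq' := fun v i j hv hij => α.map_eq_zero_of_eq v hv hij }
    ext v
    change Ω v = 0
    -- A complex multilinear form of degree p + 1 vanishes for p + 1 > n. Otherwise its weight would
    -- have to be p + 1 ≤ n, while the hypothesis forces m > n.
    by_cases hp : n < p + 1
    · refine Ω.map_linearDependent v fun hli => ?_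
      have := hli.fintype_card_le_finrank
      simp at this
      omega
    · obtain ⟨c, hc, hcm⟩ := exists_unit_zpow_eq_neg_one (m := m - (p + 1 : ℕ))
        (by push_cast at h ⊢; omega)
      have hc0 : c ≠ 0 := fun h => by simp [h] at hc
      have h2 : Ω (fun a => c • v a) = c ^ m * Ω v := hα c hc v
      have h3 : Ω (fun a => c • v a) = c ^ (p + 1) * Ω v := by
        simpa using Ω.toMultilinearMap.map_smul_univ (fun _ => c) v
      have h4 : c ^ m = - c ^ (p + 1) := by
        have : c ^ m = c ^ (m - (p + 1 : ℕ)) * c ^ (p + 1) := by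
          rw [← zpow_natCast, ← zpow_add₀ hc0]; simp
        rw [this, hcm]; ring
      rw [h3, h4] at h2
      have h5 : c ^ (p + 1) ≠ 0 := pow_ne_zero _ hc0
      have h6 : c ^ (p + 1) * Ω v = 0 := by linear_combination h2 / 2
      exact (mul_eq_zero.1 h6).resolve_left h5

/-- The alternatization of a complex linear map into forms of weight `m` and degree `p` with
`p + m ≥ 2 n` vanishes. -/
theorem alternatize_eq_zero_of_hasWeight {n p : ℕ} {m : ℤ}
    {A : Cn n →L[ℝ] Cn n [⋀^Fin p]→L[ℝ] ℂ} (hA : ∀ u, HasWeight m (A u))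
    (hI : ∀ u, A (Complex.I • u) = Complex.I • A u) (h : 2 * (n : ℤ) ≤ p + m) :
    ContinuousAlternatingMap.alternatizeUncurryFin A = 0 := by
  have hAc : ∀ (c : ℂ) u, A (c • u) = c • A u := by
    intro c u
    have : c • u = c.re • u + c.im • (Complex.I • u) := by
      conv_lhs => rw [← Complex.re_add_im c, add_smul, mul_smul]
      rfl
    rw [this, map_add, map_smul, map_smul, hI]
    ext v
    simp only [ContinuousAlternatingMap.add_apply, ContinuousAlternatingMap.smul_apply,
      smul_eq_mul, Complex.real_smul]
    conv_rhs => rw [← Complex.re_add_im c]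
    ring
  -- The new complex linear argument adds one to the degree and one to the weight, which makes the
  -- inequality strict.
  refine HasWeight.eq_zero (m := m + 1) (fun c hc v => ?_) (by push_cast; omega)
  have hc0 : c ≠ 0 := fun h => by simp [h] at hc
  simp only [ContinuousAlternatingMap.alternatizeUncurryFin_apply, Finset.mul_sum]
  refine Finset.sum_congr rfl fun i _ => ?_
  rw [hAc]
  have := hA (v i) c hc (i.removeNth v)
  rw [ContinuousAlternatingMap.smul_apply]
  have h' : (i.removeNth fun a => c • v a) = fun a => c • i.removeNth v a := rfl
  rw [h', this, zpow_add₀ hc0, zpow_one]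
  simp only [smul_eq_mul, zsmul_eq_mul]
  ring

end Weight

/-! ### Exterior multiplication by covectors -/

section Wedge

/-- Left exterior multiplication by a complex-valued covector. -/
def wedge {n p : ℕ} (θ : Cn n →L[ℝ] ℂ) (α : Cn n [⋀^Fin p]→L[ℝ] ℂ) :
    Cn n [⋀^Fin (p + 1)]→L[ℝ] ℂ :=
  ContinuousAlternatingMap.alternatizeUncurryFin (θ.smulRight α)

theorem wedge_eq {n p : ℕ} (θ : Cn n →L[ℝ] ℂ) (α : Cn n [⋀^Fin p]→L[ℝ] ℂ) :
    wedge θ α = ContinuousAlternatingMap.alternatizeUncurryFin (θ.smulRight α) := rfl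

theorem wedge_apply {n p : ℕ} (θ : Cn n →L[ℝ] ℂ) (α : Cn n [⋀^Fin p]→L[ℝ] ℂ)
    (v : Fin (p + 1) → Cn n) :
    wedge θ α v = ∑ i : Fin (p + 1), (-1 : ℂ) ^ (i : ℕ) * (θ (v i) * α (i.removeNth v)) := by
  simp [wedge_eq, ContinuousAlternatingMap.alternatizeUncurryFin_apply]

theorem wedge_add_left {n p : ℕ} (θ θ' : Cn n →L[ℝ] ℂ) (α : Cn n [⋀^Fin p]→L[ℝ] ℂ) :
    wedge (θ + θ') α = wedge θ α + wedge θ' α := by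
  ext v; simp [wedge_apply, mul_add, add_mul, Finset.sum_add_distrib]

theorem wedge_smul_left {n p : ℕ} (c : ℂ) (θ : Cn n →L[ℝ] ℂ) (α : Cn n [⋀^Fin p]→L[ℝ] ℂ) :
    wedge (c • θ) α = c • wedge θ α := by
  ext v; simp [wedge_apply, Finset.mul_sum, mul_left_comm, mul_assoc]

theorem wedge_add_right {n p : ℕ} (θ : Cn n →L[ℝ] ℂ) (α α' : Cn n [⋀^Fin p]→L[ℝ] ℂ) :
    wedge θ (α + α') = wedge θ α + wedge θ α' := by
  ext v; simp [wedge_apply, mul_add, Finset.sum_add_distrib]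

theorem wedge_smul_right {n p : ℕ} (c : ℂ) (θ : Cn n →L[ℝ] ℂ) (α : Cn n [⋀^Fin p]→L[ℝ] ℂ) :
    wedge θ (c • α) = c • wedge θ α := by
  ext v; simp [wedge_apply, Finset.mul_sum, mul_left_comm]

@[simp] theorem wedge_zero_right {n p : ℕ} (θ : Cn n →L[ℝ] ℂ) :
    wedge θ (0 : Cn n [⋀^Fin p]→L[ℝ] ℂ) = 0 := by
  ext v; simp [wedge_apply]

@[simp] theorem wedge_zero_left {n p : ℕ} (α : Cn n [⋀^Fin p]→L[ℝ] ℂ) :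
    wedge 0 α = 0 := by
  ext v; simp [wedge_apply]

/-- The double product is the double alternatization of (x, y) ↦ θ(x) θ(y) α, which is symmetric in
x and y; this is the algebra behind d² = 0. Polarization then gives anticommutativity. -/
theorem wedge_wedge_self {n p : ℕ} (θ : Cn n →L[ℝ] ℂ) (α : Cn n [⋀^Fin p]→L[ℝ] ℂ) :
    wedge θ (wedge θ α) = 0 := by
  have h := ContinuousAlternatingMap.alternatizeUncurryFin_alternatizeUncurryFinCLM_comp_of_symmetric
    (f := (((ContinuousLinearMap.compL ℝ (Cn n) (Cn n [⋀^Fin p]→L[ℝ] ℂ)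
      (Cn n [⋀^Fin p]→L[ℝ] ℂ)).flip (θ.smulRight α)).comp (ContinuousLinearMap.lsmul ℝ ℂ)).comp θ)
    (fun x y => by
      ext v
      simp [mul_left_comm])
  rw [← h, wedge_eq, wedge_eq]
  congr 1
  ext u v
  simp [ContinuousAlternatingMap.alternatizeUncurryFin_apply, Finset.mul_sum, mul_left_comm]

theorem wedge_comm {n p : ℕ} (θ θ' : Cn n →L[ℝ] ℂ) (α : Cn n [⋀^Fin p]→L[ℝ] ℂ) :
    wedge θ (wedge θ' α) = -wedge θ' (wedge θ α) := by
  have h := wedge_wedge_self (θ + θ') α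
  simp only [wedge_add_left, wedge_add_right, wedge_wedge_self, zero_add, add_zero] at h
  exact eq_neg_of_add_eq_zero_right h

end Wedge

section BilinearOperations

theorem isBoundedBilinearMap_wedge (n p : ℕ) : IsBoundedBilinearMap ℝ
    fun x : (Cn n →L[ℝ] ℂ) × (Cn n [⋀^Fin p]→L[ℝ] ℂ) => wedge x.1 x.2 where
  add_left := wedge_add_left
  smul_left c θ α := by ext v; simp [wedge_apply, Finset.mul_sum, mul_left_comm, mul_assoc]
  add_right := wedge_add_right
  smul_right c θ α := by ext v; simp [wedge_apply, Finset.mul_sum, mul_left_comm]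
  bound := by
    refine ⟨p + 1, by positivity, fun θ α => ?_⟩
    rw [wedge_eq]
    refine (ContinuousAlternatingMap.norm_alternatizeUncurryFin_le _).trans ?_
    rw [mul_assoc]
    gcongr
    refine ContinuousLinearMap.opNorm_le_bound _ (by positivity) fun u => ?_
    refine ContinuousAlternatingMap.opNorm_le_bound _ (by positivity) fun v => ?_
    calc ‖θ u * α v‖ = ‖θ u‖ * ‖α v‖ := norm_mul _ _
      _ ≤ (‖θ‖ * ‖u‖) * (‖α‖ * ∏ i, ‖v i‖) := by
        gcongr
        · exact θ.le_opNorm u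
        · exact α.le_opNorm v
      _ = _ := by ring

theorem contDiff_wedgeLeft (n j : ℕ) :
    ContDiff ℝ ∞ fun σ : Cn n →L[ℂ] ℂ => (wedgeLeft j σ).restrictScalars ℝ := by
  refine IsBoundedLinearMap.contDiff (𝕜 := ℝ) ⟨⟨fun _ _ => ?_, fun _ _ => ?_⟩, j + 1, by positivity,
    fun σ => ?_⟩
  · ext; simp [wedgeLeft]
  · ext; simp [wedgeLeft]
  · refine ContinuousLinearMap.opNorm_le_bound _ (by positivity) fun e => ?_
    refine (ContinuousAlternatingMap.norm_alternatizeUncurryFin_le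
      (ContinuousLinearMap.smulRightL ℂ (Cn n) (CotExt n j) σ e)).trans ?_
    rw [mul_assoc]
    gcongr
    exact (ContinuousLinearMap.norm_smulRight_apply σ e).le

/-- Contraction of an exterior covector with a vector. -/
def contract {n : ℕ} (j : ℕ) (h : Cn n) : CotExt n (j + 1) →L[ℂ] CotExt n j :=
  LinearMap.mkContinuous
    { toFun := fun e => e.curryLeft h
      map_add' := fun _ _ => rfl
      map_smul' := fun _ _ => rfl } ‖h‖ fun e => by
    rw [mul_comm, ← e.norm_curryLeft]
    exact e.curryLeft.le_opNorm h

@[simp] theorem contract_apply {n j : ℕ} (h : Cn n) (e : CotExt n (j + 1)) (w : Fin j → Cn n) :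
    contract j h e w = e (Matrix.vecCons h w) := rfl

theorem contDiff_contract (n j : ℕ) :
    ContDiff ℝ ∞ fun h : Cn n => (contract j h).restrictScalars ℝ := by
  refine IsBoundedLinearMap.contDiff (𝕜 := ℝ) ⟨⟨fun _ _ => ?_, fun _ _ => ?_⟩, 1, by positivity,
    fun h => ?_⟩
  · ext e; simp [← ContinuousAlternatingMap.curryLeft_apply_apply]
  · ext e; simp [← ContinuousAlternatingMap.curryLeft_apply_apply]
  · rw [one_mul]
    refine ContinuousLinearMap.opNorm_le_bound _ (norm_nonneg h) fun e => ?_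
    rw [mul_comm, ← e.norm_curryLeft]
    exact e.curryLeft.le_opNorm h

theorem isBoundedBilinearMap_compContinuousAlternatingMap (n p : ℕ) (V W : Type*)
    [NormedAddCommGroup V] [NormedSpace ℝ V] [NormedAddCommGroup W] [NormedSpace ℝ W] :
    IsBoundedBilinearMap ℝ fun x : (V →L[ℝ] W) × (Cn n [⋀^Fin p]→L[ℝ] V) =>
      x.1.compContinuousAlternatingMap x.2 where
  add_left _ _ _ := by ext v; simp
  smul_left c θ α := by ext v; simp
  add_right _ _ _ := by ext v; simp
  smul_right c θ α := by ext v; simp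
  bound := ⟨1, by positivity, fun θ α => by
    rw [one_mul]; exact θ.norm_compContinuousAlternatingMap_le α⟩

end BilinearOperations

/-! ### Exterior derivative, Leibniz rules and types -/

section ScalarForms

variable {n p : ℕ} {U : Set (Cn n)} {z : Cn n}

theorem contDiffOn_extDeriv {F : Type*} [NormedAddCommGroup F] [NormedSpace ℝ F]
    {α : Cn n → Cn n [⋀^Fin p]→L[ℝ] F} (hU : IsOpen U) (hα : ContDiffOn ℝ ∞ α U) :
    ContDiffOn ℝ ∞ (extDeriv α) U :=
  (ContinuousAlternatingMap.alternatizeUncurryFinCLM ℝ (Cn n) F).contDiff.comp_contDiffOn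
    (hα.fderiv_of_isOpen hU (by simp))

theorem differentiableAt_of_contDiffOn {F : Type*} [NormedAddCommGroup F] [NormedSpace ℝ F]
    {α : Cn n → F} (hU : IsOpen U) (hα : ContDiffOn ℝ ∞ α U) (hz : z ∈ U) :
    DifferentiableAt ℝ α z :=
  (hα.contDiffAt (hU.mem_nhds hz)).differentiableAt (by simp)

theorem contDiffOn_wedge {θ : Cn n → Cn n →L[ℝ] ℂ} {α : Cn n → Cn n [⋀^Fin p]→L[ℝ] ℂ}
    (hθ : ContDiffOn ℝ ∞ θ U) (hα : ContDiffOn ℝ ∞ α U) :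
    ContDiffOn ℝ ∞ (fun z => wedge (θ z) (α z)) U := by
  have h1 : ContDiff ℝ ∞ fun x : (Cn n →L[ℝ] ℂ) × (Cn n [⋀^Fin p]→L[ℝ] ℂ) => wedge x.1 x.2 :=
    (isBoundedBilinearMap_wedge n p).contDiff
  exact h1.comp_contDiffOn (hθ.prodMk hα)

/-- The Leibniz rule for the product of a function and a form. -/
theorem extDeriv_fun_smul_form {c : Cn n → ℂ} {α : Cn n → Cn n [⋀^Fin p]→L[ℝ] ℂ}
    (hc : DifferentiableAt ℝ c z) (hα : DifferentiableAt ℝ α z) :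
    extDeriv (fun z => c z • α z) z = wedge (fderiv ℝ c z) (α z) + c z • extDeriv α z := by
  have h : fderiv ℝ (fun z => c z • α z) z = c z • fderiv ℝ α z + (fderiv ℝ c z).smulRight (α z) := by
    have h := (ContinuousLinearMap.lsmul ℝ ℂ :
      ℂ →L[ℝ] (Cn n [⋀^Fin p]→L[ℝ] ℂ) →L[ℝ] _).hasFDerivAt_of_bilinear hc.hasFDerivAt hα.hasFDerivAt
    refine h.fderiv.trans ?_
    ext u v
    simp
  rw [extDeriv, h, ContinuousAlternatingMap.alternatizeUncurryFin_add, wedge_eq]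
  refine (add_comm _ _).trans ?_
  congr 1
  ext v
  simp [ContinuousAlternatingMap.alternatizeUncurryFin_apply, extDeriv, Finset.mul_sum]

theorem extDeriv_extDeriv_of_mem {F : Type*} [NormedAddCommGroup F] [NormedSpace ℝ F]
    {α : Cn n → Cn n [⋀^Fin p]→L[ℝ] F} (hU : IsOpen U) (hα : ContDiffOn ℝ ∞ α U) (hz : z ∈ U) :
    extDeriv (extDeriv α) z = 0 :=
  extDeriv_extDeriv_apply (hα.contDiffAt (hU.mem_nhds hz)) (by
    rw [minSmoothness_of_isRCLikeNormedField]; exact ENat.LEInfty.out)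

/-- `d (dc ∧ α) = - dc ∧ dα`. -/
theorem extDeriv_wedge_fderiv {c : Cn n → ℂ} {α : Cn n → Cn n [⋀^Fin p]→L[ℝ] ℂ} (hU : IsOpen U)
    (hc : ContDiffOn ℝ ∞ c U) (hα : ContDiffOn ℝ ∞ α U) (hz : z ∈ U) :
    extDeriv (fun z => wedge (fderiv ℝ c z) (α z)) z = -wedge (fderiv ℝ c z) (extDeriv α z) := by
  have hd : ∀ w ∈ U, DifferentiableAt ℝ c w := fun w hw => differentiableAt_of_contDiffOn hU hc hw
  have hαd : ∀ w ∈ U, DifferentiableAt ℝ α w := fun w hw => differentiableAt_of_contDiffOn hU hα hw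
  have hcα : ContDiffOn ℝ ∞ (fun z => c z • α z) U := hc.smul hα
  have hdα := contDiffOn_extDeriv hU hα
  have hdcα := contDiffOn_extDeriv hU hcα
  -- By the Leibniz rule dc ∧ α = d(cα) - c dα. A further derivative kills the first term, and the
  -- second is treated by Leibniz again.
  have hev : (fun z => wedge (fderiv ℝ c z) (α z)) =ᶠ[nhds z]
      extDeriv (fun z => c z • α z) + (-1 : ℝ) • fun z => c z • extDeriv α z := by
    filter_upwards [hU.mem_nhds hz] with w hw
    simp [extDeriv_fun_smul_form (hd w hw) (hαd w hw)]
  have h1 : DifferentiableAt ℝ (fun z => c z • extDeriv α z) z :=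
    differentiableAt_of_contDiffOn hU (hc.smul hdα) hz
  rw [hev.extDeriv_eq, extDeriv_add (differentiableAt_of_contDiffOn hU hdcα hz)
    (h1.const_smul _), extDeriv_extDeriv_of_mem hU hcα hz, extDeriv_smul,
    extDeriv_fun_smul_form (hd z hz) (differentiableAt_of_contDiffOn hU hdα hz),
    extDeriv_extDeriv_of_mem hU hα hz]
  simp

theorem fderiv_hasWeight {m : ℤ} {α : Cn n → Cn n [⋀^Fin p]→L[ℝ] ℂ} (hU : IsOpen U)
    (hα : DifferentiableAt ℝ α z) (hw : ∀ z ∈ U, HasWeight m (α z)) (hz : z ∈ U) (u : Cn n) :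
    HasWeight m (fderiv ℝ α z u) := by
  intro c hc v
  rw [← fderiv_continuousAlternatingMap_apply_const_apply hα,
    ← fderiv_continuousAlternatingMap_apply_const_apply hα]
  have hev : (fun y => α y fun a => c • v a) =ᶠ[nhds z] fun y => c ^ m • α y v := by
    filter_upwards [hU.mem_nhds hz] with y hy using hw y hy c hc v
  have hd : DifferentiableAt ℝ (fun y => α y v) z :=
    (ContinuousAlternatingMap.apply ℝ (Cn n) ℂ v).differentiableAt.comp z hα
  rw [hev.fderiv_eq, fderiv_fun_const_smul hd]
  rfl

/-- `d` sends forms of type `(n, k)` to forms of type `(n, k + 1)`. -/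
theorem extDeriv_hasWeight {m : ℤ} {α : Cn n → Cn n [⋀^Fin p]→L[ℝ] ℂ} (hU : IsOpen U)
    (hα : DifferentiableAt ℝ α z) (hw : ∀ z ∈ U, HasWeight m (α z)) (hz : z ∈ U)
    (h : 2 * (n : ℤ) ≤ p + m) : HasWeight (m - 1) (extDeriv α z) := by
  set D := fderiv ℝ α z with hD
  let J : Cn n →L[ℝ] Cn n := (Complex.I • ContinuousLinearMap.id ℂ (Cn n)).restrictScalars ℝ
  have hJ : ∀ u, J u = Complex.I • u := fun u => rfl
  let K : (Cn n [⋀^Fin p]→L[ℝ] ℂ) →L[ℝ] Cn n [⋀^Fin p]→L[ℝ] ℂ :=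
    ContinuousLinearMap.lsmul ℝ ℂ Complex.I
  -- A and B are the complex linear and antilinear parts of the derivative, which alternate to ∂α
  -- and ∂̄α. The first vanishes for reasons of type; the second has its weight lowered by one.
  let A : Cn n →L[ℝ] Cn n [⋀^Fin p]→L[ℝ] ℂ := (1 / 2 : ℝ) • (D - K.comp (D.comp J))
  let B : Cn n →L[ℝ] Cn n [⋀^Fin p]→L[ℝ] ℂ := (1 / 2 : ℝ) • (D + K.comp (D.comp J))
  have hAv : ∀ u v, A u v = 1 / 2 * (D u v - Complex.I * D (Complex.I • u) v) := fun u v => by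
    simp [A, K, hJ]
  have hBv : ∀ u v, B u v = 1 / 2 * (D u v + Complex.I * D (Complex.I • u) v) := fun u v => by
    simp [B, K, hJ, mul_add]
  have hDI : ∀ u v, D (Complex.I • Complex.I • u) v = -D u v := fun u v => by
    rw [smul_smul, Complex.I_mul_I, neg_one_smul, map_neg]; rfl
  have hDw := fderiv_hasWeight hU hα hw hz
  have hsum : D = A + B := by
    ext u v; rw [add_apply, ContinuousAlternatingMap.add_apply, hAv, hBv]; ring
  have hA : ContinuousAlternatingMap.alternatizeUncurryFin A = 0 := by
    refine alternatize_eq_zero_of_hasWeight (m := m) (fun u c hc v => ?_) (fun u => ?_) h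
    · rw [hAv, hAv, hD, hDw u c hc v, hDw (Complex.I • u) c hc v]
      ring
    · ext v
      rw [ContinuousAlternatingMap.smul_apply, hAv, hAv, hDI, smul_eq_mul]
      linear_combination 1 / 2 * D (Complex.I • u) v * Complex.I_sq
  have hBc : ∀ (c : ℂ), ‖c‖ = 1 → ∀ u, B (c • u) = c⁻¹ • B u := by
    intro c hc u
    have hinv : c⁻¹ = starRingEnd ℂ c := Complex.inv_eq_conj hc
    have hBI : B (Complex.I • u) = -(Complex.I • B u) := by
      ext v
      rw [ContinuousAlternatingMap.neg_apply, ContinuousAlternatingMap.smul_apply, hBv, hBv, hDI,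
        smul_eq_mul]
      linear_combination 1 / 2 * D (Complex.I • u) v * Complex.I_sq
    have : c • u = c.re • u + c.im • (Complex.I • u) := by
      conv_lhs => rw [← Complex.re_add_im c, add_smul, mul_smul]
      rfl
    rw [this, map_add, map_smul, map_smul, hBI, hinv]
    ext v
    simp only [ContinuousAlternatingMap.add_apply, ContinuousAlternatingMap.smul_apply,
      ContinuousAlternatingMap.neg_apply, smul_eq_mul, Complex.real_smul]
    have hc' : starRingEnd ℂ c = c.re - c.im * Complex.I := by
      apply Complex.ext <;> simp
    rw [hc']
    ring
  have hBw : ∀ u, HasWeight m (B u) := by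
    intro u c hc v
    rw [hBv, hBv, hD, hDw u c hc v, hDw (Complex.I • u) c hc v]
    ring
  intro c hc v
  have hc0 : c ≠ 0 := fun h => by simp [h] at hc
  rw [extDeriv, ← hD, hsum, ContinuousAlternatingMap.alternatizeUncurryFin_add, hA, zero_add]
  simp only [ContinuousAlternatingMap.alternatizeUncurryFin_apply, Finset.mul_sum]
  refine Finset.sum_congr rfl fun i _ => ?_
  rw [hBc c hc, ContinuousAlternatingMap.smul_apply]
  have h' : (i.removeNth fun a => c • v a) = fun a => c • i.removeNth v a := rfl
  rw [h', hBw _ c hc, zpow_sub₀ hc0, zpow_one]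
  simp only [smul_eq_mul, zsmul_eq_mul]
  field_simp

theorem wedge_eq_zero_of_hasWeight {m : ℤ} (σ : Cn n →L[ℂ] ℂ) {α : Cn n [⋀^Fin p]→L[ℝ] ℂ}
    (hw : HasWeight m α) (h : 2 * (n : ℤ) ≤ p + m) : wedge (σ.restrictScalars ℝ) α = 0 := by
  rw [wedge_eq]
  refine alternatize_eq_zero_of_hasWeight (m := m) (fun u c hc v => ?_) (fun u => ?_) h
  · simp [hw c hc v, mul_left_comm]
  · ext v; simp [mul_assoc]

/-- Forms of type `(n, k)` are annihilated by differentials of holomorphic functions. -/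
theorem wedge_fderiv_eq_zero {m : ℤ} {c : Cn n → ℂ} (hc : DifferentiableAt ℂ c z)
    {α : Cn n [⋀^Fin p]→L[ℝ] ℂ} (hw : HasWeight m α) (h : 2 * (n : ℤ) ≤ p + m) :
    wedge (fderiv ℝ c z) α = 0 := by
  rw [hc.fderiv_restrictScalars ℝ, wedge_eq_zero_of_hasWeight _ hw h]

theorem HasWeight.wedge {m m' : ℤ} {θ : Cn n →L[ℝ] ℂ} {α : Cn n [⋀^Fin p]→L[ℝ] ℂ}
    (hθ : ∀ c : ℂ, ‖c‖ = 1 → ∀ u, θ (c • u) = c ^ m' * θ u) (hα : HasWeight m α) :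
    HasWeight (m + m') (wedge θ α) := by
  intro c hc v
  have hc0 : c ≠ 0 := fun h => by simp [h] at hc
  simp only [wedge_apply, Finset.mul_sum]
  refine Finset.sum_congr rfl fun i _ => ?_
  have h' : (i.removeNth fun a => c • v a) = fun a => c • i.removeNth v a := rfl
  rw [h', hα c hc, hθ c hc, zpow_add₀ hc0]
  ring

end ScalarForms

/-! ### Forms with values in exterior powers of Ω -/

section Components

variable {n p j : ℕ} {U : Set (Cn n)} {z : Cn n}

/-- Evaluation of a `⋀ʲ Ω`-valued form on vectors `w` in the coefficient bundle. -/
def component (β : ExtForm n p j) (w : Fin j → Cn n) : Cn n → Cn n [⋀^Fin p]→L[ℝ] ℂ :=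
  fun z => ((ContinuousAlternatingMap.apply ℂ (Cn n) ℂ w).restrictScalars
    ℝ).compContinuousAlternatingMap (β z)

@[simp] theorem component_apply (β : ExtForm n p j) (w : Fin j → Cn n) (v : Fin p → Cn n) :
    component β w z v = β z v w := rfl

theorem ext_component {β β' : ExtForm n p j} (h : ∀ w, component β w z = component β' w z) :
    β z = β' z := by
  ext v w
  exact congrArg (fun η => η v) (h w)

theorem contDiffOn_component {β : ExtForm n p j} (hβ : ContDiffOn ℝ ∞ β U) (w : Fin j → Cn n) :
    ContDiffOn ℝ ∞ (component β w) U :=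
  (isBoundedBilinearMap_compContinuousAlternatingMap n p (CotExt n j) ℂ).contDiff.comp_contDiffOn
    (contDiffOn_const.prodMk hβ)

/-- Evaluation on fixed vectors is a constant linear map on the coefficients, so it commutes with d.
This carries the rules for complex-valued forms over to vector-valued ones. -/
theorem extDeriv_component {β : ExtForm n p j} (hβ : DifferentiableAt ℝ β z) (w : Fin j → Cn n) :
    extDeriv (component β w) z = component (extDeriv β) w z := by
  have h := ((isBoundedBilinearMap_compContinuousAlternatingMap n p (CotExt n j)
    ℂ).isBoundedLinearMap_right ((ContinuousAlternatingMap.apply ℂ (Cn n) ℂ w).restrictScalars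
    ℝ)).hasFDerivAt.comp z hβ.hasFDerivAt
  have h' : fderiv ℝ (component β w) z = _ := h.fderiv
  ext v
  rw [extDeriv, h', component_apply, extDeriv]
  simp only [ContinuousAlternatingMap.alternatizeUncurryFin_apply]
  have hs : ∀ (s : Finset (Fin (p + 1))) (g : Fin (p + 1) → CotExt n j),
      (∑ i ∈ s, g i) w = ∑ i ∈ s, g i w := fun s g =>
    map_sum (ContinuousAlternatingMap.apply ℂ (Cn n) ℂ w) g s
  rw [hs]
  refine Finset.sum_congr rfl fun i _ => ?_
  simp only [ContinuousLinearMap.comp_apply]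
  rfl

theorem wedgeLeft_apply (σ : Cn n →L[ℂ] ℂ) (e : CotExt n j) (w : Fin (j + 1) → Cn n) :
    wedgeLeft j σ e w = ∑ a : Fin (j + 1), (-1 : ℂ) ^ (a : ℕ) * (σ (w a) * e (a.removeNth w)) := by
  simp [wedgeLeft, ContinuousAlternatingMap.alternatizeUncurryFin_apply,
    ContinuousLinearMap.smulRightL]

theorem component_koszul (s : Cn n → Cn n →L[ℂ] ℂ) (β : ExtForm n p j) (w : Fin (j + 1) → Cn n) :
    component (koszul s β) w z = (-1 : ℂ) ^ p • ∑ a : Fin (j + 1),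
      (-1 : ℂ) ^ (a : ℕ) • s z (w a) • component β (a.removeNth w) z := by
  ext v
  simp [koszul, wedgeLeft_apply]

theorem contDiffOn_koszul {s : Cn n → Cn n →L[ℂ] ℂ} {β : ExtForm n p j}
    (hs : ContDiffOn ℝ ∞ s U) (hβ : ContDiffOn ℝ ∞ β U) : ContDiffOn ℝ ∞ (koszul s β) U := by
  have h := (isBoundedBilinearMap_compContinuousAlternatingMap n p (CotExt n j)
    (CotExt n (j + 1))).contDiff.comp_contDiffOn
      (((contDiff_wedgeLeft n j).comp_contDiffOn hs).prodMk hβ)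
  exact ContDiffOn.const_smul _ h

theorem extDeriv_sum {ι : Type*} (t : Finset ι) {α : ι → Cn n → Cn n [⋀^Fin p]→L[ℝ] ℂ}
    (h : ∀ i ∈ t, DifferentiableAt ℝ (α i) z) :
    extDeriv (fun z => ∑ i ∈ t, α i z) z = ∑ i ∈ t, extDeriv (α i) z := by
  simp only [extDeriv]
  rw [fderiv_fun_sum h, ← ContinuousAlternatingMap.alternatizeUncurryFinCLM_apply, map_sum]
  rfl

theorem extDeriv_complex_smul (c : ℂ) {α : Cn n → Cn n [⋀^Fin p]→L[ℝ] ℂ}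
    (hα : DifferentiableAt ℝ α z) :
    extDeriv (fun z => c • α z) z = c • extDeriv α z := by
  rw [extDeriv_fun_smul_form (differentiableAt_const c) hα]
  simp

/-- `d (s ∧ β) = - s ∧ dβ` for holomorphic `s` and `β` of type `(n, k)`. -/
theorem extDeriv_koszul {m : ℤ} {s : Cn n → Cn n →L[ℂ] ℂ} {β : ExtForm n p j} (hU : IsOpen U)
    (hs : ContDiffOn ℝ ∞ s U) (hsh : ∀ v, DifferentiableOn ℂ (fun z => s z v) U)
    (hβ : ContDiffOn ℝ ∞ β U) (hw : ∀ w, ∀ z ∈ U, HasWeight m (component β w z))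
    (hm : 2 * (n : ℤ) ≤ p + m) (hz : z ∈ U) :
    extDeriv (koszul s β) z = koszul s (fun z => -extDeriv β z) z := by
  have hkd := differentiableAt_of_contDiffOn hU (contDiffOn_koszul hs hβ) hz
  have hd := differentiableAt_of_contDiffOn hU hβ hz
  refine ext_component fun w => ?_
  have hcd : ∀ w, DifferentiableAt ℝ (component β w) z := fun w =>
    differentiableAt_of_contDiffOn hU (contDiffOn_component hβ w) hz
  have hsd : ∀ v, DifferentiableAt ℂ (fun z => s z v) z := fun v =>
    (hsh v).differentiableAt (hU.mem_nhds hz)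
  have hpd : ∀ a : Fin (j + 1), DifferentiableAt ℝ
      (fun z => s z (w a) • component β (a.removeNth w) z) z := fun a =>
    ((hsd (w a)).restrictScalars ℝ).smul (hcd _)
  rw [← extDeriv_component hkd, component_koszul]
  have : component (koszul s β) w = fun z => (-1 : ℂ) ^ p • ∑ a : Fin (j + 1),
      (-1 : ℂ) ^ (a : ℕ) • s z (w a) • component β (a.removeNth w) z :=
    funext fun z => component_koszul s β w
  have hpd' : ∀ a : Fin (j + 1), DifferentiableAt ℝ
      (fun z => (-1 : ℂ) ^ (a : ℕ) • s z (w a) • component β (a.removeNth w) z) z := fun a =>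
    (hpd a).const_smul ((-1 : ℂ) ^ (a : ℕ))
  -- The Koszul differential carries (-1)ᵖ on β but (-1)ᵖ⁺¹ on dβ; the sign of the formula comes
  -- from here.
  have e : ∀ S : Cn n [⋀^Fin (p + 1)]→L[ℝ] ℂ, (-1 : ℂ) ^ (p + 1) • S = (-1 : ℂ) ^ p • (-S) := by
    intro S; ext v; simp [pow_succ]
  rw [this, extDeriv_complex_smul _
      (DifferentiableAt.fun_sum fun a _ => hpd' a),
    extDeriv_sum _ (fun a _ => hpd' a), e]
  congr 1
  rw [← Finset.sum_neg_distrib]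
  refine Finset.sum_congr rfl fun a _ => ?_
  -- The Leibniz term d(s(w_a)) ∧ β vanishes, because s(w_a) is holomorphic and β already has full
  -- holomorphic degree.
  rw [extDeriv_complex_smul _ (hpd a), extDeriv_fun_smul_form ((hsd _).restrictScalars ℝ) (hcd _),
    wedge_fderiv_eq_zero (hsd _) (hw _ z hz) hm, zero_add, extDeriv_component hd]
  ext v
  simp

end Components

/-! ### Existence of Koszul lifts -/

section KoszulLift

variable {n p j : ℕ} {U : Set (Cn n)} {z : Cn n}

theorem clm_eq_sum (σ : Cn n →L[ℂ] ℂ) (v : Cn n) :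
    σ v = ∑ i, v i * σ (EuclideanSpace.single i 1) := by
  conv_lhs => rw [← (EuclideanSpace.basisFun (Fin n) ℂ).sum_repr v]
  simp

/-- Pointwise contraction of a `⋀ʲ⁺¹ Ω`-valued form with a vector field. -/
def contractForm (h : Cn n → Cn n) (β : ExtForm n p (j + 1)) : ExtForm n p j :=
  fun z => ((contract j (h z)).restrictScalars ℝ).compContinuousAlternatingMap (β z)

theorem contDiffOn_contractForm {h : Cn n → Cn n} {β : ExtForm n p (j + 1)}
    (hh : ContDiffOn ℝ ∞ h U) (hβ : ContDiffOn ℝ ∞ β U) :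
    ContDiffOn ℝ ∞ (contractForm h β) U :=
  (isBoundedBilinearMap_compContinuousAlternatingMap n p (CotExt n (j + 1))
    (CotExt n j)).contDiff.comp_contDiffOn
      (((contDiff_contract n j).comp_contDiffOn hh).prodMk hβ)

/-- The antiderivation rule for contraction: expanding σ ∧ e with h as first argument splits off
σ(h) e, and the remaining terms are those of the left side with opposite sign. -/
theorem wedgeLeft_contract (σ : Cn n →L[ℂ] ℂ) (h : Cn n) (e : CotExt n (j + 1))
    (w : Fin (j + 1) → Cn n) : wedgeLeft j σ (contract j h e) w =
      σ h * e w - contract (j + 1) h (wedgeLeft (j + 1) σ e) w := by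
  rw [contract_apply, wedgeLeft_apply, wedgeLeft_apply, Fin.sum_univ_succ (n := j + 1)]
  have h0 : (0 : Fin (j + 2)).removeNth (Matrix.vecCons h w) = w := by
    ext1 a; simp [Fin.removeNth]
  have h1 : ∀ a : Fin (j + 1), a.succ.removeNth (Matrix.vecCons h w) =
      Matrix.vecCons h (a.removeNth w) := by
    intro a
    ext1 b
    refine Fin.cases ?_ (fun b => ?_) b
    · simp [Fin.removeNth]
    · simp [Fin.removeNth]
  simp only [h0, h1, contract_apply, Matrix.cons_val_zero, Matrix.cons_val_succ, Fin.val_zero,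
    pow_zero, one_mul, Fin.val_succ, pow_succ]
  simp

/-- Contraction with `h` is a homotopy for the Koszul differential when `s(h) = 1`. -/
theorem koszul_contractForm {s : Cn n → Cn n →L[ℂ] ℂ} {h : Cn n → Cn n}
    {β : ExtForm n p (j + 1)} (hs : s z (h z) = 1) (hk : koszul s β z = 0) :
    koszul s (fun z => (-1 : ℝ) ^ p • contractForm h β z) z = β z := by
  ext v w
  have hk' : ((-1 : ℝ) ^ p • wedgeLeft (j + 1) (s z) (β z v)) (Matrix.vecCons (h z) w) = 0 :=
    congrArg (fun η => η v (Matrix.vecCons (h z) w)) hk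
  have hk'' : contract (j + 1) (h z) (wedgeLeft (j + 1) (s z) (β z v)) w = 0 := by
    rw [contract_apply]
    simpa using hk'
  have := wedgeLeft_contract (s z) (h z) (β z v) w
  rw [hk'', sub_zero, hs, one_mul] at this
  have h2 : (-1 : ℝ) ^ p * (-1) ^ p = 1 := by rw [← mul_pow]; simp
  simp only [koszul]
  change ((-1 : ℝ) ^ p • wedgeLeft j (s z) ((-1 : ℝ) ^ p • contract j (h z) (β z v))) w = _
  rw [ContinuousLinearMap.map_smul_of_tower, smul_smul, h2, one_smul, this]

/-- `dz₁ ∧ ⋯ ∧ dzₙ` in degree `n`, and zero in other degrees. -/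
def topCot (n m : ℕ) : CotExt n m :=
  if h : n = m then h ▸ topForm n else 0

/-- There are no nonzero exterior forms of degree n + 1, so ψ is Koszul closed. Admitting every m
frees the recursion in `koszulLift` from index constraints. -/
theorem wedgeLeft_topCot (σ : Cn n →L[ℂ] ℂ) (m : ℕ) : wedgeLeft m σ (topCot n m) = 0 := by
  by_cases h : n = m
  · subst h
    ext w
    refine (wedgeLeft n σ (topCot n n)).toAlternatingMap.map_linearDependent w fun hli => ?_
    simpa using hli.fintype_card_le_finrank
  · simp [topCot, h]

/-- The form `dz₁ ∧ ⋯ ∧ dzₙ` as a real multilinear form. -/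
def topFormReal (n : ℕ) : Cn n [⋀^Fin n]→L[ℝ] ℂ := (topForm n).restrictScalars ℝ

theorem topFormReal_apply (v : Fin n → Cn n) : topFormReal n v = topForm n v := rfl

theorem topFormReal_hasWeight : HasWeight n (topFormReal n) := by
  intro c _ v
  have := (topForm n).toMultilinearMap.map_smul_univ (fun _ => c) v
  rw [zpow_natCast]
  change topForm n _ = c ^ n * topForm n v
  simpa using this

/-- The section `φ dz₁ ∧ ⋯ ∧ dzₙ ⊗ e₁ ∧ ⋯ ∧ eₙ`, extended by zero to all degrees. -/
def topSectionIn (φ : Cn n → ℂ) (m : ℕ) : ExtForm n n m := fun z =>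
  ((ContinuousLinearMap.toSpanSingleton ℂ
    (φ z • topCot n m)).restrictScalars ℝ).compContinuousAlternatingMap (topFormReal n)

theorem topSectionIn_apply (φ : Cn n → ℂ) (m : ℕ) (v : Fin n → Cn n) (w : Fin m → Cn n) :
    topSectionIn φ m z v w = topForm n v * (φ z * topCot n m w) := rfl

theorem component_topSectionIn (φ : Cn n → ℂ) (m : ℕ) (w : Fin m → Cn n) :
    component (topSectionIn φ m) w = fun z => φ z • topCot n m w • topFormReal n := by
  ext z v
  simp only [component_apply, topSectionIn_apply, ContinuousAlternatingMap.smul_apply,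
    smul_eq_mul, topFormReal_apply]
  ring

theorem koszul_topSectionIn (s : Cn n → Cn n →L[ℂ] ℂ) (φ : Cn n → ℂ) (m : ℕ) :
    koszul s (topSectionIn φ m) z = 0 := by
  ext v w
  change ((-1 : ℝ) ^ n • wedgeLeft m (s z) (topForm n v • φ z • topCot n m)) w = 0
  simp [wedgeLeft_topCot]

theorem contDiffOn_topSectionIn {φ : Cn n → ℂ} (hφ : ContDiffOn ℝ ∞ φ U) (m : ℕ) :
    ContDiffOn ℝ ∞ (topSectionIn φ m) U := by
  have h : ContDiff ℝ ∞ fun c : ℂ =>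
      (ContinuousLinearMap.toSpanSingleton ℂ (c • topCot n m)).restrictScalars ℝ := by
    refine IsBoundedLinearMap.contDiff (𝕜 := ℝ) ⟨⟨fun _ _ => ?_, fun _ _ => ?_⟩,
      ‖topCot n m‖ + 1, by positivity, fun c => ?_⟩
    · ext; simp [add_mul, mul_add]
    · ext; simp [mul_left_comm, mul_assoc]
    · refine ContinuousLinearMap.opNorm_le_bound _ (by positivity) fun e => ?_
      have h1 : ‖e • c • topCot n m‖ = ‖e‖ * (‖c‖ * ‖topCot n m‖) := by
        rw [norm_smul, norm_smul]
      refine h1.le.trans ?_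
      have := mul_nonneg (norm_nonneg c) (norm_nonneg e)
      nlinarith
  exact (isBoundedBilinearMap_compContinuousAlternatingMap n n ℂ
    (CotExt n m)).contDiff.comp_contDiffOn ((h.comp_contDiffOn hφ).prodMk contDiffOn_const)

theorem extDeriv_topSectionIn {φ : Cn n → ℂ} (hU : IsOpen U) (hφ : ContDiffOn ℝ ∞ φ U)
    (hφh : DifferentiableOn ℂ φ U) (m : ℕ) (hz : z ∈ U) : extDeriv (topSectionIn φ m) z = 0 := by
  have hd := differentiableAt_of_contDiffOn hU (contDiffOn_topSectionIn hφ m) hz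
  refine ext_component (β' := 0) fun w => ?_
  rw [← extDeriv_component hd, component_topSectionIn,
    extDeriv_fun_smul_form (differentiableAt_of_contDiffOn hU hφ hz) (differentiableAt_const _),
    wedge_smul_right,
    wedge_fderiv_eq_zero (hφh.differentiableAt (hU.mem_nhds hz)) topFormReal_hasWeight (by lia)]
  ext v
  simp [extDeriv, ContinuousAlternatingMap.alternatizeUncurryFin_apply]

/-- The lift of `φ dz₁ ∧ ⋯ ∧ dzₙ ⊗ e₁ ∧ ⋯ ∧ eₙ` produced by the homotopy `h`. -/
def koszulLift (φ : Cn n → ℂ) (h : Cn n → Cn n) : ∀ k j : ℕ, ExtForm n (n + k) j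
  | 0, j => fun z => (-1 : ℝ) ^ n • contractForm h (topSectionIn φ (j + 1)) z
  | k + 1, j => fun z =>
    (-1 : ℝ) ^ (n + (k + 1)) • contractForm h (extDeriv (koszulLift φ h k (j + 1))) z

theorem contDiffOn_koszulLift {φ : Cn n → ℂ} {h : Cn n → Cn n} (hU : IsOpen U)
    (hφ : ContDiffOn ℝ ∞ φ U) (hh : ContDiffOn ℝ ∞ h U) :
    ∀ k j, ContDiffOn ℝ ∞ (koszulLift φ h k j) U
  | 0, j => (contDiffOn_contractForm hh (contDiffOn_topSectionIn hφ (j + 1))).const_smul _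
  | k + 1, j => (contDiffOn_contractForm hh
      (contDiffOn_extDeriv hU (contDiffOn_koszulLift hU hφ hh k (j + 1)))).const_smul _

/-- Contraction acts on the coefficients only and leaves the type of the form alone, while each d
lowers the weight by one. -/
theorem koszulLift_hasWeight {φ : Cn n → ℂ} {h : Cn n → Cn n} (hU : IsOpen U)
    (hφ : ContDiffOn ℝ ∞ φ U) (hh : ContDiffOn ℝ ∞ h U) :
    ∀ (k j : ℕ) (w : Fin j → Cn n), ∀ z ∈ U, HasWeight ((n : ℤ) - k) (component (koszulLift φ h k j) w z)
  | 0, j, w, z, hz => by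
    intro c hc v
    have : topForm n (fun a : Fin n => c • v a) = c ^ (n : ℤ) * topForm n v :=
      topFormReal_hasWeight c hc v
    rw [component_apply, component_apply]
    change ((-1 : ℝ) ^ n • topSectionIn φ (j + 1) z _) _ =
      _ * ((-1 : ℝ) ^ n • topSectionIn φ (j + 1) z _) _
    simp only [ContinuousAlternatingMap.smul_apply, topSectionIn_apply]
    refine (congrArg (fun t : ℂ => (-1 : ℝ) ^ n •
      (t * (φ z * topCot n (j + 1) (Matrix.vecCons (h z) w)))) this).trans ?_
    simp only [Complex.real_smul, zpow_natCast, Nat.cast_zero, sub_zero]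
    rw [show (Fin.cons (h z) w : Fin (j + 1) → Cn n) = Matrix.vecCons (h z) w from rfl]
    ring
  | k + 1, j, w, z, hz => by
    have hs := contDiffOn_koszulLift hU hφ hh k (j + 1)
    have hd := differentiableAt_of_contDiffOn hU hs hz
    have h1 := extDeriv_hasWeight hU (differentiableAt_of_contDiffOn hU
      (contDiffOn_component hs (Matrix.vecCons (h z) w)) hz)
      (koszulLift_hasWeight hU hφ hh k (j + 1) (Matrix.vecCons (h z) w)) hz
      (by push_cast; omega)
    rw [extDeriv_component hd] at h1
    intro c hc v
    have h2 := h1 c hc v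
    simp only [component_apply] at h2 ⊢
    change ((-1 : ℝ) ^ (n + (k + 1)) • extDeriv (koszulLift φ h k (j + 1)) z _) _ =
      _ * ((-1 : ℝ) ^ (n + (k + 1)) • extDeriv (koszulLift φ h k (j + 1)) z _) _
    rw [ContinuousAlternatingMap.smul_apply, ContinuousAlternatingMap.smul_apply]
    change (-1 : ℝ) ^ (n + (k + 1)) • (extDeriv (koszulLift φ h k (j + 1)) z _
      (Matrix.vecCons (h z) w)) = _ * ((-1 : ℝ) ^ (n + (k + 1)) •
      (extDeriv (koszulLift φ h k (j + 1)) z _ (Matrix.vecCons (h z) w)))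
    refine (congrArg (fun t : ℂ => (-1 : ℝ) ^ (n + (k + 1)) • t) h2).trans ?_
    have h3 : (n : ℤ) - k - 1 = n - (k + 1 : ℕ) := by push_cast; ring
    rw [mul_smul_comm, h3]

/-- A form of weight `n - k` and degree `n + k` is of type `(n, k)`. -/
theorem HasWeight.apply_smul {k : ℕ} {α : Cn n [⋀^Fin (n + k)]→L[ℝ] ℂ}
    (hα : HasWeight ((n : ℤ) - k) α) (c : ℂ) (v : Fin (n + k) → Cn n) :
    α (fun a => c • v a) = c ^ n * (starRingEnd ℂ c) ^ k * α v := by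
  -- In c = ‖c‖ u, real homogeneity accounts for ‖c‖ⁿ⁺ᵏ and the weight for uⁿ⁻ᵏ; together they are
  -- cⁿ c̄ᵏ.
  set u := Complex.exp (Complex.arg c * Complex.I) with hu
  have hu1 : ‖u‖ = 1 := Complex.norm_exp_ofReal_mul_I _
  have hc : c = ‖c‖ * u := (Complex.norm_mul_exp_arg_mul_I c).symm
  have hu0 : u ≠ 0 := Complex.exp_ne_zero _
  have h1 : (fun a => c • v a) = fun a => (‖c‖ : ℝ) • (fun a => u • v a) a := by
    ext1 a
    conv_lhs => rw [hc, mul_smul]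
    rfl
  have h2 := α.toMultilinearMap.map_smul_univ (fun _ => ‖c‖) (fun a => u • v a)
  have h3 : α (fun a => c • v a) = (∏ _i : Fin (n + k), ‖c‖) • α (fun a => u • v a) := by
    rw [h1]; exact h2
  rw [h3, hα u hu1]
  conv_rhs => rw [hc]
  rw [map_mul, Complex.conj_ofReal, ← Complex.inv_eq_conj hu1, zpow_sub₀ hu0]
  simp only [Finset.prod_const, Finset.card_univ, Fintype.card_fin, Complex.real_smul, mul_pow,
    zpow_natCast, pow_add, inv_pow, Complex.ofReal_mul, Complex.ofReal_pow]
  field_simp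

theorem koszul_koszulLift_zero {s : Cn n → Cn n →L[ℂ] ℂ} {φ : Cn n → ℂ} {h : Cn n → Cn n}
    (hs : s z (h z) = 1) (j : ℕ) :
    koszul s (koszulLift φ h 0 j) z = topSectionIn φ (j + 1) z :=
  koszul_contractForm hs (koszul_topSectionIn s φ (j + 1))

/-- By the homotopy identity it suffices that s ∧ dβ_k = 0. This is -d(s ∧ β_k), and s ∧ β_k is
either ψ, which is closed for reasons of type, or the exact form dβ_{k-1}. -/
theorem koszul_koszulLift_succ {s : Cn n → Cn n →L[ℂ] ℂ} {φ : Cn n → ℂ} {h : Cn n → Cn n}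
    (hU : IsOpen U) (hs : ContDiffOn ℝ ∞ s U)
    (hsh : ∀ v, DifferentiableOn ℂ (fun z => s z v) U)
    (hφ : ContDiffOn ℝ ∞ φ U) (hφh : DifferentiableOn ℂ φ U) (hh : ContDiffOn ℝ ∞ h U)
    (h1 : ∀ z ∈ U, s z (h z) = 1) : ∀ k j, ∀ z ∈ U,
    koszul s (koszulLift φ h (k + 1) j) z = extDeriv (koszulLift φ h k (j + 1)) z := by
  have key : ∀ k j, (∀ z ∈ U, extDeriv (koszul s (koszulLift φ h k (j + 1))) z = 0) → ∀ z ∈ U,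
      koszul s (koszulLift φ h (k + 1) j) z = extDeriv (koszulLift φ h k (j + 1)) z := by
    intro k j hd z hz
    refine koszul_contractForm (h1 z hz) ?_
    have h2 := extDeriv_koszul hU hs hsh (contDiffOn_koszulLift hU hφ hh k (j + 1))
      (koszulLift_hasWeight hU hφ hh k (j + 1)) (by push_cast; omega) hz
    rw [hd z hz] at h2
    ext v w
    have h3 := congrArg (fun η => η v w) h2
    simp only [koszul] at h3 ⊢
    simpa using h3
  intro k
  induction k with
  | zero =>
    intro j
    refine key 0 j fun z hz => ?_
    have hev : koszul s (koszulLift φ h 0 (j + 1)) =ᶠ[nhds z] topSectionIn φ (j + 2) := by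
      filter_upwards [hU.mem_nhds hz] with y hy using koszul_koszulLift_zero (h1 y hy) (j + 1)
    rw [hev.extDeriv_eq]
    exact extDeriv_topSectionIn hU hφ hφh (j + 2) hz
  | succ k ih =>
    intro j
    refine key (k + 1) j fun z hz => ?_
    have hev : koszul s (koszulLift φ h (k + 1) (j + 1)) =ᶠ[nhds z]
        extDeriv (koszulLift φ h k (j + 2)) := by
      filter_upwards [hU.mem_nhds hz] with y hy using ih (j + 1) y hy
    rw [hev.extDeriv_eq]
    exact extDeriv_extDeriv_of_mem hU (contDiffOn_koszulLift hU hφ hh k (j + 2)) hz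

/-- The field is h = s̄ / |s|². It is smooth but in general not holomorphic, which is where the
antiholomorphic degrees of the lift come from. -/
theorem exists_smooth_dual {s : Cn n → Cn n →L[ℂ] ℂ} (hs : ContDiffOn ℝ ∞ s U)
    (h0 : ∀ z ∈ U, s z ≠ 0) : ∃ h : Cn n → Cn n, ContDiffOn ℝ ∞ h U ∧ ∀ z ∈ U, s z (h z) = 1 := by
  let F : Fin n → Cn n → ℂ := fun i z => s z (EuclideanSpace.single i 1)
  have hF : ∀ i, ContDiffOn ℝ ∞ (F i) U := fun i =>
    ((ContinuousLinearMap.apply ℂ ℂ (EuclideanSpace.single i (1 : ℂ) : Cn n)).restrictScalars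
      ℝ).contDiff.comp_contDiffOn hs
  have hFc : ∀ i, ContDiffOn ℝ ∞ (fun z => starRingEnd ℂ (F i z)) U := fun i =>
    Complex.conjCLE.contDiff.comp_contDiffOn (hF i)
  let N : Cn n → ℂ := fun z => ∑ i, F i z * starRingEnd ℂ (F i z)
  have hNs : ContDiffOn ℝ ∞ N U := ContDiffOn.sum fun i _ => (hF i).mul (hFc i)
  have hN0 : ∀ z ∈ U, N z ≠ 0 := by
    intro z hz hN
    have h1 : ∑ i, Complex.normSq (F i z) = 0 := by
      have : ((∑ i, Complex.normSq (F i z) : ℝ) : ℂ) = 0 := by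
        rw [← hN]; push_cast; exact Finset.sum_congr rfl fun i _ => (Complex.mul_conj _).symm
      exact_mod_cast this
    rw [Finset.sum_eq_zero_iff_of_nonneg fun i _ => Complex.normSq_nonneg _] at h1
    refine h0 z hz (ContinuousLinearMap.ext fun v => ?_)
    rw [clm_eq_sum]
    refine (Finset.sum_eq_zero fun i hi => ?_).trans rfl
    have := Complex.normSq_eq_zero.1 (h1 i hi)
    rw [show s z (EuclideanSpace.single i 1) = 0 from this, mul_zero]
  have hq : ∀ i, ContDiffOn ℝ ∞ (fun z => starRingEnd ℂ (F i z) / N z) U := fun i => by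
    simp only [div_eq_mul_inv]
    exact (hFc i).mul (hNs.inv hN0)
  refine ⟨fun z => ∑ i, (starRingEnd ℂ (F i z) / N z) • EuclideanSpace.single i (1 : ℂ), ?_, fun z hz => ?_⟩
  · exact ContDiffOn.sum fun i _ => (hq i).smul contDiffOn_const
  · simp only [map_sum, map_smul, smul_eq_mul, div_mul_eq_mul_div]
    rw [← Finset.sum_div, div_eq_one_iff_eq (hN0 z hz)]
    exact Finset.sum_congr rfl fun i _ => mul_comm _ _

theorem exists_isKoszulLift {s : Cn n → Cn n →L[ℂ] ℂ} {φ : Cn n → ℂ} (hU : IsOpen U)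
    (hs : ContDiffOn ℝ ∞ s U) (hsh : ∀ v, DifferentiableOn ℂ (fun z => s z v) U)
    (h0 : ∀ z ∈ U, s z ≠ 0) (hφ : ContDiffOn ℝ ∞ φ U) (hφh : DifferentiableOn ℂ φ U) :
    ∃ β : ∀ k j : ℕ, ExtForm n (n + k) j, IsKoszulLift U s (topSection φ) β := by
  obtain ⟨h, hh, h1⟩ := exists_smooth_dual hs h0
  refine ⟨koszulLift φ h, fun k j _ => contDiffOn_koszulLift hU hφ hh k j,
    fun k j _ z hz c v => ?_, fun j hj z hz v w => ?_,
    fun k j _ => koszul_koszulLift_succ hU hs hsh hφ hφh hh h1 k j⟩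
  · ext w
    exact (koszulLift_hasWeight hU hφ hh k j w z hz).apply_smul c v
  · rw [koszul_koszulLift_zero (h1 z hz), topSectionIn_apply]
    have : topCot n (j + 1) (fun a => w (Fin.cast hj a)) = topForm n w := by
      subst hj
      simp [topCot]
    rw [this]
    rfl

end KoszulLift

/-! ### Smooth bumps and step functions -/

section Cutoff

/-- A smooth nonnegative bump of integral one, supported in `[c - r, c + r]`. -/
def unitBump (c r : ℝ) (hr : 0 < r) : ℝ → ℝ :=
  (⟨r / 2, r, by positivity, by linarith⟩ : ContDiffBump c).normed volume

/-- A smooth function that is one to the left of `c - r` and zero to the right of `c + r`,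
and whose derivative is `-unitBump c r`. -/
def stepDown (c r : ℝ) (hr : 0 < r) (u : ℝ) : ℝ := 1 - ∫ t in (c - r)..u, unitBump c r hr t

variable {c r : ℝ} (hr : 0 < r)

theorem contDiff_unitBump : ContDiff ℝ ∞ (unitBump c r hr) := ContDiffBump.contDiff_normed _

theorem unitBump_nonneg (u : ℝ) : 0 ≤ unitBump c r hr u := ContDiffBump.nonneg_normed _ _

theorem unitBump_eq_zero {u : ℝ} (h : r ≤ |u - c|) : unitBump c r hr u = 0 := by
  by_contra h'
  have : u ∈ Function.support (unitBump c r hr) := h'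
  rw [unitBump, ContDiffBump.support_normed_eq, mem_ball, Real.dist_eq] at this
  exact absurd h (not_le.2 this)

theorem integral_unitBump : ∫ u, unitBump c r hr u = 1 := ContDiffBump.integral_normed _

theorem integrable_unitBump : Integrable (unitBump c r hr) := ContDiffBump.integrable_normed _

theorem hasDerivAt_stepDown (u : ℝ) : HasDerivAt (stepDown c r hr) (-unitBump c r hr u) u := by
  have h := intervalIntegral.integral_hasDerivAt_right
    ((contDiff_unitBump (c := c) hr).continuous.intervalIntegrable (c - r) u)
    ((contDiff_unitBump (c := c) hr).continuous.stronglyMeasurableAtFilter _ _)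
    (contDiff_unitBump (c := c) hr).continuous.continuousAt
  exact h.const_sub 1

theorem contDiff_stepDown : ContDiff ℝ ∞ (stepDown c r hr) := by
  rw [contDiff_infty_iff_deriv]
  refine ⟨fun u => (hasDerivAt_stepDown hr u).differentiableAt, ?_⟩
  rw [funext fun u => (hasDerivAt_stepDown (c := c) hr u).deriv]
  exact (contDiff_unitBump hr).neg

theorem stepDown_of_le {u : ℝ} (h : u ≤ c - r) : stepDown c r hr u = 1 := by
  rw [stepDown, intervalIntegral.integral_congr (g := fun _ => 0)]
  · simp
  · intro t ht
    rw [Set.uIcc_of_ge h] at ht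
    exact unitBump_eq_zero hr (by rw [abs_of_nonpos (by linarith [ht.2])]; linarith [ht.2])

theorem stepDown_of_ge {u : ℝ} (h : c + r ≤ u) : stepDown c r hr u = 0 := by
  rw [stepDown, intervalIntegral.integral_of_le (by linarith),
    setIntegral_eq_integral_of_forall_compl_eq_zero, integral_unitBump, sub_self]
  intro t ht
  refine unitBump_eq_zero hr ?_
  rw [Set.mem_Ioc, not_and_or, not_lt, not_le] at ht
  rcases ht with ht | ht
  · rw [abs_of_nonpos (by linarith)]; linarith
  · rw [abs_of_nonneg (by linarith)]; linarith

end Cutoff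

/-! ### Stokes' theorem for compactly supported cutoffs -/

section Stokes

variable {n p : ℕ} {U : Set (Cn n)} {z : Cn n}

/-- Opens the way to integration by parts, polar coordinates and change of variables, which are
available for Haar measures. -/
instance isAddHaarMeasure_lebesgue (n : ℕ) : (lebesgue n).IsAddHaarMeasure :=
  (PiLp.continuousLinearEquiv 2 ℝ fun _ : Fin n => ℂ).symm.isAddHaarMeasure_map volume

theorem continuous_of_tsupport_subset {F : Type*} [NormedAddCommGroup F] {G : Cn n → F}
    (hU : IsOpen U) (hG : ContinuousOn G U) (h : tsupport G ⊆ U) : Continuous G :=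
  continuous_of_tsupport fun _ hx => hG.continuousAt (hU.mem_nhds (h hx))

theorem contDiff_of_tsupport_subset {F : Type*} [NormedAddCommGroup F] [NormedSpace ℝ F]
    {G : Cn n → F} (hU : IsOpen U) (hG : ContDiffOn ℝ ∞ G U) (h : tsupport G ⊆ U) :
    ContDiff ℝ ∞ G := by
  rw [contDiff_iff_contDiffAt]
  intro z
  by_cases hz : z ∈ tsupport G
  · exact hG.contDiffAt (hU.mem_nhds (h hz))
  · exact (contDiffAt_const (c := (0 : F))).congr_of_eventuallyEq
      (notMem_tsupport_iff_eventuallyEq.1 hz)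

theorem contDiffOn_form_apply {α : Cn n → Cn n [⋀^Fin p]→L[ℝ] ℂ} (hα : ContDiffOn ℝ ∞ α U)
    (v : Fin p → Cn n) : ContDiffOn ℝ ∞ (fun z => α z v) U :=
  (ContinuousAlternatingMap.apply ℝ (Cn n) ℂ v).contDiff.comp_contDiffOn hα

theorem tsupport_mul_form_subset {c : Cn n → ℂ} {α : Cn n → Cn n [⋀^Fin p]→L[ℝ] ℂ}
    (v : Fin p → Cn n) : tsupport (fun z => c z * α z v) ⊆ tsupport c :=
  closure_mono fun z hz => by
    simp only [Function.mem_support] at hz ⊢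
    exact left_ne_zero_of_mul hz

theorem integrable_mul_form {c : Cn n → ℂ} {α : Cn n → Cn n [⋀^Fin p]→L[ℝ] ℂ} (hU : IsOpen U)
    (hc : Continuous c) (hcs : HasCompactSupport c) (hcU : tsupport c ⊆ U)
    (hα : ContDiffOn ℝ ∞ α U) (v : Fin p → Cn n) :
    Integrable (fun z => c z * α z v) (lebesgue n) := by
  refine Continuous.integrable_of_hasCompactSupport ?_ ?_
  · exact continuous_of_tsupport_subset hU
      (hc.continuousOn.mul (contDiffOn_form_apply hα v).continuousOn)
      ((tsupport_mul_form_subset v).trans hcU)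
  · exact hcs.mono fun z hz => left_ne_zero_of_mul hz

theorem integrable_wedge_fderiv {c : Cn n → ℂ} {α : Cn n → Cn n [⋀^Fin p]→L[ℝ] ℂ} (hU : IsOpen U)
    (hc : ContDiff ℝ ∞ c) (hcs : HasCompactSupport (fderiv ℝ c))
    (hcU : tsupport (fderiv ℝ c) ⊆ U)
    (hα : ContDiffOn ℝ ∞ α U) (v : Fin (p + 1) → Cn n) :
    Integrable (fun z => wedge (fderiv ℝ c z) (α z) v) (lebesgue n) := by
  simp only [wedge_apply]
  refine integrable_finsetSum _ fun i _ => Integrable.const_mul ?_ _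
  have hsub : (fun z => fderiv ℝ c z (v i)) = (fun L : Cn n →L[ℝ] ℂ => L (v i)) ∘ fderiv ℝ c := rfl
  refine integrable_mul_form hU ?_ ?_ ?_ hα _
  · exact (hc.continuous_fderiv (by simp)).clm_apply continuous_const
  · rw [hsub]; exact hcs.comp_left rfl
  · refine Set.Subset.trans (closure_mono fun z hz => ?_) hcU
    rw [Function.mem_support] at hz ⊢
    exact fun h => hz (by simp [h])

/-- Stokes' theorem for a compactly supported function against a form. -/
theorem integral_wedge_fderiv {c : Cn n → ℂ} {α : Cn n → Cn n [⋀^Fin p]→L[ℝ] ℂ} (hU : IsOpen U)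
    (hc : ContDiff ℝ ∞ c) (hcs : HasCompactSupport c) (hcU : tsupport c ⊆ U)
    (hα : ContDiffOn ℝ ∞ α U) (v : Fin (p + 1) → Cn n) :
    ∫ z, wedge (fderiv ℝ c z) (α z) v ∂lebesgue n = -∫ z, c z * extDeriv α z v ∂lebesgue n := by
  have hts : tsupport (fun z => c z • α z) ⊆ tsupport c :=
    closure_mono fun z hz => by
      simp only [Function.mem_support] at hz ⊢
      exact fun h => hz (by rw [h]; ext; simp)
  have hcα : ContDiff ℝ ∞ (fun z => c z • α z) :=
    contDiff_of_tsupport_subset hU (hc.contDiffOn.smul hα) (hts.trans hcU)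
  -- Extended by zero, cα is a globally smooth form with compact support, even though α is only
  -- controlled on U. The claim is that the integral of d(cα) vanishes.
  have hfd : ∀ z, extDeriv (fun z => c z • α z) z v =
      wedge (fderiv ℝ c z) (α z) v + c z * extDeriv α z v := by
    intro z
    by_cases hz : z ∈ tsupport c
    · rw [extDeriv_fun_smul_form (hc.differentiable (by simp) z)
        (differentiableAt_of_contDiffOn hU hα (hcU hz))]
      simp
    · have h1 := notMem_tsupport_iff_eventuallyEq.1 hz
      have h2 : (fun z => c z • α z) =ᶠ[nhds z] fun _ => 0 := by
        filter_upwards [h1] with w hw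
        rw [hw]; ext; simp
      have h3 : fderiv ℝ c z = 0 := by
        rw [h1.fderiv_eq]; exact fderiv_const_apply (0 : ℂ)
      rw [h2.extDeriv_eq, h3, h1.self_of_nhds, wedge_zero_left]
      simp [extDeriv, ContinuousAlternatingMap.alternatizeUncurryFin_apply]
  have hi1 := integrable_wedge_fderiv hU hc (hcs.fderiv ℝ)
    ((tsupport_fderiv_subset ℝ).trans hcU) hα v
  have hi2 := integrable_mul_form hU hc.continuous hcs hcU (contDiffOn_extDeriv hU hα) v
  rw [eq_neg_iff_add_eq_zero, ← integral_add hi1 hi2]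
  simp only [← hfd]
  have hcompact : ∀ w : Fin p → Cn n, HasCompactSupport fun z => c z • α z w := fun w =>
    hcs.mono fun z hz => left_ne_zero_of_mul hz
  have hsm : ∀ w : Fin p → Cn n, ContDiff ℝ ∞ fun z => c z • α z w := fun w =>
    (ContinuousAlternatingMap.apply ℝ (Cn n) ℂ w).contDiff.comp hcα
  have hint : ∀ (w : Fin p → Cn n) (u : Cn n),
      Integrable (fun z => fderiv ℝ (fun z => c z • α z w) z u) (lebesgue n) := fun w u =>
    ((hsm w).continuous_fderiv (by simp)).clm_apply continuous_const
      |>.integrable_of_hasCompactSupport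
        (((hcompact w).fderiv ℝ).comp_left (g := fun L : Cn n →L[ℝ] ℂ => L u) rfl)
  have hzero : ∀ (w : Fin p → Cn n) (u : Cn n),
      ∫ z, fderiv ℝ (fun z => c z • α z w) z u ∂lebesgue n = 0 := by
    intro w u
    -- Integration by parts against the constant function one.
    have h := integral_mul_fderiv_eq_neg_fderiv_mul_of_integrable (μ := lebesgue n) (𝕜 := ℂ)
      (f := fun _ => (1 : ℂ)) (g := fun z => c z • α z w) (v := u) (by simp)
      (by simpa using hint w u)
      (by simpa using (hsm w).continuous.integrable_of_hasCompactSupport (hcompact w))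
      (fun x _ => by fun_prop) (fun x _ => (hsm w).differentiable (by simp) x)
    simpa using h
  simp only [extDeriv_apply (hcα.differentiable (by simp) _)]
  rw [integral_finsetSum]
  · refine Finset.sum_eq_zero fun i _ => ?_
    simp only [zsmul_eq_mul]
    rw [integral_const_mul]
    exact (congrArg _ (hzero (i.removeNth v) (v i))).trans (mul_zero _)
  · exact fun i _ => (hint (i.removeNth v) (v i)).smul ((-1 : ℤ) ^ (i : ℕ))

end Stokes

/-! ### Polar coordinates and integrals over spheres -/

section Polar

variable {n : ℕ} {ε : ℝ}

theorem finrank_real_Cn (n : ℕ) : Module.finrank ℝ (Cn n) = n + n := by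
  rw [finrank_real_of_complex, finrank_euclideanSpace, Fintype.card_fin, two_mul]

theorem nontrivial_Cn (hn : 1 ≤ n) : Nontrivial (Cn n) :=
  Module.nontrivial_of_finrank_pos (R := ℝ) (by rw [finrank_real_Cn]; omega)

/-- Integration in polar coordinates. -/
theorem integral_lebesgue_polar (hn : 1 ≤ n) {G : Cn n → ℂ} (hG : Integrable G (lebesgue n)) :
    ∫ z, G z ∂lebesgue n = ∫ r in Set.Ioi (0 : ℝ),
      ∫ x : sphere (0 : Cn n) 1, (r : ℂ) ^ (n + (n - 1)) * G (r • (x : Cn n))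
        ∂(lebesgue n).toSphere := by
  have := nontrivial_Cn hn
  have hdim : Module.finrank ℝ (Cn n) - 1 = n + (n - 1) := by rw [finrank_real_Cn]; omega
  have hmp := (lebesgue n).measurePreserving_homeomorphUnitSphereProd
  have hemb := (homeomorphUnitSphereProd (Cn n)).measurableEmbedding
  rw [hdim] at hmp
  let H : sphere (0 : Cn n) 1 × Set.Ioi (0 : ℝ) → ℂ := fun x => G ((x.2 : ℝ) • (x.1 : Cn n))
  have hH : ∀ z : ({(0)}ᶜ : Set (Cn n)), H (homeomorphUnitSphereProd (Cn n) z) = G z := by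
    intro z
    have : ‖(z : Cn n)‖ ≠ 0 := norm_ne_zero_iff.2 z.2
    simp [H, smul_smul, this]
  have h1 : ∫ z, G z ∂lebesgue n = ∫ x, H x ∂(lebesgue n).toSphere.prod
      (Measure.volumeIoiPow (n + (n - 1))) := by
    rw [← hmp.integral_comp hemb]
    simp only [hH]
    rw [integral_subtype_comap (measurableSet_singleton _).compl fun z => G z,
      restrict_compl_singleton]
  have hint : Integrable H ((lebesgue n).toSphere.prod (Measure.volumeIoiPow (n + (n - 1)))) := by
    rw [← hmp.integrable_comp_emb hemb]
    have : H ∘ homeomorphUnitSphereProd (Cn n) = fun z : ({(0)}ᶜ : Set (Cn n)) => G z := funext hH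
    rw [this]
    have := (integrableOn_iff_comap_subtypeVal (μ := lebesgue n) (f := G)
      (measurableSet_singleton (0 : Cn n)).compl).1 hG.integrableOn
    exact this
  rw [h1, integral_prod_symm _ hint, Measure.volumeIoiPow]
  simp only [ENNReal.ofReal]
  rw [integral_withDensity_eq_integral_smul
    (by exact (measurable_subtype_coe.pow_const _).real_toNNReal),
    integral_subtype_comap measurableSet_Ioi fun a : ℝ => Real.toNNReal (a ^ (n + (n - 1))) •
      ∫ x : sphere (0 : Cn n) 1, G (a • (x : Cn n)) ∂(lebesgue n).toSphere]
  refine setIntegral_congr_fun measurableSet_Ioi fun r hr => ?_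
  rw [NNReal.smul_def, Real.coe_toNNReal _ (pow_nonneg (le_of_lt hr) _), integral_const_mul,
    Complex.real_smul]
  push_cast
  rfl

end Polar

section Sphere

variable {n : ℕ} {ε : ℝ}

/-- The restriction of a form to the sphere through `z` with unit normal `x`. -/
def flux (α : Cn n → Cn n [⋀^Fin (n + (n - 1))]→L[ℝ] ℂ) (x z : Cn n) : ℂ :=
  ∑ a : Fin (n + (n - 1) + 1), (-1 : ℂ) ^ (a : ℕ) *
    ((inner ℂ (realBasisVec n a) x).re : ℂ) * α z (fun b => realBasisVec n (a.succAbove b))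

theorem sphereIntegral_eq (r : ℝ) (α : Cn n → Cn n [⋀^Fin (n + (n - 1))]→L[ℝ] ℂ) :
    sphereIntegral r (fun z v => α z v) = ∫ x : sphere (0 : Cn n) 1,
      (r : ℂ) ^ (n + (n - 1)) * flux α x (r • (x : Cn n)) ∂(lebesgue n).toSphere := rfl

theorem continuousOn_flux {α : Cn n → Cn n [⋀^Fin (n + (n - 1))]→L[ℝ] ℂ} {U : Set (Cn n)}
    (hα : ContDiffOn ℝ ∞ α U) :
    ContinuousOn (fun p : Cn n × Cn n => flux α p.1 p.2) (Set.univ ×ˢ U) := by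
  refine continuousOn_finsetSum _ fun a _ => ContinuousOn.mul ?_ ?_
  · exact Continuous.continuousOn (by fun_prop)
  · exact (contDiffOn_form_apply hα _).continuousOn.comp continuousOn_snd fun p hp => hp.2

theorem fderiv_comp_norm_sq {κ : ℝ → ℝ} (hκ : ContDiff ℝ ∞ κ) (z v : Cn n) :
    fderiv ℝ (fun z : Cn n => (κ (‖z‖ ^ 2) : ℂ)) z v =
      ((deriv κ (‖z‖ ^ 2) * (2 * (inner ℂ v z).re) : ℝ) : ℂ) := by
  let _ : InnerProductSpace ℝ (Cn n) := InnerProductSpace.rclikeToReal ℂ (Cn n)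
  have h1 : HasFDerivAt (fun z : Cn n => ‖z‖ ^ 2) (2 • innerSL ℝ z) z :=
    (hasStrictFDerivAt_norm_sq z).hasFDerivAt
  have h2 : HasDerivAt κ (deriv κ (‖z‖ ^ 2)) (‖z‖ ^ 2) :=
    (hκ.differentiable (by simp) _).hasDerivAt
  have h3 := Complex.ofRealCLM.hasFDerivAt.comp z (h2.comp_hasFDerivAt z h1)
  have h4 : fderiv ℝ (fun z : Cn n => (κ (‖z‖ ^ 2) : ℂ)) z = _ := h3.fderiv
  rw [h4]
  have h5 : inner ℝ z v = (inner ℂ v z).re := by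
    rw [real_inner_comm]; exact real_inner_eq_re_inner ℂ v z
  simp [h5]

/-- The radial integral of a derivative against a form is a superposition of sphere integrals. -/
theorem integral_wedge_radial (hn : 1 ≤ n) {α : Cn n → Cn n [⋀^Fin (n + (n - 1))]→L[ℝ] ℂ}
    {κ : ℝ → ℝ} (hκ : ContDiff ℝ ∞ κ)
    (hint : Integrable (fun z => wedge (fderiv ℝ (fun z : Cn n => (κ (‖z‖ ^ 2) : ℂ)) z) (α z)
      fun a => realBasisVec n a) (lebesgue n)) :
    ∫ z, wedge (fderiv ℝ (fun z : Cn n => (κ (‖z‖ ^ 2) : ℂ)) z) (α z)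
      (fun a => realBasisVec n a) ∂lebesgue n =
    ∫ u in Set.Ioi (0 : ℝ), ((deriv κ u : ℝ) : ℂ) * sphereIntegral (Real.sqrt u) (fun z v => α z v) := by
  -- The substitution u = r² absorbs the factor 2r in the radial derivative of κ(‖z‖²).
  rw [integral_lebesgue_polar hn hint, ← integral_comp_rpow_Ioi_of_pos
    (g := fun u : ℝ => ((deriv κ u : ℝ) : ℂ) * sphereIntegral (Real.sqrt u) (fun z v => α z v))
    (p := 2) (by norm_num)]
  refine setIntegral_congr_fun measurableSet_Ioi fun r hr => ?_
  have hr0 : (0 : ℝ) < r := hr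
  have hsq : r ^ (2 : ℝ) = r ^ 2 := by norm_cast
  simp only [hsq, Real.sqrt_sq hr0.le, sphereIntegral_eq]
  rw [← integral_const_mul, ← integral_smul]
  refine integral_congr_ae (Filter.Eventually.of_forall fun x => ?_)
  have hnorm : ‖r • (x : Cn n)‖ = r := by
    rw [norm_smul, norm_eq_of_mem_sphere, Real.norm_of_nonneg hr0.le, mul_one]
  have hinner : ∀ v : Cn n, (inner ℂ v (r • (x : Cn n))).re = r * (inner ℂ v (x : Cn n)).re := by
    intro v
    rw [← Complex.coe_smul, inner_smul_right]; simp
  have hpow : r ^ ((2 : ℝ) - 1) = r := by norm_num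
  simp only [wedge_apply, fderiv_comp_norm_sq hκ, hnorm, hinner, flux, Finset.mul_sum, hpow,
    Complex.real_smul]
  refine Finset.sum_congr rfl fun a _ => ?_
  have : (a.removeNth fun a => realBasisVec n ↑a) = fun b => realBasisVec n (a.succAbove b) := rfl
  rw [this]
  push_cast
  ring

variable {α : Cn n → Cn n [⋀^Fin (n + (n - 1))]→L[ℝ] ℂ}

theorem tsupport_fderiv_subset_punctured {χ : Cn n → ℂ} (hχε : tsupport χ ⊆ ball 0 ε)
    (hχ0 : χ =ᶠ[nhds 0] 1) : tsupport (fderiv ℝ χ) ⊆ ball 0 ε \ {0} := by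
  intro z hz
  refine ⟨hχε (tsupport_fderiv_subset ℝ hz), fun h => ?_⟩
  rw [Set.mem_singleton_iff.1 h] at hz
  refine notMem_tsupport_iff_eventuallyEq.2 ?_ hz
  filter_upwards [hχ0.eventuallyEq_nhds] with w hw
  rw [hw.fderiv_eq]
  exact fderiv_const_apply (1 : ℂ)

/-- The bump is a probability density, so its average of T differs from T(c) by at most the
oscillation of T on the support. -/
theorem norm_integral_unitBump_mul_sub_le {c r e : ℝ} (hr : 0 < r) {T : ℝ → ℂ}
    (hT : ContinuousOn T (closedBall c r)) (h : ∀ u, |u - c| ≤ r → ‖T u - T c‖ ≤ e) :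
    ‖(∫ u, (unitBump c r hr u : ℂ) * T u) - T c‖ ≤ e := by
  have hA : Integrable (fun u => (unitBump c r hr u : ℂ)) := (integrable_unitBump hr).ofReal
  have hsupp : Function.support (fun u => (unitBump c r hr u : ℂ) * T u) ⊆ closedBall c r := by
    intro u hu
    by_contra h'
    rw [mem_closedBall, Real.dist_eq, not_le] at h'
    exact hu (by simp [unitBump_eq_zero hr h'.le])
  have hi : Integrable fun u => (unitBump c r hr u : ℂ) * T u := by
    rw [← integrableOn_iff_integrable_of_support_subset hsupp]
    refine ContinuousOn.integrableOn_compact (isCompact_closedBall _ _) (ContinuousOn.mul ?_ hT)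
    exact (Complex.continuous_ofReal.comp (contDiff_unitBump hr).continuous).continuousOn
  have h1 : T c = ∫ u, (unitBump c r hr u : ℂ) * T c := by
    rw [integral_mul_const, integral_complex_ofReal, integral_unitBump]; simp
  conv_lhs => rw [h1]
  rw [← integral_sub hi (hA.mul_const _)]
  calc _ ≤ ∫ u, unitBump c r hr u * e := by
        refine norm_integral_le_of_norm_le ((integrable_unitBump hr).mul_const e)
          (Filter.Eventually.of_forall fun u => ?_)
        rw [← mul_sub, norm_mul, Complex.norm_real, Real.norm_of_nonneg (unitBump_nonneg hr u)]
        rcases le_or_gt |u - c| r with hu | hu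
        · exact mul_le_mul_of_nonneg_left (h u hu) (unitBump_nonneg hr u)
        · simp [unitBump_eq_zero hr hu.le]
    _ = e := by rw [integral_mul_const, integral_unitBump, one_mul]

/-- For a closed form `α` on a punctured ball, the integral of `dχ ∧ α` does not depend on the
cutoff function `χ`. -/
theorem integral_wedge_cutoff_congr (hα : ContDiffOn ℝ ∞ α (ball 0 ε \ {0}))
    (hd : ∀ z ∈ ball 0 ε \ {0}, extDeriv α z = 0) {χ χ' : Cn n → ℂ}
    (hχ : ContDiff ℝ ∞ χ) (hχs : HasCompactSupport χ) (hχε : tsupport χ ⊆ ball 0 ε)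
    (hχ0 : χ =ᶠ[nhds 0] 1)
    (hχ' : ContDiff ℝ ∞ χ') (hχs' : HasCompactSupport χ') (hχε' : tsupport χ' ⊆ ball 0 ε)
    (hχ0' : χ' =ᶠ[nhds 0] 1) (v : Fin (n + (n - 1) + 1) → Cn n) :
    ∫ z, wedge (fderiv ℝ χ z) (α z) v ∂lebesgue n =
      ∫ z, wedge (fderiv ℝ χ' z) (α z) v ∂lebesgue n := by
  have hU : IsOpen (ball (0 : Cn n) ε \ {0}) := isOpen_ball.sdiff isClosed_singleton
  have hi1 := integrable_wedge_fderiv hU hχ (hχs.fderiv ℝ)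
    (tsupport_fderiv_subset_punctured hχε hχ0) hα v
  have hi2 := integrable_wedge_fderiv hU hχ' (hχs'.fderiv ℝ)
    (tsupport_fderiv_subset_punctured hχε' hχ0') hα v
  -- The two cutoffs agree near the origin, so their difference has compact support in the punctured
  -- ball, where α is smooth and closed; Stokes gives zero.
  have h0 : (0 : Cn n) ∉ tsupport (χ - χ') := by
    rw [notMem_tsupport_iff_eventuallyEq]
    filter_upwards [hχ0, hχ0'] with z h1 h2
    simp [h1, h2]
  have hst := integral_wedge_fderiv hU (hχ.sub hχ') (hχs.sub hχs')
    (fun z hz => ⟨(tsupport_sub χ χ' hz).elim (fun h => hχε h) fun h => hχε' h,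
      fun h => h0 (by rwa [← Set.mem_singleton_iff.1 h])⟩) hα v
  have hzero : ∀ z, (χ - χ') z * extDeriv α z v = 0 := by
    intro z
    by_cases hz : z ∈ ball (0 : Cn n) ε \ {0}
    · rw [hd z hz]; simp
    · have : z ∉ tsupport (χ - χ') := fun h => hz
        ⟨(tsupport_sub χ χ' h).elim (fun h => hχε h) fun h => hχε' h,
          fun h' => h0 (by rwa [← Set.mem_singleton_iff.1 h'])⟩
      rw [image_eq_zero_of_notMem_tsupport this, zero_mul]
  rw [← sub_eq_zero, ← integral_sub hi1 hi2]
  have hfd : ∀ z, fderiv ℝ χ z = fderiv ℝ (χ - χ') z + fderiv ℝ χ' z := by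
    intro z
    rw [fderiv_sub (hχ.differentiable (by simp) z) (hχ'.differentiable (by simp) z), sub_add_cancel]
  have : ∀ z, wedge (fderiv ℝ χ z) (α z) v - wedge (fderiv ℝ χ' z) (α z) v =
      wedge (fderiv ℝ (χ - χ') z) (α z) v := by
    intro z
    rw [hfd z, wedge_add_left, ContinuousAlternatingMap.add_apply, add_sub_cancel_right]
  simp only [this]
  refine hst.trans ?_
  rw [neg_eq_zero]
  exact (integral_congr_ae (Filter.Eventually.of_forall hzero)).trans (integral_zero _ _)

theorem continuousOn_sphereIntegral (hα : ContDiffOn ℝ ∞ α (ball 0 ε \ {0})) :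
    ContinuousOn (fun r => sphereIntegral r fun z v => α z v) (Set.Ioo 0 ε) := by
  simp only [sphereIntegral_eq]
  refine continuousOn_integral_of_compact_support (k := Set.univ) isCompact_univ ?_
    (fun p x _ h => absurd (Set.mem_univ x) h)
  refine ContinuousOn.mul (Continuous.continuousOn (by fun_prop)) ?_
  refine (continuousOn_flux hα).comp
    (f := fun p : ℝ × sphere (0 : Cn n) 1 => ((p.2 : Cn n), p.1 • (p.2 : Cn n)))
    (Continuous.continuousOn (by fun_prop)) fun p hp => ⟨Set.mem_univ _, ?_⟩
  have h0 := hp.1.1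
  have hnorm : ‖p.1 • (p.2 : Cn n)‖ = p.1 := by
    rw [norm_smul, norm_eq_of_mem_sphere, Real.norm_of_nonneg h0.le, mul_one]
  refine ⟨by rw [mem_ball_zero_iff, hnorm]; exact hp.1.2, fun h => ?_⟩
  have h' : p.1 • (p.2 : Cn n) = 0 := h
  rw [h', norm_zero] at hnorm
  exact h0.ne hnorm

/-- For a closed form `α` on a punctured ball and a cutoff function `χ` equal to one near the
origin, the integral of `dχ ∧ α` is minus the integral of `α` over any sphere. -/
theorem integral_wedge_cutoff (hn : 1 ≤ n) (hα : ContDiffOn ℝ ∞ α (ball 0 ε \ {0}))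
    (hd : ∀ z ∈ ball 0 ε \ {0}, extDeriv α z = 0) {χ : Cn n → ℂ}
    (hχ : ContDiff ℝ ∞ χ) (hχs : HasCompactSupport χ) (hχε : tsupport χ ⊆ ball 0 ε)
    (hχ0 : χ =ᶠ[nhds 0] 1) {r : ℝ} (hr : 0 < r) (hrε : r < ε) :
    ∫ z, wedge (fderiv ℝ χ z) (α z) (fun a => realBasisVec n a) ∂lebesgue n =
      -sphereIntegral r fun z v => α z v := by
  have hU : IsOpen (ball (0 : Cn n) ε \ {0}) := isOpen_ball.sdiff isClosed_singleton
  have hε : 0 < ε := hr.trans hrε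
  set T : ℝ → ℂ := fun u => sphereIntegral (Real.sqrt u) fun z v => α z v with hT
  have hTc : ContinuousOn T (Set.Ioo 0 (ε ^ 2)) := by
    refine (continuousOn_sphereIntegral hα).comp Real.continuous_sqrt.continuousOn fun u hu => ?_
    exact ⟨Real.sqrt_pos.2 hu.1, (Real.sqrt_lt' hε).2 hu.2⟩
  have hu0 : r ^ 2 ∈ Set.Ioo 0 (ε ^ 2) := ⟨by positivity, by gcongr⟩
  have hTr : T (r ^ 2) = sphereIntegral r fun z v => α z v := by rw [hT]; simp [Real.sqrt_sq hr.le]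
  rw [eq_neg_iff_add_eq_zero, ← hTr, add_comm, ← norm_eq_zero, ← sub_neg_eq_add]
  -- Since the left side does not depend on the cutoff, for each e a radial one may be used whose
  -- step lies in a window of half-width t around r². It produces minus an average of sphere
  -- integrals over squared radii in that window, within e of the value at r.
  refine le_antisymm (le_of_forall_pos_le_add fun e he => ?_) (norm_nonneg _)
  rw [zero_add]
  obtain ⟨d, hd0, hdT⟩ := Metric.continuousAt_iff.1
    (hTc.continuousAt (isOpen_Ioo.mem_nhds hu0)) e he
  obtain ⟨d', hd'0, hd'⟩ := Metric.isOpen_iff.1 isOpen_Ioo _ hu0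
  set t := min d d' / 2 with ht
  have ht0 : 0 < t := by positivity
  have htd : t < d := by
    have : min d d' ≤ d := min_le_left _ _
    have : 0 < min d d' := by positivity
    rw [ht]; linarith
  have htd' : t < d' := by
    have : min d d' ≤ d' := min_le_right _ _
    have : 0 < min d d' := by positivity
    rw [ht]; linarith
  have hIoo : ∀ u, |u - r ^ 2| ≤ t → u ∈ Set.Ioo 0 (ε ^ 2) := fun u hu =>
    hd' (by rw [mem_ball, Real.dist_eq]; linarith)
  have hplus := (hIoo (r ^ 2 + t) (by rw [add_sub_cancel_left, abs_of_pos ht0])).2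
  have hminus := (hIoo (r ^ 2 - t) (by rw [sub_sub_cancel_left, abs_neg, abs_of_pos ht0])).1
  set κ := stepDown (r ^ 2) t ht0
  have hκ : ContDiff ℝ ∞ κ := contDiff_stepDown ht0
  set χ' : Cn n → ℂ := fun z => (κ (‖z‖ ^ 2) : ℂ)
  have hχ' : ContDiff ℝ ∞ χ' :=
    Complex.ofRealCLM.contDiff.comp (hκ.comp ((contDiff_norm_sq ℂ).restrict_scalars ℝ))
  have hsupp : tsupport χ' ⊆ closedBall 0 (Real.sqrt (r ^ 2 + t)) := by
    refine closure_minimal (fun z hz => ?_) isClosed_closedBall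
    rw [mem_closedBall_zero_iff]
    by_contra h
    rw [not_le, Real.sqrt_lt' (lt_of_le_of_lt (Real.sqrt_nonneg _) (not_le.1 (by simpa using h)))] at h
    exact hz (by simp [χ', κ, stepDown_of_ge ht0 h.le])
  have hχs' : HasCompactSupport χ' :=
    (isCompact_closedBall _ _).of_isClosed_subset (isClosed_tsupport _) hsupp
  have hχε' : tsupport χ' ⊆ ball 0 ε :=
    hsupp.trans (closedBall_subset_ball ((Real.sqrt_lt' hε).2 hplus))
  have hχ0' : χ' =ᶠ[nhds 0] 1 := by
    have : ∀ᶠ z : Cn n in nhds 0, ‖z‖ ^ 2 < r ^ 2 - t :=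
      (by fun_prop : Continuous fun z : Cn n => ‖z‖ ^ 2).continuousAt.eventually_lt_const
        (by simpa using hminus)
    filter_upwards [this] with z hz
    simp [χ', κ, stepDown_of_le ht0 hz.le]
  rw [integral_wedge_cutoff_congr hα hd hχ hχs hχε hχ0 hχ' hχs' hχε' hχ0',
    integral_wedge_radial hn hκ (integrable_wedge_fderiv hU hχ' (hχs'.fderiv ℝ)
      (tsupport_fderiv_subset_punctured hχε' hχ0') hα _)]
  have hder : ∀ u, deriv κ u = -unitBump (r ^ 2) t ht0 u := fun u =>
    (hasDerivAt_stepDown ht0 u).deriv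
  have hval : ∫ u in Set.Ioi (0 : ℝ), ((deriv κ u : ℝ) : ℂ) * T u =
      -∫ u, (unitBump (r ^ 2) t ht0 u : ℂ) * T u := by
    rw [← integral_neg, setIntegral_eq_integral_of_forall_compl_eq_zero]
    · simp [hder]
    · intro u hu
      rw [hder, unitBump_eq_zero ht0]
      · simp
      · by_contra h
        exact hu (hIoo u (not_le.1 h).le).1
  have hbd := norm_integral_unitBump_mul_sub_le ht0 (T := T) (e := e)
    (hTc.mono fun u hu => hIoo u (by rwa [mem_closedBall, Real.dist_eq] at hu))
    (fun u hu => (dist_eq_norm (T u) _ ▸ hdT (by rw [Real.dist_eq]; linarith)).le)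
  rw [hval, neg_neg, norm_sub_rev]
  exact hbd

end Sphere

/-! ### Iterated exterior products -/

section WedgeSeq

variable {n p : ℕ}

theorem wedge_sum_right {ι : Type*} (t : Finset ι) (θ : Cn n →L[ℝ] ℂ)
    (α : ι → Cn n [⋀^Fin p]→L[ℝ] ℂ) : wedge θ (∑ i ∈ t, α i) = ∑ i ∈ t, wedge θ (α i) := by
  classical
  induction t using Finset.induction_on with
  | empty => simp
  | insert a t ha ih => rw [Finset.sum_insert ha, Finset.sum_insert ha, wedge_add_right, ih]

theorem wedge_sum_left {ι : Type*} (t : Finset ι) (θ : ι → Cn n →L[ℝ] ℂ)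
    (α : Cn n [⋀^Fin p]→L[ℝ] ℂ) : wedge (∑ i ∈ t, θ i) α = ∑ i ∈ t, wedge (θ i) α := by
  classical
  induction t using Finset.induction_on with
  | empty => simp
  | insert a t ha ih => rw [Finset.sum_insert ha, Finset.sum_insert ha, wedge_add_left, ih]

/-- `θ₀ ∧ ⋯ ∧ θⱼ₋₁ ∧ α`. -/
def wedgeSeq : {j : ℕ} → (Fin j → Cn n →L[ℝ] ℂ) → Cn n [⋀^Fin p]→L[ℝ] ℂ →
    Cn n [⋀^Fin (p + j)]→L[ℝ] ℂ
  | 0, _, α => α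
  | _ + 1, θ, α => wedge (θ 0) (wedgeSeq (Fin.tail θ) α)

@[simp] theorem wedgeSeq_zero (θ : Fin 0 → Cn n →L[ℝ] ℂ) (α : Cn n [⋀^Fin p]→L[ℝ] ℂ) :
    wedgeSeq θ α = α := rfl

theorem wedgeSeq_succ {j : ℕ} (θ : Fin (j + 1) → Cn n →L[ℝ] ℂ) (α : Cn n [⋀^Fin p]→L[ℝ] ℂ) :
    wedgeSeq θ α = wedge (θ 0) (wedgeSeq (Fin.tail θ) α) := rfl

theorem wedgeSeq_smul (c : ℂ) : ∀ {j : ℕ} (θ : Fin j → Cn n →L[ℝ] ℂ) (α : Cn n [⋀^Fin p]→L[ℝ] ℂ),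
    wedgeSeq θ (c • α) = c • wedgeSeq θ α
  | 0, _, _ => rfl
  | _ + 1, θ, α => by rw [wedgeSeq_succ, wedgeSeq_smul c, wedge_smul_right, wedgeSeq_succ]

theorem wedgeSeq_sum {ι : Type*} (t : Finset ι) :
    ∀ {j : ℕ} (θ : Fin j → Cn n →L[ℝ] ℂ) (α : ι → Cn n [⋀^Fin p]→L[ℝ] ℂ),
    wedgeSeq θ (∑ i ∈ t, α i) = ∑ i ∈ t, wedgeSeq θ (α i)
  | 0, _, _ => rfl
  | _ + 1, θ, α => by simp only [wedgeSeq_succ, wedgeSeq_sum t, wedge_sum_right]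

/-- Moving a factor of an iterated exterior product to the front. -/
theorem wedgeSeq_eq_removeNth : ∀ {j : ℕ} (θ : Fin (j + 1) → Cn n →L[ℝ] ℂ)
    (α : Cn n [⋀^Fin p]→L[ℝ] ℂ) (a : Fin (j + 1)),
    wedgeSeq θ α = (-1 : ℂ) ^ (a : ℕ) • wedge (θ a) (wedgeSeq (a.removeNth θ) α)
  | 0, θ, α, a => by
    obtain rfl : a = 0 := Fin.ext (by omega)
    simp only [Fin.val_zero, pow_zero, one_smul]
    rfl
  | j + 1, θ, α, a => by
    refine Fin.cases ?_ (fun a => ?_) a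
    · simp only [Fin.val_zero, pow_zero, one_smul]
      rfl
    · have h : wedgeSeq (a.succ.removeNth θ) α =
          wedge (θ 0) (wedgeSeq (a.removeNth (Fin.tail θ)) α) := by
        rw [wedgeSeq_succ]
        congr 2
        funext b
        simp [Fin.tail, Fin.removeNth]
      rw [h, wedgeSeq_succ, wedgeSeq_eq_removeNth (Fin.tail θ) α a, wedge_smul_right, wedge_comm,
        Fin.val_succ, pow_succ]
      simp only [mul_neg, mul_one]
      ext v
      simp [Fin.tail]

theorem wedge_wedgeSeq_self {j : ℕ} (θ : Fin j → Cn n →L[ℝ] ℂ) (α : Cn n [⋀^Fin p]→L[ℝ] ℂ)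
    (a : Fin j) : wedge (θ a) (wedgeSeq θ α) = 0 := by
  cases j with
  | zero => exact a.elim0
  | succ j => rw [wedgeSeq_eq_removeNth θ α a, wedge_smul_right, wedge_wedge_self]; ext; simp

theorem HasWeight.wedgeSeq : ∀ {j : ℕ} {θ : Fin j → Cn n →L[ℝ] ℂ}
    (_ : ∀ a, ∀ c : ℂ, ‖c‖ = 1 → ∀ u, θ a (c • u) = c ^ (-1 : ℤ) * θ a u) {m : ℤ}
    {α : Cn n [⋀^Fin p]→L[ℝ] ℂ} (_ : HasWeight m α), HasWeight (m - j) (wedgeSeq θ α)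
  | 0, _, _, m, _, hα => by simpa using hα
  | j + 1, θ, hθ, m, α, hα => by
    have h := HasWeight.wedge (hθ 0)
      (HasWeight.wedgeSeq (θ := Fin.tail θ) (fun a => hθ a.succ) hα)
    have e : m - ((j + 1 : ℕ) : ℤ) = m - j + -1 := by push_cast; ring
    rw [wedgeSeq_succ, e]
    exact h

theorem contDiffOn_wedgeSeq {U : Set (Cn n)} : ∀ {j : ℕ} {θ : Fin j → Cn n → Cn n →L[ℝ] ℂ}
    (_ : ∀ a, ContDiffOn ℝ ∞ (θ a) U) {α : Cn n → Cn n [⋀^Fin p]→L[ℝ] ℂ}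
    (_ : ContDiffOn ℝ ∞ α U), ContDiffOn ℝ ∞ (fun z => wedgeSeq (fun a => θ a z) (α z)) U
  | 0, _, _, _, hα => hα
  | _ + 1, θ, hθ, _, hα =>
    contDiffOn_wedge (hθ 0) (contDiffOn_wedgeSeq (θ := fun a => θ a.succ) (fun a => hθ a.succ) hα)

/-- Transport of a form along an equality of degrees. -/
def castForm {p q : ℕ} (h : p = q) (α : Cn n [⋀^Fin p]→L[ℝ] ℂ) : Cn n [⋀^Fin q]→L[ℝ] ℂ := h ▸ α

theorem wedge_castForm {q : ℕ} (h : p = q) (θ : Cn n →L[ℝ] ℂ) (α : Cn n [⋀^Fin p]→L[ℝ] ℂ) :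
    wedge θ (castForm h α) = castForm (congrArg (· + 1) h) (wedge θ α) := by
  subst h; rfl

theorem castForm_smul {q : ℕ} (h : p = q) (c : ℂ) (α : Cn n [⋀^Fin p]→L[ℝ] ℂ) :
    castForm h (c • α) = c • castForm h α := by
  subst h; rfl

/-- The value of a form on the initial vectors of the standard real basis. -/
def basisValue (α : Cn n [⋀^Fin p]→L[ℝ] ℂ) : ℂ := α fun a => realBasisVec n a

theorem basisValue_castForm {q : ℕ} (h : p = q) (α : Cn n [⋀^Fin p]→L[ℝ] ℂ) :
    basisValue (castForm h α) = basisValue α := by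
  subst h; rfl

@[simp] theorem basisValue_smul (c : ℂ) (α : Cn n [⋀^Fin p]→L[ℝ] ℂ) :
    basisValue (c • α) = c * basisValue α := rfl

@[simp] theorem basisValue_sum {ι : Type*} (t : Finset ι) (α : ι → Cn n [⋀^Fin p]→L[ℝ] ℂ) :
    basisValue (∑ i ∈ t, α i) = ∑ i ∈ t, basisValue (α i) := by
  simp [basisValue]

@[simp] theorem basisValue_zero : basisValue (0 : Cn n [⋀^Fin p]→L[ℝ] ℂ) = 0 := rfl

/-- `d (dG₀ ∧ ⋯ ∧ dGⱼ₋₁ ∧ α) = (-1)ʲ dG₀ ∧ ⋯ ∧ dGⱼ₋₁ ∧ dα`. -/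
theorem extDeriv_wedgeSeq {U : Set (Cn n)} (hU : IsOpen U) {z : Cn n} (hz : z ∈ U) :
    ∀ {j : ℕ} {G : Fin j → Cn n → ℂ} (_ : ∀ a, ContDiffOn ℝ ∞ (G a) U)
    {α : Cn n → Cn n [⋀^Fin p]→L[ℝ] ℂ} (_ : ContDiffOn ℝ ∞ α U),
    extDeriv (fun z => wedgeSeq (fun a => fderiv ℝ (G a) z) (α z)) z =
      castForm (by omega) ((-1 : ℂ) ^ j • wedgeSeq (fun a => fderiv ℝ (G a) z) (extDeriv α z))
  | 0, _, _, α, hα => by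
    simp only [pow_zero, one_smul]
    rfl
  | j + 1, G, hG, α, hα => by
    have hsm := contDiffOn_wedgeSeq (θ := fun (a : Fin j) z => fderiv ℝ (G a.succ) z)
      (fun a => (hG a.succ).fderiv_of_isOpen hU (by simp)) hα
    have h := extDeriv_wedge_fderiv hU (hG 0) hsm hz
    have ih := extDeriv_wedgeSeq hU hz (G := fun a => G a.succ) (fun a => hG a.succ) hα
    rw [ih, wedge_castForm, wedge_smul_right] at h
    refine h.trans ?_
    have e : wedgeSeq (fun a => fderiv ℝ (G a) z) (extDeriv α z) = wedge (fderiv ℝ (G 0) z)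
      (wedgeSeq (fun a => fderiv ℝ (G a.succ) z) (extDeriv α z)) := rfl
    rw [pow_succ, mul_neg_one, castForm_smul, castForm_smul, e]
    ext v
    simp

end WedgeSeq

/-! ### Sums over tuples of indices -/

section Tuple

variable {n p : ℕ}

/-- `∑ C(m, i) F_m θ_m ∧ θ_{i₀} ∧ ⋯ ∧ θ_{iⱼ₋₁} ∧ α_i` over all indices `m` and `j`-tuples `i`, for
weights `C` that depend on the set of indices. -/
def tupleSum {j : ℕ} (C : Finset (Fin n) → ℂ) (θ : Fin n → Cn n →L[ℝ] ℂ) (F : Fin n → ℂ)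
    (α : (Fin j → Fin n) → Cn n [⋀^Fin p]→L[ℝ] ℂ) : Cn n [⋀^Fin (p + j + 1)]→L[ℝ] ℂ :=
  ∑ i : Fin j → Fin n, ∑ m, (C (insert m (Finset.univ.image i)) * F m) •
    wedge (θ m) (wedgeSeq (fun a => θ (i a)) (α i))

theorem image_insertNth {j : ℕ} (a : Fin (j + 1)) (m : Fin n) (i : Fin j → Fin n) :
    Finset.univ.image (a.insertNth m i : Fin (j + 1) → Fin n) =
      insert m (Finset.univ.image i) := by
  ext x
  simp only [Finset.mem_image, Finset.mem_univ, true_and, Finset.mem_insert]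
  constructor
  · rintro ⟨b, rfl⟩
    refine Fin.succAboveCases a ?_ (fun b => ?_) b
    · simp
    · right; exact ⟨b, by simp⟩
  · rintro (rfl | ⟨b, rfl⟩)
    · exact ⟨a, by simp⟩
    · exact ⟨a.succAbove b, by simp⟩

/-- Moving the a-th covector to the front costs (-1)ᵃ, which cancels the sign in the Koszul sum. As
C depends only on the set of indices, all j + 1 positions contribute the same sum. -/
theorem sum_wedgeSeq_koszul {j : ℕ} (C : Finset (Fin n) → ℂ) (θ : Fin n → Cn n →L[ℝ] ℂ)
    (F : Fin n → ℂ) (α : (Fin j → Fin n) → Cn n [⋀^Fin p]→L[ℝ] ℂ) :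
    ∑ i : Fin (j + 1) → Fin n, C (Finset.univ.image i) • wedgeSeq (fun a => θ (i a))
      (∑ a : Fin (j + 1), (-1 : ℂ) ^ (a : ℕ) • F (i a) • α (a.removeNth i)) =
      ((j : ℂ) + 1) • tupleSum C θ F α := by
  have h1 : ∀ i : Fin (j + 1) → Fin n, C (Finset.univ.image i) • wedgeSeq (fun a => θ (i a))
      (∑ a : Fin (j + 1), (-1 : ℂ) ^ (a : ℕ) • F (i a) • α (a.removeNth i)) =
      ∑ a : Fin (j + 1), (C (Finset.univ.image i) * F (i a)) •
        wedge (θ (i a)) (wedgeSeq (fun b => θ (a.removeNth i b)) (α (a.removeNth i))) := by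
    intro i
    rw [wedgeSeq_sum, Finset.smul_sum]
    refine Finset.sum_congr rfl fun a _ => ?_
    rw [wedgeSeq_smul, wedgeSeq_smul, wedgeSeq_eq_removeNth _ _ a]
    have h : (-1 : ℂ) ^ (a : ℕ) * (-1 : ℂ) ^ (a : ℕ) = 1 := by
      rw [← mul_pow]; simp
    simp only [smul_smul]
    congr 1
    linear_combination C (Finset.univ.image i) * F (i a) * h
  simp only [h1]
  rw [Finset.sum_comm]
  have h2 : ∀ a : Fin (j + 1), ∑ i : Fin (j + 1) → Fin n, (C (Finset.univ.image i) * F (i a)) •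
        wedge (θ (i a)) (wedgeSeq (fun b => θ (a.removeNth i b)) (α (a.removeNth i))) =
      tupleSum C θ F α := by
    intro a
    rw [← (Fin.insertNthEquiv (fun _ => Fin n) a).sum_comp, Fintype.sum_prod_type_right, tupleSum]
    refine Finset.sum_congr rfl fun i _ => Finset.sum_congr rfl fun m _ => ?_
    have h3 : a.removeNth (a.insertNth m i : Fin (j + 1) → Fin n) = i :=
      Fin.removeNth_insertNth _ _ _
    change (C (Finset.univ.image (a.insertNth m i : Fin (j + 1) → Fin n)) *
      F ((a.insertNth m i : Fin (j + 1) → Fin n) a)) •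
      wedge (θ ((a.insertNth m i : Fin (j + 1) → Fin n) a)) (wedgeSeq (fun b => θ
        (a.removeNth (a.insertNth m i : Fin (j + 1) → Fin n) b))
        (α (a.removeNth (a.insertNth m i : Fin (j + 1) → Fin n)))) = _
    rw [h3, image_insertNth, Fin.insertNth_apply_same]
  simp only [h2, Finset.sum_const, Finset.card_univ, Fintype.card_fin]
  rw [← Nat.cast_smul_eq_nsmul ℂ]
  push_cast
  rfl

end Tuple

/-! ### The descent from η to ψ -/

section Chain

variable {n p : ℕ} {ε : ℝ}

/-- The complex conjugate differential `dF̄`. -/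
def conjDiff (F : Cn n → ℂ) (z : Cn n) : Cn n →L[ℝ] ℂ :=
  fderiv ℝ (fun z => (starRingEnd ℂ) (F z)) z

/-- A family of cutoff functions `C S`, indexed by sets `S` of indices, such that
`dC_S = ∑_{m ∉ S} C_{S ∪ {m}} d|F_m|²` modulo the differentials `d|F_m|²` with `m ∈ S`. -/
structure IsCutoffFamily (ε : ℝ) (F : Fin n → Cn n → ℂ) (C : Finset (Fin n) → Cn n → ℂ) :
    Prop where
  smooth : ∀ S, ContDiff ℝ ∞ (C S)
  compact : ∀ S, HasCompactSupport (C S)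
  support : ∀ S, tsupport (C S) ⊆ ball 0 ε
  support_of_nonempty : ∀ S, S.Nonempty → 0 ∉ tsupport (C S)
  one_near : C ∅ =ᶠ[nhds 0] 1
  fderiv_eq : ∀ S, ∀ z ∈ ball 0 ε, ∃ g : Fin n → ℂ, (∀ m ∉ S, g m = C (insert m S) z) ∧
    fderiv ℝ (C S) z = ∑ m, g m • (F m z • conjDiff (F m) z +
      (starRingEnd ℂ) (F m z) • fderiv ℝ (F m) z)

variable {F : Fin n → Cn n → ℂ} {C : Finset (Fin n) → Cn n → ℂ}

theorem conjDiff_apply {F : Cn n → ℂ} {z : Cn n} (hF : DifferentiableAt ℂ F z) (u : Cn n) :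
    conjDiff F z u = (starRingEnd ℂ) (fderiv ℂ F z u) := by
  have h := (Complex.conjCLE : ℂ →L[ℝ] ℂ).hasFDerivAt.comp z
    (hF.hasFDerivAt.restrictScalars ℝ)
  have h' : conjDiff F z = _ := h.fderiv
  rw [h']
  simp

theorem conjDiff_smul {F : Cn n → ℂ} {z : Cn n} (hF : DifferentiableAt ℂ F z) (c : ℂ)
    (hc : ‖c‖ = 1) (u : Cn n) : conjDiff F z (c • u) = c ^ (-1 : ℤ) * conjDiff F z u := by
  rw [conjDiff_apply hF, conjDiff_apply hF, map_smul, smul_eq_mul, map_mul, zpow_neg_one,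
    Complex.inv_def, Complex.normSq_eq_norm_sq, hc]
  simp

theorem contDiffOn_conj {F : Cn n → ℂ} {U : Set (Cn n)} (hF : ContDiffOn ℝ ∞ F U) :
    ContDiffOn ℝ ∞ (fun z => (starRingEnd ℂ) (F z)) U :=
  (Complex.conjCLE : ℂ →L[ℝ] ℂ).contDiff.comp_contDiffOn hF

theorem IsCutoffFamily.support_punctured (hC : IsCutoffFamily ε F C) {S : Finset (Fin n)}
    (hS : S.Nonempty) : tsupport (C S) ⊆ ball 0 ε \ {0} := fun z hz =>
  ⟨hC.support S hz, fun h => hC.support_of_nonempty S hS (by rwa [← Set.mem_singleton_iff.1 h])⟩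

theorem IsCutoffFamily.eq_zero (hC : IsCutoffFamily ε F C) {S : Finset (Fin n)}
    (hS : S.Nonempty) {z : Cn n} (hz : z ∉ ball (0 : Cn n) ε \ {0}) : C S z = 0 :=
  image_eq_zero_of_notMem_tsupport fun h => hz (hC.support_punctured hS h)

/-- The integrand in the descent from `(n, k)`-forms to `(n, k - 1)`-forms. -/
def descentForm {j : ℕ} (F : Fin n → Cn n → ℂ) (C : Finset (Fin n) → Cn n → ℂ)
    (β : ExtForm n p j) (z : Cn n) : Cn n [⋀^Fin (p + j + 1)]→L[ℝ] ℂ :=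
  tupleSum (fun S => C S z) (fun m => conjDiff (F m) z) (fun m => F m z)
    fun i => component β (fun a => EuclideanSpace.single (i a) 1) z

/-- Against a form of full holomorphic degree only F_m dF̄_m survives from d|F_m|². An index m
already in the tuple contributes nothing because dF̄_m is repeated, which is why `IsCutoffFamily`
prescribes the coefficients only for m ∉ S and why the sum may run over all m. -/
theorem wedge_fderiv_cutoff (hC : IsCutoffFamily ε F C)
    (hF : ∀ m, DifferentiableOn ℂ (F m) (ball 0 ε)) {j : ℕ} (i : Fin j → Fin n) {m' : ℤ}
    {α : Cn n [⋀^Fin p]→L[ℝ] ℂ} (hα : HasWeight m' α) (hm : 2 * (n : ℤ) ≤ p + m') {z : Cn n}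
    (hz : z ∈ ball (0 : Cn n) ε) :
    wedge (fderiv ℝ (C (Finset.univ.image i)) z) (wedgeSeq (fun a => conjDiff (F (i a)) z) α) =
      ∑ m, (C (insert m (Finset.univ.image i)) z * F m z) •
        wedge (conjDiff (F m) z) (wedgeSeq (fun a => conjDiff (F (i a)) z) α) := by
  have hFz : ∀ m, DifferentiableAt ℂ (F m) z := fun m =>
    (hF m).differentiableAt (isOpen_ball.mem_nhds hz)
  obtain ⟨g, hg, hfd⟩ := hC.fderiv_eq (Finset.univ.image i) z hz
  have hw := HasWeight.wedgeSeq (θ := fun a => conjDiff (F (i a)) z)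
    (fun a => conjDiff_smul (hFz (i a))) hα
  rw [hfd, wedge_sum_left]
  refine Finset.sum_congr rfl fun m _ => ?_
  rw [wedge_smul_left, wedge_add_left, wedge_smul_left, wedge_smul_left,
    wedge_fderiv_eq_zero (hFz m) hw (by push_cast; linarith)]
  by_cases hmi : m ∈ Finset.univ.image i
  · obtain ⟨a, _, rfl⟩ := Finset.mem_image.1 hmi
    rw [wedge_wedgeSeq_self (fun a => conjDiff (F (i a)) z) α a]
    ext v
    simp
  · rw [hg m hmi]
    ext v
    simp [mul_assoc]

theorem descentForm_eq (hC : IsCutoffFamily ε F C)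
    (hF : ∀ m, DifferentiableOn ℂ (F m) (ball 0 ε)) {j : ℕ} {β : ExtForm n p j} {m' : ℤ}
    (hm : 2 * (n : ℤ) ≤ p + m') {z : Cn n} (hz : z ∈ ball (0 : Cn n) ε)
    (hβ : ∀ w, HasWeight m' (component β w z)) :
    descentForm F C β z = ∑ i : Fin j → Fin n, wedge (fderiv ℝ (C (Finset.univ.image i)) z)
      (wedgeSeq (fun a => conjDiff (F (i a)) z)
        (component β (fun a => EuclideanSpace.single (i a) 1) z)) :=
  Finset.sum_congr rfl fun i _ => (wedge_fderiv_cutoff hC hF i (hβ _) hm hz).symm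

/-- The sum over `j`-tuples `i` of `C_i dF̄_i ∧ α(e_i)`. -/
def tupleValue {j : ℕ} (F : Fin n → Cn n → ℂ) (C : Finset (Fin n) → Cn n → ℂ)
    (β : ExtForm n p j) (z : Cn n) : ℂ :=
  ∑ i : Fin j → Fin n, C (Finset.univ.image i) z * basisValue
    (wedgeSeq (fun a => conjDiff (F (i a)) z)
      (component β (fun a => EuclideanSpace.single (i a) 1) z))

/-- The algebraic half of a descent step: the factors F_m are absorbed into s ∧ β, at the price of
the number of positions in which m can stand. -/
theorem tupleValue_koszul {j : ℕ} {s : Cn n → Cn n →L[ℂ] ℂ}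
    (hFs : ∀ m z, F m z = s z (EuclideanSpace.single m 1)) (β : ExtForm n p j) (z : Cn n) :
    tupleValue F C (koszul s β) z =
      (-1 : ℂ) ^ p * ((j : ℂ) + 1) * basisValue (descentForm F C β z) := by
  have h := sum_wedgeSeq_koszul (fun S => C S z) (fun m => conjDiff (F m) z) (fun m => F m z)
    fun i : Fin j → Fin n => component β (fun a => EuclideanSpace.single (i a) 1) z
  have h' := congrArg (fun α => (-1 : ℂ) ^ p * basisValue α) h
  simp only [basisValue_smul, basisValue_sum, Finset.mul_sum] at h'
  rw [mul_assoc, descentForm]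
  refine Eq.trans ?_ h'
  refine Finset.sum_congr rfl fun i _ => ?_
  rw [component_koszul, wedgeSeq_smul, basisValue_smul, mul_left_comm]
  simp only [hFs]
  rfl

/-- The analytic half of a descent step. The integrand is ∑ dC_i ∧ dF̄_i ∧ β(e_i); integration by
parts gives one minus sign, and passing d across the j + 1 closed factors dF̄ gives (-1)ʲ⁺¹. The
tuples are nonempty, so the cutoffs vanish near 0 and the singularity of β there is harmless. -/
theorem integral_descentForm_succ (hC : IsCutoffFamily ε F C)
    (hF : ∀ m, DifferentiableOn ℂ (F m) (ball 0 ε)) {j : ℕ} {β : ExtForm n p (j + 1)} {m' : ℤ}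
    (hm : 2 * (n : ℤ) ≤ p + m') (hβs : ContDiffOn ℝ ∞ β (ball 0 ε \ {0}))
    (hβ : ∀ w, ∀ z ∈ ball 0 ε \ {0}, HasWeight m' (component β w z)) :
    ∫ z, basisValue (descentForm F C β z) ∂lebesgue n =
      (-1 : ℂ) ^ j * ∫ z, tupleValue F C (extDeriv β) z ∂lebesgue n := by
  have hU : IsOpen (ball (0 : Cn n) ε \ {0}) := isOpen_ball.sdiff isClosed_singleton
  have hFs : ∀ m, ContDiffOn ℝ ∞ (fun z => (starRingEnd ℂ) (F m z)) (ball (0 : Cn n) ε \ {0}) :=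
    fun m => contDiffOn_conj (((contDiffOn_of_holomorphic isOpen_ball (hF m)).restrict_scalars
      ℝ).mono Set.sdiff_subset)
  have hne : ∀ i : Fin (j + 1) → Fin n, (Finset.univ.image i).Nonempty := fun i =>
    ⟨i 0, Finset.mem_image_of_mem _ (Finset.mem_univ _)⟩
  let α : (Fin (j + 1) → Fin n) → Cn n → Cn n [⋀^Fin (p + (j + 1))]→L[ℝ] ℂ := fun i z =>
    wedgeSeq (fun a => conjDiff (F (i a)) z)
      (component β (fun a => EuclideanSpace.single (i a) 1) z)
  have hαs : ∀ i, ContDiffOn ℝ ∞ (α i) (ball (0 : Cn n) ε \ {0}) := fun i =>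
    contDiffOn_wedgeSeq (θ := fun a z => conjDiff (F (i a)) z)
      (fun a => (hFs (i a)).fderiv_of_isOpen hU (by simp)) (contDiffOn_component hβs _)
  have hpt : ∀ z, basisValue (descentForm F C β z) =
      ∑ i : Fin (j + 1) → Fin n, basisValue (wedge (fderiv ℝ (C (Finset.univ.image i)) z) (α i z)) := by
    intro z
    by_cases hz : z ∈ ball (0 : Cn n) ε \ {0}
    · rw [descentForm_eq hC hF hm hz.1 (fun w => hβ w z hz), basisValue_sum]
    · have h1 : ∀ i : Fin (j + 1) → Fin n, fderiv ℝ (C (Finset.univ.image i)) z = 0 := fun i =>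
        image_eq_zero_of_notMem_tsupport fun h =>
          hz (hC.support_punctured (hne i) (tsupport_fderiv_subset ℝ h))
      have h2 : ∀ (i : Fin (j + 1) → Fin n) m, C (insert m (Finset.univ.image i)) z = 0 :=
        fun i m => hC.eq_zero (Finset.insert_nonempty _ _) hz
      simp [descentForm, tupleSum, h1, h2]
  have hext : ∀ (i : Fin (j + 1) → Fin n) z, C (Finset.univ.image i) z *
      basisValue (extDeriv (α i) z) = (-1 : ℂ) ^ (j + 1) * (C (Finset.univ.image i) z * basisValue
        (wedgeSeq (fun a => conjDiff (F (i a)) z)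
          (component (extDeriv β) (fun a => EuclideanSpace.single (i a) 1) z))) := by
    intro i z
    by_cases hz : z ∈ ball (0 : Cn n) ε \ {0}
    · have h := extDeriv_wedgeSeq hU hz (fun a => hFs (i a))
        (contDiffOn_component hβs fun a => EuclideanSpace.single (i a) 1)
      have h' : extDeriv (α i) z = _ := h
      rw [h', basisValue_castForm, basisValue_smul,
        extDeriv_component (differentiableAt_of_contDiffOn hU hβs hz), mul_left_comm]
      rfl
    · rw [hC.eq_zero (hne i) hz]; ring
  have hint : ∀ i : Fin (j + 1) → Fin n, Integrable (fun z => C (Finset.univ.image i) z *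
      basisValue (extDeriv (α i) z)) (lebesgue n) := fun i =>
    integrable_mul_form hU (hC.smooth _).continuous (hC.compact _) (hC.support_punctured (hne i))
      (contDiffOn_extDeriv hU (hαs i)) _
  have hint' : ∀ i : Fin (j + 1) → Fin n, Integrable (fun z => C (Finset.univ.image i) z *
      basisValue (wedgeSeq (fun a => conjDiff (F (i a)) z)
          (component (extDeriv β) (fun a => EuclideanSpace.single (i a) 1) z))) (lebesgue n) := by
    intro i
    refine ((hint i).const_mul ((-1 : ℂ) ^ (j + 1))).congr (Filter.Eventually.of_forall fun z => ?_)
    simp only [hext i z]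
    rw [← mul_assoc, ← mul_pow]
    simp
  simp only [hpt]
  rw [integral_finsetSum]
  · simp only [tupleValue]
    rw [integral_finsetSum _ fun i _ => hint' i, Finset.mul_sum]
    refine Finset.sum_congr rfl fun i _ => ?_
    have hst := integral_wedge_fderiv hU (hC.smooth (Finset.univ.image i)) (hC.compact _)
      (hC.support_punctured (hne i)) (hαs i) (fun a => realBasisVec n a)
    refine hst.trans ?_
    have : ∫ z, C (Finset.univ.image i) z * (extDeriv (α i) z fun a => realBasisVec n a) ∂lebesgue n
        = _ := integral_congr_ae (Filter.Eventually.of_forall (hext i))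
    rw [this, integral_const_mul, pow_succ]
    ring
  · exact fun i _ => integrable_wedge_fderiv hU (hC.smooth _) ((hC.compact _).fderiv ℝ)
      ((tsupport_fderiv_subset ℝ).trans (hC.support_punctured (hne i))) (hαs i) _

/-- The last form of a Koszul lift, as a form of degree `2 n - 1`. -/
theorem IsKoszulLift.hasWeight {U : Set (Cn n)} {s : Cn n → Cn n →L[ℂ] ℂ} {ψ : ExtForm n n n}
    {β : ∀ k j : ℕ, ExtForm n (n + k) j} (hβ : IsKoszulLift U s ψ β) {k j : ℕ} (hkj : k + j + 1 = n)
    {z : Cn n} (hz : z ∈ U) (w : Fin j → Cn n) :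
    HasWeight ((n : ℤ) - k) (component (β k j) w z) := by
  intro c hc v
  have hc0 : c ≠ 0 := fun h => by simp [h] at hc
  have hcc : (starRingEnd ℂ) c = c⁻¹ := by
    rw [Complex.inv_def, Complex.normSq_eq_norm_sq, hc]; simp
  rw [component_apply, hβ.type k j hkj z hz c v, hcc, zpow_sub₀ hc0]
  simp [div_eq_mul_inv]

end Chain

section ChainMain

variable {N : ℕ} {ε : ℝ} {F : Fin (N + 1) → Cn (N + 1) → ℂ}
  {C : Finset (Fin (N + 1)) → Cn (N + 1) → ℂ} {s : Cn (N + 1) → Cn (N + 1) →L[ℂ] ℂ}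
  {φ : Cn (N + 1) → ℂ} {β : ∀ k j : ℕ, ExtForm (N + 1) (N + 1 + k) j}

theorem IsKoszulLift.koszul_start {U : Set (Cn (N + 1))}
    (hβ : IsKoszulLift U s (topSection φ) β) {z : Cn (N + 1)} (hz : z ∈ U)
    (w : Fin (N + 1) → Cn (N + 1)) :
    component (koszul s (β 0 N)) w z = (φ z * topForm (N + 1) w) • topFormReal (N + 1) := by
  ext v
  have h := hβ.start N rfl z hz v w
  refine h.trans ?_
  simp [topSection, topFormReal_apply]
  ring

/-- The form s ∧ η is closed, being ψ in dimension one and exact otherwise. Hence s ∧ dη = 0, and s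
has no zeros on U. -/
theorem IsKoszulLift.extDeriv_last {U : Set (Cn (N + 1))} (hU : IsOpen U)
    (hs : ContDiffOn ℝ ∞ s U) (hsh : ∀ v, DifferentiableOn ℂ (fun z => s z v) U)
    (h0 : ∀ z ∈ U, s z ≠ 0) (hφ : DifferentiableOn ℂ φ U)
    (hβ : IsKoszulLift U s (topSection φ) β) {z : Cn (N + 1)} (hz : z ∈ U)
    (w : Fin 0 → Cn (N + 1)) : extDeriv (component (β N 0) w) z = 0 := by
  have hsm := hβ.smooth N 0 rfl
  have hk := extDeriv_koszul hU hs hsh hsm (fun w z hz => hβ.hasWeight rfl hz w)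
    (by push_cast; linarith) hz
  have hzero : ∀ w, extDeriv (component (koszul s (β N 0)) w) z = 0 := by
    intro w
    rcases N with _ | M
    · have hev : component (koszul s (β 0 0)) w =ᶠ[nhds z]
          fun z => φ z • (topForm 1 w • topFormReal 1) := by
        filter_upwards [hU.mem_nhds hz] with y hy
        rw [hβ.koszul_start hy w]
        ext v
        simp [mul_assoc]
      have hφz := hφ.differentiableAt (hU.mem_nhds hz)
      refine hev.extDeriv_eq.trans ?_
      rw [extDeriv_fun_smul_form (hφz.restrictScalars ℝ) (differentiableAt_const _),
        wedge_smul_right, wedge_fderiv_eq_zero hφz topFormReal_hasWeight (by norm_num)]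
      ext v
      simp [extDeriv, ContinuousAlternatingMap.alternatizeUncurryFin_apply]
    · have hev : component (koszul s (β (M + 1) 0)) w =ᶠ[nhds z]
          component (extDeriv (β M 1)) w := by
        filter_upwards [hU.mem_nhds hz] with y hy
        ext v
        have := hβ.step M 0 rfl y hy
        exact congrArg (fun η => η v w) this
      have hsm' := hβ.smooth M 1 rfl
      refine hev.extDeriv_eq.trans ?_
      rw [extDeriv_component (differentiableAt_of_contDiffOn hU (contDiffOn_extDeriv hU hsm') hz)]
      ext v
      rw [component_apply, extDeriv_extDeriv_of_mem hU hsm' hz]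
      rfl
  rw [extDeriv_component (differentiableAt_of_contDiffOn hU hsm hz)]
  -- Since ⋀⁰Ω is trivial, s ∧ dη evaluated on u is s(u) dη up to sign, and s(u) can be cancelled.
  obtain ⟨u, hu⟩ : ∃ u, s z u ≠ 0 := by
    by_contra h
    push Not at h
    exact h0 z hz (ContinuousLinearMap.ext h)
  ext v
  have h1 := hzero (fun _ => u)
  rw [extDeriv_component (differentiableAt_of_contDiffOn hU (contDiffOn_koszul hs hsm) hz)] at h1
  have h2 : component (koszul s fun z => -extDeriv (β N 0) z) (fun _ : Fin 1 => u) z = 0 := by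
    ext v
    have := congrArg (fun η => η v) h1
    simp only [component_apply] at this ⊢
    rw [hk] at this
    exact this
  rw [component_koszul] at h2
  have h3 := congrArg (fun η => η v) h2
  simp [hu] at h3
  rw [Subsingleton.elim w (Fin.removeNth 0 fun _ => u)]
  exact h3

/-- The start of the descent. Only the empty tuple occurs, the integrand is dC_∅ ∧ η, and C_∅ is one
near the origin, so the sphere integral appears. -/
theorem integral_descentForm_zero (hC : IsCutoffFamily ε F C)
    (hF : ∀ m, DifferentiableOn ℂ (F m) (ball 0 ε))
    (hs : ContDiffOn ℝ ∞ s (ball 0 ε)) (hsh : ∀ v, DifferentiableOn ℂ (fun z => s z v) (ball 0 ε))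
    (h0 : ∀ z ∈ ball 0 ε \ {0}, s z ≠ 0) (hφ : DifferentiableOn ℂ φ (ball 0 ε))
    (hβ : IsKoszulLift (ball 0 ε \ {0}) s (topSection φ) β) {r : ℝ} (hr : 0 < r) (hrε : r < ε) :
    ∫ z, basisValue (descentForm F C (β N 0) z) ∂lebesgue (N + 1) =
      -sphereIntegral r (lastForm β) := by
  have hU : IsOpen (ball (0 : Cn (N + 1)) ε \ {0}) := isOpen_ball.sdiff isClosed_singleton
  have hsm := hβ.smooth N 0 rfl
  have hst := integral_wedge_cutoff (n := N + 1) (by omega)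
    (contDiffOn_component hsm Fin.elim0)
    (fun z hz => hβ.extDeriv_last hU (hs.mono Set.sdiff_subset)
      (fun v => (hsh v).mono Set.sdiff_subset) h0 (hφ.mono Set.sdiff_subset) hz _)
    (hC.smooth ∅) (hC.compact ∅) (hC.support ∅) hC.one_near hr hrε
  refine Eq.trans ?_ hst
  refine integral_congr_ae (Filter.Eventually.of_forall fun z => ?_)
  by_cases hz : z ∈ ball (0 : Cn (N + 1)) ε \ {0}
  · simp only
    rw [descentForm_eq hC hF (m' := ((N + 1 : ℕ) : ℤ) - N) (by push_cast; linarith) hz.1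
      (fun w => hβ.hasWeight rfl hz w), Fintype.sum_unique]
    have e1 : ∀ w : Fin 0 → Cn (N + 1), component (β N 0) w z = component (β N 0) Fin.elim0 z :=
      fun w => by rw [Subsingleton.elim w Fin.elim0]
    have e2 : ∀ i : Fin 0 → Fin (N + 1), Finset.univ.image i = ∅ := fun i => by simp
    rw [e2, wedgeSeq_zero, e1]
    rfl
  · have h1 : fderiv ℝ (C ∅) z = 0 := image_eq_zero_of_notMem_tsupport fun h =>
      hz (tsupport_fderiv_subset_punctured (hC.support ∅) hC.one_near h)
    have h2 : ∀ m, C {m} z = 0 := fun m => hC.eq_zero (Finset.singleton_nonempty m) hz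
    simp [descentForm, tupleSum, h1, h2]

/-- Induction on the number j of factors dF̄. Integration by parts produces dβ_k, the lift equation
rewrites it as s ∧ β_{k+1}, and `tupleValue_koszul` leads back to the case j; the factors j + 1
accumulate to the factorial. -/
theorem integral_descentForm (hC : IsCutoffFamily ε F C)
    (hF : ∀ m, DifferentiableOn ℂ (F m) (ball 0 ε))
    (hFs : ∀ m z, F m z = s z (EuclideanSpace.single m 1))
    (hs : ContDiffOn ℝ ∞ s (ball 0 ε)) (hsh : ∀ v, DifferentiableOn ℂ (fun z => s z v) (ball 0 ε))
    (h0 : ∀ z ∈ ball 0 ε \ {0}, s z ≠ 0) (hφ : DifferentiableOn ℂ φ (ball 0 ε))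
    (hβ : IsKoszulLift (ball 0 ε \ {0}) s (topSection φ) β) {r : ℝ} (hr : 0 < r) (hrε : r < ε) :
    ∀ j k : ℕ, k + j = N → ∫ z, basisValue (descentForm F C (β k j) z) ∂lebesgue (N + 1) =
      (-1 : ℂ) ^ (j + 1) * (j.factorial : ℂ) * sphereIntegral r (lastForm β)
  | 0, k, h => by
    obtain rfl : k = N := h
    rw [integral_descentForm_zero hC hF hs hsh h0 hφ hβ hr hrε]
    simp
  | j + 1, k, h => by
    have ih := integral_descentForm hC hF hFs hs hsh h0 hφ hβ hr hrε j (k + 1) (by omega)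
    rw [integral_descentForm_succ hC hF (m' := ((N + 1 : ℕ) : ℤ) - k) (by push_cast; linarith)
      (hβ.smooth k (j + 1) (by omega)) (fun w z hz => hβ.hasWeight (by omega) hz w)]
    have hval : ∀ z, tupleValue F C (extDeriv (β k (j + 1))) z =
        (-1 : ℂ) ^ (N + 1 + (k + 1)) * ((j : ℂ) + 1) *
          basisValue (descentForm F C (β (k + 1) j) z) := by
      intro z
      rw [← tupleValue_koszul hFs]
      refine Finset.sum_congr rfl fun i _ => ?_
      by_cases hz : z ∈ ball (0 : Cn (N + 1)) ε \ {0}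
      · congr 3
        ext v
        exact (congrArg (fun η => η v fun a => EuclideanSpace.single (i a) 1)
          (hβ.step k j (by omega) z hz)).symm
      · rw [hC.eq_zero ⟨i 0, Finset.mem_image_of_mem _ (Finset.mem_univ _)⟩ hz, zero_mul, zero_mul]
    simp only [hval]
    rw [integral_const_mul, ih, Nat.factorial_succ]
    -- Here N = k + j + 1, so the exponents differ by an even number.
    have : (-1 : ℂ) ^ j * ((-1 : ℂ) ^ (N + 1 + (k + 1)) * (-1 : ℂ) ^ (j + 1)) =
        (-1 : ℂ) ^ (j + 1 + 1) := by
      rw [← pow_add, ← pow_add,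
        show j + (N + 1 + (k + 1) + (j + 1)) = j + 1 + 1 + 2 * (k + j + 1) by omega,
        pow_add _ _ (2 * _), pow_mul]
      simp
    push_cast
    linear_combination ((j : ℂ) + 1) * (j.factorial : ℂ) * sphereIntegral r (lastForm β) * this

end ChainMain

/-! ### The top-degree form dF̄₁ ∧ ⋯ ∧ dF̄ₙ ∧ dz₁ ∧ ⋯ ∧ dzₙ -/

section TopDegree

variable {n : ℕ}

/-- The definition of `wedge` is the Laplace expansion along the first row, so each covector adds a
row on top of the matrix of coordinates. -/
theorem wedgeSeq_topFormReal : ∀ {j : ℕ} (θ : Fin j → Cn n →L[ℝ] ℂ) (v : Fin (n + j) → Cn n),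
    wedgeSeq θ (topFormReal n) v = Matrix.det (Matrix.of fun r b : Fin (n + j) =>
      if h : (r : ℕ) < j then θ ⟨r, h⟩ (v b) else v b ⟨r - j, by omega⟩)
  | 0, θ, v => by
    rw [wedgeSeq_zero, topFormReal_apply]
    have h : topForm n v = (EuclideanSpace.basisFun (Fin n) ℂ).toBasis.det v := rfl
    rw [h, Module.Basis.det_apply]
    congr 1
  | j + 1, θ, v => by
    rw [wedgeSeq_succ, wedge_apply]
    refine Eq.trans ?_ (Matrix.det_succ_row_zero _).symm
    refine Finset.sum_congr rfl fun b _ => ?_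
    rw [wedgeSeq_topFormReal (Fin.tail θ), ← mul_assoc]
    congr 1
    congr 1
    ext r c
    simp only [Matrix.of_apply, Matrix.submatrix_apply, Fin.val_succ, Fin.tail, Fin.removeNth]
    by_cases h : (r : ℕ) < j
    · rw [dif_pos h, dif_pos (by omega)]
      rfl
    · rw [dif_neg h, dif_neg (by omega)]
      exact congrArg (v (b.succAbove c)).ofLp (Fin.ext (by simp))

/-- The value of `θ₁ ∧ ⋯ ∧ θₙ ∧ dz₁ ∧ ⋯ ∧ dzₙ` on the standard real basis, as an alternating
function of the covectors. -/
def topValue (n : ℕ) : (Cn n →L[ℝ] ℂ) [⋀^Fin n]→ₗ[ℂ] ℂ where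
  toFun θ := Matrix.detRowAlternating fun r b : Fin (n + n) =>
    if h : (r : ℕ) < n then θ ⟨r, h⟩ (realBasisVec n b) else realBasisVec n b ⟨r - n, by omega⟩
  map_update_add' := by
    intro inst θ m x y
    have hu : ∀ x : Cn n →L[ℝ] ℂ, (fun r b : Fin (n + n) => if h : (r : ℕ) < n then
        Function.update θ m x ⟨r, h⟩ (realBasisVec n b) else realBasisVec n b ⟨r - n, by omega⟩) =
        Function.update (fun r b : Fin (n + n) => if h : (r : ℕ) < n then
        θ ⟨r, h⟩ (realBasisVec n b) else realBasisVec n b ⟨r - n, by omega⟩)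
        (Fin.castAdd n m) (fun b => x (realBasisVec n b)) := by
      intro x
      funext r
      by_cases hr : r = Fin.castAdd n m
      · subst hr
        simp
      · rw [Function.update_of_ne hr]
        funext b
        by_cases h : (r : ℕ) < n
        · rw [dif_pos h, dif_pos h, Function.update_of_ne]
          rintro rfl
          exact hr rfl
        · rw [dif_neg h, dif_neg h]
    simp only [hu]
    rw [← AlternatingMap.map_update_add]
    rfl
  map_update_smul' := by
    intro inst θ m c x
    have hu : ∀ x : Cn n →L[ℝ] ℂ, (fun r b : Fin (n + n) => if h : (r : ℕ) < n then
        Function.update θ m x ⟨r, h⟩ (realBasisVec n b) else realBasisVec n b ⟨r - n, by omega⟩) =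
        Function.update (fun r b : Fin (n + n) => if h : (r : ℕ) < n then
        θ ⟨r, h⟩ (realBasisVec n b) else realBasisVec n b ⟨r - n, by omega⟩)
        (Fin.castAdd n m) (fun b => x (realBasisVec n b)) := by
      intro x
      funext r
      by_cases hr : r = Fin.castAdd n m
      · subst hr
        simp
      · rw [Function.update_of_ne hr]
        funext b
        by_cases h : (r : ℕ) < n
        · rw [dif_pos h, dif_pos h, Function.update_of_ne]
          rintro rfl
          exact hr rfl
        · rw [dif_neg h, dif_neg h]
    simp only [hu]
    rw [← AlternatingMap.map_update_smul]
    rfl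
  map_eq_zero_of_eq' := by
    intro θ a b hab hne
    refine AlternatingMap.map_eq_zero_of_eq _ _ (i := Fin.castAdd n a) (j := Fin.castAdd n b) ?_ ?_
    · simp [hab]
    · exact fun h => hne (Fin.castAdd_injective _ _ h)

theorem basisValue_wedgeSeq_topFormReal (θ : Fin n → Cn n →L[ℝ] ℂ) :
    basisValue (wedgeSeq θ (topFormReal n)) = topValue n θ := wedgeSeq_topFormReal θ _

/-- The matrix of `dz̄₁, …, dz̄ₙ, dz₁, …, dzₙ` in the standard real basis. -/
def realBasisEntry (n r b : ℕ) : ℂ :=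
  if r < n then (if r = b / 2 then (if Even b then 1 else -Complex.I) else 0)
  else (if r - n = b / 2 then (if Even b then 1 else Complex.I) else 0)

theorem det_realBasisEntry : ∀ n : ℕ, Matrix.det (Matrix.of fun r b : Fin (2 * n) =>
    realBasisEntry n r b) = (-1 : ℂ) ^ (n * (n - 1) / 2) * (2 * Complex.I) ^ n
  | 0 => by simp
  | n + 1 => by
    have ih := det_realBasisEntry n
    -- The row of dz̄₁ lives in columns 0 and 1. Once it and column c are deleted, the other of
    -- these two columns has a single nonzero entry d, in the row of dz₁, now row n. Expanding there
    -- gives the sign (-1)ⁿ and leaves the matrix of dimension n.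
    have key : ∀ (c : Fin (2 * n + 2)), (c : ℕ) < 2 → ∀ d : ℂ,
        (∀ r : Fin (2 * n + 1), realBasisEntry (n + 1) r.succ (1 - c : ℕ) =
          if (r : ℕ) = n then d else 0) →
        Matrix.det ((Matrix.of fun r b : Fin (2 * n + 2) =>
          realBasisEntry (n + 1) r b).submatrix Fin.succ c.succAbove) =
        (-1) ^ n * d * ((-1 : ℂ) ^ (n * (n - 1) / 2) * (2 * Complex.I) ^ n) := by
      intro c hc d hd
      have hsucc : ∀ b : Fin (2 * n), ((c.succAbove b.succ : Fin (2 * n + 2)) : ℕ) = b + 2 := by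
        intro b
        rw [Fin.succAbove_of_le_castSucc]
        · simp
        · rw [Fin.le_def]; simp; omega
      have hzero : ((c.succAbove (0 : Fin (2 * n + 1)) : Fin (2 * n + 2)) : ℕ) = 1 - c := by
        rcases Nat.lt_or_ge c 1 with h | h
        · have : c = 0 := Fin.ext (by change (c : ℕ) = 0; omega)
          subst this; simp
        · rw [Fin.succAbove_of_castSucc_lt]
          · change 0 = 1 - (c : ℕ); omega
          · change 0 < (c : ℕ); omega
      rw [Matrix.det_succ_column_zero, Finset.sum_eq_single (⟨n, by omega⟩ : Fin (2 * n + 1))]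
      · rw [← ih]
        simp only [Matrix.submatrix_apply, Matrix.of_apply, hzero, hd, if_true]
        congr 2
        ext r b
        simp only [Matrix.submatrix_apply, Matrix.of_apply, hsucc, Fin.val_succ]
        have hr : (((⟨n, by omega⟩ : Fin (2 * n + 1)).succAbove r : Fin (2 * n + 1)) : ℕ) =
            if (r : ℕ) < n then (r : ℕ) else r + 1 := by
          rw [Fin.succAbove]
          split_ifs with h1 h2 h2 <;> simp [Fin.lt_def] at * <;> omega
        rw [hr]
        have hb : (b + 2 : ℕ) / 2 = b / 2 + 1 := by omega
        have he : Even (b + 2 : ℕ) ↔ Even (b : ℕ) := by simp [Nat.even_add]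
        simp only [realBasisEntry, hb, he]
        split_ifs <;> first | rfl | omega
      · intro r _ hr
        have : (r : ℕ) ≠ n := fun h => hr (Fin.ext h)
        simp only [Matrix.submatrix_apply, Matrix.of_apply, hzero, hd, if_neg this]
        ring
      · simp
    have h0 := key 0 (by simp) Complex.I (by
      intro r
      rcases lt_trichotomy (r : ℕ) n with h | h | h
      · simp [realBasisEntry, h, h.ne]
      · simp [realBasisEntry, h]
      · have h1 : ¬(r : ℕ) < n := by omega
        have h2 : (r : ℕ) - n ≠ 0 := by omega
        simp [realBasisEntry, h1, h2, h.ne'])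
    have h1 := key 1 (by simp) 1 (by
      intro r
      rcases lt_trichotomy (r : ℕ) n with h | h | h
      · simp [realBasisEntry, h, h.ne]
      · simp [realBasisEntry, h]
      · have h1 : ¬(r : ℕ) < n := by omega
        have h2 : (r : ℕ) - n ≠ 0 := by omega
        simp [realBasisEntry, h1, h2, h.ne'])
    change Matrix.det (Matrix.of fun r b : Fin (2 * n + 2) => realBasisEntry (n + 1) r b) = _
    rw [Matrix.det_succ_row_zero, Fin.sum_univ_succ, Fin.sum_univ_succ, Finset.sum_eq_zero]
    · have e0 : realBasisEntry (n + 1) 0 0 = 1 := by simp [realBasisEntry]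
      have e1 : realBasisEntry (n + 1) 0 1 = -Complex.I := by simp [realBasisEntry]
      simp only [Fin.succ_zero_eq_one] at *
      rw [h0, h1]
      simp only [Matrix.of_apply, Fin.val_zero, Fin.val_one, e0, e1]
      have hexp : (n + 1) * (n + 1 - 1) / 2 = n * (n - 1) / 2 + n := by
        rcases n with _ | n
        · rfl
        · simp only [Nat.add_sub_cancel]
          rw [show (n + 1 + 1) * (n + 1) = (n + 1) * n + (n + 1) * 2 by ring,
            Nat.add_mul_div_right _ _ (by norm_num)]
      rw [hexp, pow_add, pow_succ]
      ring
    · intro b _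
      have : realBasisEntry (n + 1) 0 (b.succ.succ : Fin (2 * n + 2)) = 0 := by
        simp only [realBasisEntry, Fin.val_succ]
        rw [if_pos (by omega), if_neg (by omega)]
      simp only [Matrix.of_apply, Fin.val_zero, this]
      ring

/-- The conjugate coordinate functions. -/
def conjCoord (l : Fin n) : Cn n →L[ℝ] ℂ :=
  (Complex.conjCLE : ℂ →L[ℝ] ℂ).comp ((EuclideanSpace.proj l : Cn n →L[ℂ] ℂ).restrictScalars ℝ)

theorem conjCoord_apply (l : Fin n) (v : Cn n) : conjCoord l v = (starRingEnd ℂ) (v l) := rfl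

theorem topValue_conjCoord : topValue n (fun l => conjCoord l) =
    (-1 : ℂ) ^ (n * (n - 1) / 2) * (2 * Complex.I) ^ n := by
  have h : ∀ m, ∀ hm : m = n + n, Matrix.det (Matrix.of fun r b : Fin m => realBasisEntry n r b) =
      topValue n (fun l => conjCoord l) := by
    rintro m rfl
    refine congrArg Matrix.det ?_
    ext r b
    simp only [Matrix.of_apply, realBasisEntry, conjCoord_apply, realBasisVec]
    by_cases hr : (r : ℕ) < n
    · rw [dif_pos hr, if_pos hr]
      split_ifs <;> simp
    · rw [dif_neg hr, if_neg hr]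
  rw [← h (2 * n) (by omega), det_realBasisEntry]

/-- Conjugates of complex linear forms are combinations of the dz̄_l, so by alternation the value is
a determinant times the value on dz̄₁, …, dz̄ₙ. -/
theorem topValue_conj (θ : Fin n → Cn n →L[ℝ] ℂ) (σ : Fin n → Cn n →L[ℂ] ℂ)
    (h : ∀ m v, θ m v = (starRingEnd ℂ) (σ m v)) :
    topValue n θ = (-1 : ℂ) ^ (n * (n - 1) / 2) * (2 * Complex.I) ^ n * (starRingEnd ℂ)
      (Matrix.det (Matrix.of fun m l : Fin n => σ m (EuclideanSpace.single l 1))) := by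
  let L : (Fin n → ℂ) →ₗ[ℂ] (Cn n →L[ℝ] ℂ) :=
    { toFun := fun c => ∑ l, c l • conjCoord l
      map_add' := fun c d => by ext v; simp [add_mul, Finset.sum_add_distrib]
      map_smul' := fun c d => by ext v; simp [mul_assoc, Finset.mul_sum] }
  have hL : ∀ l, L (Pi.basisFun ℂ (Fin n) l) = conjCoord l := by
    intro l
    change ∑ l', _ • conjCoord l' = _
    rw [Finset.sum_eq_single l]
    · simp
    · intro l' _ hl
      ext v
      simp [hl]
    · simp
  have hθ : θ = fun m => L fun l => (starRingEnd ℂ) (σ m (EuclideanSpace.single l 1)) := by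
    funext m
    ext v
    change _ = (∑ l, _ • conjCoord l) v
    rw [h, clm_eq_sum, map_sum]
    simp [conjCoord_apply, mul_comm]
  have hdet := AlternatingMap.congr_fun
    (((topValue n).compLinearMap L).eq_smul_basis_det (Pi.basisFun ℂ (Fin n)))
    fun m l => (starRingEnd ℂ) (σ m (EuclideanSpace.single l 1))
  rw [hθ]
  refine Eq.trans hdet ?_
  rw [AlternatingMap.smul_apply, AlternatingMap.compLinearMap_apply]
  simp only [hL, topValue_conjCoord, smul_eq_mul]
  congr 1
  rw [Pi.basisFun_det, RingHom.map_det]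
  rfl

end TopDegree

/-! ### The sphere integral as an integral over the ball -/

section ChainEnd

variable {N : ℕ} {ε : ℝ} {F : Fin (N + 1) → Cn (N + 1) → ℂ}
  {C : Finset (Fin (N + 1)) → Cn (N + 1) → ℂ} {s : Cn (N + 1) → Cn (N + 1) →L[ℂ] ℂ}
  {φ : Cn (N + 1) → ℂ} {β : ∀ k j : ℕ, ExtForm (N + 1) (N + 1 + k) j}

/-- Tuples with a repetition vanish. A permutation contributes its sign twice, from the e_i and from
the θ_i, so all n! terms agree. -/
theorem sum_topForm_mul_topValue {n : ℕ} (C : Finset (Fin n) → ℂ) (θ : Fin n → Cn n →L[ℝ] ℂ) :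
    ∑ i : Fin n → Fin n, C (Finset.univ.image i) *
      (topForm n (fun a => EuclideanSpace.single (i a) 1) * topValue n (fun a => θ (i a))) =
      (n.factorial : ℂ) * (C Finset.univ * topValue n θ) := by
  have h := Fintype.sum_of_injective (fun σ : Equiv.Perm (Fin n) => (σ : Fin n → Fin n))
    (fun σ τ h => Equiv.coe_fn_injective h) (fun _ => C Finset.univ * topValue n θ)
    (fun i : Fin n → Fin n => C (Finset.univ.image i) *
      (topForm n (fun a => EuclideanSpace.single (i a) 1) * topValue n (fun a => θ (i a))))
    (fun i hi => ?_) (fun σ => ?_)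
  · rw [← h]
    simp [Fintype.card_perm]
  · have hni : ¬Function.Injective i := fun hinj =>
      hi ⟨Equiv.ofBijective i (Finite.injective_iff_bijective.1 hinj), rfl⟩
    have : ¬Function.Injective fun a => θ (i a) := fun h' => hni fun a b hab => h' (by simp [hab])
    simp [AlternatingMap.map_eq_zero_of_not_injective _ _ this]
  · have h1 : Finset.univ.image (σ : Fin n → Fin n) = Finset.univ :=
      Finset.image_univ_of_surjective σ.surjective
    have h2 : topValue n (fun a => θ (σ a)) = Equiv.Perm.sign σ • topValue n θ :=
      (topValue n).map_perm θ σ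
    have h3 : topForm n (fun a => EuclideanSpace.single (σ a) 1) = Equiv.Perm.sign σ • (1 : ℂ) := by
      have h := (EuclideanSpace.basisFun (Fin n) ℂ).toBasis.det.map_perm
        (EuclideanSpace.basisFun (Fin n) ℂ).toBasis σ
      rw [Module.Basis.det_self] at h
      rw [← h]
      have : (fun a => EuclideanSpace.single (σ a) 1) =
          (EuclideanSpace.basisFun (Fin n) ℂ).toBasis ∘ σ := by
        funext a; simp
      rw [this]
      rfl
    simp only [h1, h2, h3]
    rcases Int.units_eq_one_or (Equiv.Perm.sign σ) with h | h <;> simp [h]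

/-- The sphere integral of the last form of a Koszul lift as an integral over the ball, for a family
of cutoff functions. -/
theorem sphereIntegral_lastForm (hC : IsCutoffFamily ε F C)
    (hF : ∀ m, DifferentiableOn ℂ (F m) (ball 0 ε))
    (hFs : ∀ m z, F m z = s z (EuclideanSpace.single m 1))
    (hs : ContDiffOn ℝ ∞ s (ball 0 ε)) (hsh : ∀ v, DifferentiableOn ℂ (fun z => s z v) (ball 0 ε))
    (h0 : ∀ z ∈ ball 0 ε \ {0}, s z ≠ 0) (hφ : DifferentiableOn ℂ φ (ball 0 ε))
    (hβ : IsKoszulLift (ball 0 ε \ {0}) s (topSection φ) β) {r : ℝ} (hr : 0 < r) (hrε : r < ε) :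
    sphereIntegral r (lastForm β) =
      (-1 : ℂ) ^ ((N + 1) * N / 2) * (2 * Complex.I) ^ (N + 1) *
      ∫ z, C Finset.univ z * (φ z * (starRingEnd ℂ) (Matrix.det (Matrix.of fun m l =>
        fderiv ℂ (F m) z (EuclideanSpace.single l 1)))) ∂lebesgue (N + 1) := by
  have h1 := integral_descentForm hC hF hFs hs hsh h0 hφ hβ hr hrε N 0 (by omega)
  have h2 : ∀ z, tupleValue F C (koszul s (β 0 N)) z = ((N + 1).factorial : ℂ) *
      ((-1 : ℂ) ^ ((N + 1) * N / 2) * (2 * Complex.I) ^ (N + 1) *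
      (C Finset.univ z * (φ z * (starRingEnd ℂ) (Matrix.det (Matrix.of fun m l =>
        fderiv ℂ (F m) z (EuclideanSpace.single l 1)))))) := by
    intro z
    by_cases hz : z ∈ ball (0 : Cn (N + 1)) ε \ {0}
    · have hd : ∀ m, DifferentiableAt ℂ (F m) z := fun m =>
        (hF m).differentiableAt (isOpen_ball.mem_nhds hz.1)
      have h3 := sum_topForm_mul_topValue (fun S => C S z) fun m => conjDiff (F m) z
      rw [topValue_conj (fun m => conjDiff (F m) z) (fun m => fderiv ℂ (F m) z)
        (fun m v => conjDiff_apply (hd m) v)] at h3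
      rw [show N + 1 - 1 = N from rfl] at h3
      have h4 : tupleValue F C (koszul s (β 0 N)) z = φ z *
          ∑ i : Fin (N + 1) → Fin (N + 1), C (Finset.univ.image i) z *
          (topForm (N + 1) (fun a => EuclideanSpace.single (i a) 1) *
            topValue (N + 1) (fun a => conjDiff (F (i a)) z)) := by
        rw [tupleValue, Finset.mul_sum]
        refine Finset.sum_congr rfl fun i _ => ?_
        have h5 : wedgeSeq (fun a => conjDiff (F (i a)) z)
            (component (koszul s (β 0 N)) (fun a => EuclideanSpace.single (i a) 1) z) =
            (φ z * topForm (N + 1) (fun a => EuclideanSpace.single (i a) 1)) •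
            wedgeSeq (fun a => conjDiff (F (i a)) z) (topFormReal (N + 1)) := by
          rw [← wedgeSeq_smul]
          exact congrArg _ (hβ.koszul_start hz _)
        have h6 := congrArg basisValue h5
        rw [basisValue_smul, basisValue_wedgeSeq_topFormReal] at h6
        refine (congrArg (C (Finset.univ.image i) z * ·) h6).trans ?_
        ring
      rw [h4, h3]
      ring
    · rw [hC.eq_zero ⟨0, Finset.mem_univ _⟩ hz, zero_mul, mul_zero, mul_zero]
      refine Finset.sum_eq_zero fun i _ => ?_
      rw [hC.eq_zero ⟨i 0, Finset.mem_image_of_mem _ (Finset.mem_univ _)⟩ hz, zero_mul]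
  have h3 : ∫ z, tupleValue F C (koszul s (β 0 N)) z ∂lebesgue (N + 1) =
      ((N + 1).factorial : ℂ) * sphereIntegral r (lastForm β) := by
    simp only [tupleValue_koszul hFs]
    rw [integral_const_mul, h1, Nat.factorial_succ]
    have : (-1 : ℂ) ^ (N + 1 + 0) * (-1 : ℂ) ^ (N + 1) = 1 := by
      rw [add_zero, ← mul_pow]; simp
    push_cast
    linear_combination ((N : ℂ) + 1) * (N.factorial : ℂ) * sphereIntegral r (lastForm β) * this
  simp only [h2] at h3
  rw [integral_const_mul, integral_const_mul] at h3
  -- The factorial accumulated by the descent cancels the number of permutations in the last sum.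
  exact (mul_left_cancel₀ (Nat.cast_ne_zero.2 (Nat.factorial_ne_zero _)) h3).symm

end ChainEnd

/-! ### Construction of the cutoff family -/

section CutoffFamily

variable {n : ℕ} {ε R t : ℝ} {F : Fin n → Cn n → ℂ} {δ : Fin n → ℝ}

/-- The product cutoff functions built from step functions and bumps in `|F_l|²`, truncated to the
ball of radius `R`. -/
def productCutoff (F : Fin n → Cn n → ℂ) (δ : Fin n → ℝ) (R : ℝ) {t : ℝ} (ht : 0 < t)
    (S : Finset (Fin n)) (z : Cn n) : ℂ := by
  classical
  exact if z ∈ ball (0 : Cn n) R then ∏ l, ((if l ∈ S then -unitBump (δ l ^ 2) t ht (‖F l z‖ ^ 2)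
    else stepDown (δ l ^ 2) t ht (‖F l z‖ ^ 2) : ℝ) : ℂ) else 0

/-- Compactness of the sphere turns the strict separation into a uniform margin, which leaves room
for the width t of the bumps. -/
theorem exists_separation (hn : 1 ≤ n) (hF : ∀ m, ContinuousOn (F m) (ball 0 ε)) (hRε : R < ε)
    (hδ : ∀ i, 0 < δ i) (hsep : ∀ z, ‖z‖ = R → ∃ i, δ i < ‖F i z‖) :
    ∃ t₀ > 0, ∀ z : Cn n, ‖z‖ = R → ∃ i, δ i ^ 2 + t₀ < ‖F i z‖ ^ 2 := by
  have hne : (Finset.univ : Finset (Fin n)).Nonempty := ⟨⟨0, hn⟩, Finset.mem_univ _⟩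
  rcases (sphere (0 : Cn n) R).eq_empty_or_nonempty with he | he
  · refine ⟨1, one_pos, fun z hz => ?_⟩
    have : z ∈ sphere (0 : Cn n) R := by simpa using hz
    rw [he] at this
    exact this.elim
  let g : Cn n → ℝ := fun z => Finset.univ.sup' hne fun i => ‖F i z‖ ^ 2 - δ i ^ 2
  have hg : ContinuousOn g (sphere 0 R) :=
    ContinuousOn.finset_sup'_apply hne fun i _ => (((hF i).mono
      (sphere_subset_closedBall.trans (closedBall_subset_ball hRε))).norm.pow 2).sub
      continuousOn_const
  obtain ⟨z₀, hz₀, hmin⟩ := (isCompact_sphere (0 : Cn n) R).exists_isMinOn he hg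
  have hpos : 0 < g z₀ := by
    obtain ⟨i, hi⟩ := hsep z₀ (by simpa using hz₀)
    refine (Finset.lt_sup'_iff hne).2 ⟨i, Finset.mem_univ _, ?_⟩
    have := hδ i
    nlinarith
  refine ⟨g z₀ / 2, by positivity, fun z hz => ?_⟩
  have h1 : g z₀ ≤ g z := hmin (by simpa using hz)
  have h2 : g z₀ / 2 < g z := by linarith
  obtain ⟨i, _, hi⟩ := (Finset.lt_sup'_iff hne).1 h2
  exact ⟨i, by linarith⟩

/-- The closed polyhedron containing the support of the product cutoff functions. -/
def polyhedron (F : Fin n → Cn n → ℂ) (δ : Fin n → ℝ) (R t : ℝ) : Set (Cn n) :=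
  {z | z ∈ closedBall (0 : Cn n) R ∧ ∀ l, ‖F l z‖ ^ 2 ≤ δ l ^ 2 + t}

theorem isCompact_polyhedron (hF : ∀ m, ContinuousOn (F m) (ball 0 ε)) (hRε : R < ε) :
    IsCompact (polyhedron F δ R t) := by
  refine (isCompact_closedBall (0 : Cn n) R).of_isClosed_subset ?_ fun z hz => hz.1
  have : polyhedron F δ R t = closedBall 0 R ∩
      ⋂ l, (closedBall 0 R ∩ (fun z => ‖F l z‖ ^ 2) ⁻¹' Set.Iic (δ l ^ 2 + t)) := by
    ext z
    simp only [polyhedron, Set.mem_ofPred_eq, Set.mem_inter_iff, Set.mem_iInter, Set.mem_preimage,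
      Set.mem_Iic]
    exact ⟨fun h => ⟨h.1, fun l => ⟨h.1, h.2 l⟩⟩, fun h => ⟨h.1, fun l => (h.2 l).2⟩⟩
  rw [this]
  exact isClosed_closedBall.inter (isClosed_iInter fun l =>
    ((((hF l).mono (closedBall_subset_ball hRε)).norm.pow 2)).preimage_isClosed_of_isClosed
      isClosed_closedBall isClosed_Iic)

theorem polyhedron_subset_ball (hsep : ∀ z : Cn n, ‖z‖ = R → ∃ i, δ i ^ 2 + t < ‖F i z‖ ^ 2) :
    polyhedron F δ R t ⊆ ball 0 R := by
  intro z hz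
  rw [mem_ball_zero_iff]
  refine lt_of_le_of_ne (mem_closedBall_zero_iff.1 hz.1) fun h => ?_
  obtain ⟨i, hi⟩ := hsep z h
  exact absurd (hz.2 i) (not_le.2 hi)

theorem support_productCutoff (ht : 0 < t) (S : Finset (Fin n)) :
    Function.support (productCutoff F δ R ht S) ⊆ polyhedron F δ R t := by
  intro z hz
  rw [Function.mem_support, productCutoff] at hz
  by_cases hzR : z ∈ ball (0 : Cn n) R
  · rw [if_pos hzR] at hz
    refine ⟨ball_subset_closedBall hzR, fun l => ?_⟩
    by_contra h
    rw [not_le] at h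
    refine hz (Finset.prod_eq_zero (Finset.mem_univ l) ?_)
    have hu : t ≤ |‖F l z‖ ^ 2 - δ l ^ 2| := by rw [le_abs]; left; linarith
    split_ifs <;> simp [unitBump_eq_zero ht hu, stepDown_of_ge ht h.le]
  · rw [if_neg hzR] at hz
    exact absurd rfl hz

theorem hasFDerivAt_normSq_comp {F : Cn n → ℂ} {z : Cn n} (hF : DifferentiableAt ℂ F z)
    {κ : ℝ → ℝ} {κ' : ℝ} (hκ : HasDerivAt κ κ' (‖F z‖ ^ 2)) :
    HasFDerivAt (fun z => (κ (‖F z‖ ^ 2) : ℂ)) ((κ' : ℂ) • (F z • conjDiff F z +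
      (starRingEnd ℂ) (F z) • fderiv ℝ F z)) z := by
  have hFr := (hF.restrictScalars ℝ).hasFDerivAt
  have hFc : HasFDerivAt (fun z => (starRingEnd ℂ) (F z)) (conjDiff F z) z :=
    (((Complex.conjCLE : ℂ →L[ℝ] ℂ).hasFDerivAt.comp z hFr).differentiableAt).hasFDerivAt
  have h1 := hFr.mul hFc
  have h2 := Complex.reCLM.hasFDerivAt.comp z h1
  have he : (Complex.reCLM ∘ (F * fun z => (starRingEnd ℂ) (F z))) = fun z => ‖F z‖ ^ 2 := by
    funext z
    simp [Complex.mul_conj, Complex.normSq_eq_norm_sq]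
    norm_cast
  rw [he] at h2
  have h3 := Complex.ofRealCLM.hasFDerivAt.comp z (hκ.comp_hasFDerivAt z h2)
  refine h3.congr_fderiv ?_
  ext v
  have hv : F z * conjDiff F z v + (starRingEnd ℂ) (F z) * fderiv ℝ F z v =
      ((F z * conjDiff F z v + (starRingEnd ℂ) (F z) * fderiv ℝ F z v).re : ℂ) := by
    rw [conjDiff_apply hF, hF.fderiv_restrictScalars ℝ]
    simp only [ContinuousLinearMap.coe_restrictScalars']
    apply Complex.ext
    · simp
    · simp; ring
  simp only [ContinuousLinearMap.comp_apply, smul_apply, add_apply, smul_eq_mul,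
    Complex.ofRealCLM_apply, Complex.reCLM_apply]
  rw [Complex.ofReal_mul, ← hv]

/-- By the margin the support is a compact subset of the open ball of radius R, so the truncation
there stays smooth. Differentiating a factor m ∉ S turns its step into minus its bump, which gives
C_{S ∪ {m}}; the factors with m ∈ S give coefficients that are not prescribed. Near 0 all |F_l|² are
below δ_l² - t, where steps are one and bumps are zero. -/
theorem isCutoffFamily_productCutoff (hF : ∀ m, DifferentiableOn ℂ (F m) (ball 0 ε)) (hR : 0 < R)
    (hRε : R < ε) (ht : 0 < t) (hF0 : ∀ m, F m 0 = 0) (htδ : ∀ i, t < δ i ^ 2)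
    (hsep : ∀ z : Cn n, ‖z‖ = R → ∃ i, δ i ^ 2 + t < ‖F i z‖ ^ 2) :
    IsCutoffFamily ε F (productCutoff F δ R ht) := by
  have hFc : ∀ m, ContinuousOn (F m) (ball 0 ε) := fun m => (hF m).continuousOn
  have hsub := polyhedron_subset_ball hsep
  have hts : ∀ S, tsupport (productCutoff F δ R ht S) ⊆ polyhedron F δ R t := fun S =>
    closure_minimal (support_productCutoff ht S) (isCompact_polyhedron hFc hRε).isClosed
  have hdiff : ∀ m, ∀ z ∈ ball (0 : Cn n) R, DifferentiableAt ℂ (F m) z := fun m z hz =>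
    (hF m).differentiableAt (isOpen_ball.mem_nhds (ball_subset_ball hRε.le hz))
  have hder : ∀ (S : Finset (Fin n)) l u, HasDerivAt
      (fun u => if l ∈ S then -unitBump (δ l ^ 2) t ht u else stepDown (δ l ^ 2) t ht u)
      (if l ∈ S then -deriv (unitBump (δ l ^ 2) t ht) u else -unitBump (δ l ^ 2) t ht u) u := by
    intro S l u
    split_ifs
    · exact ((contDiff_unitBump ht).differentiable (by simp) u).hasDerivAt.neg
    · exact hasDerivAt_stepDown ht u
  have hκ : ∀ (S : Finset (Fin n)) l, ContDiff ℝ ∞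
      (fun u => if l ∈ S then -unitBump (δ l ^ 2) t ht u else stepDown (δ l ^ 2) t ht u) := by
    intro S l
    split_ifs
    · exact (contDiff_unitBump ht).neg
    · exact contDiff_stepDown ht
  have hev : ∀ S, ∀ z ∈ ball (0 : Cn n) R, productCutoff F δ R ht S =ᶠ[nhds z] fun z =>
      ∏ l, ((if l ∈ S then -unitBump (δ l ^ 2) t ht (‖F l z‖ ^ 2)
        else stepDown (δ l ^ 2) t ht (‖F l z‖ ^ 2) : ℝ) : ℂ) := by
    intro S z hz
    filter_upwards [isOpen_ball.mem_nhds hz] with w hw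
    rw [productCutoff, if_pos hw]
  have hsmR : ∀ S, ContDiffOn ℝ ∞ (productCutoff F δ R ht S) (ball 0 R) := by
    intro S z hz
    refine ContDiffAt.contDiffWithinAt (ContDiffAt.congr_of_eventuallyEq ?_ (hev S z hz))
    refine contDiffAt_prod fun l _ => ?_
    have hFl : ContDiffAt ℝ ∞ (F l) z := ((contDiffOn_of_holomorphic isOpen_ball
      (hF l)).restrict_scalars ℝ).contDiffAt (isOpen_ball.mem_nhds (ball_subset_ball hRε.le hz))
    exact Complex.ofRealCLM.contDiff.contDiffAt.comp z
      ((hκ S l).contDiffAt.comp z (hFl.norm_sq ℂ))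
  refine ⟨fun S => contDiff_of_tsupport_subset isOpen_ball (hsmR S) ((hts S).trans hsub),
    fun S => (isCompact_polyhedron hFc hRε).of_isClosed_subset (isClosed_tsupport _) (hts S),
    fun S => (hts S).trans (hsub.trans (ball_subset_ball hRε.le)), ?_, ?_, ?_⟩
  · rintro S ⟨l, hl⟩
    rw [notMem_tsupport_iff_eventuallyEq]
    have hcont : ContinuousAt (fun z => ‖F l z‖ ^ 2) 0 :=
      ((hdiff l 0 (mem_ball_self hR)).continuousAt.norm.pow 2)
    have h1 : ∀ᶠ z in nhds (0 : Cn n), ‖F l z‖ ^ 2 < δ l ^ 2 - t :=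
      hcont.eventually_lt_const (by simpa [hF0] using htδ l)
    filter_upwards [h1, isOpen_ball.mem_nhds (mem_ball_self hR)] with z hz hzR
    rw [productCutoff, if_pos hzR]
    refine Finset.prod_eq_zero (Finset.mem_univ l) ?_
    have hu : t ≤ |‖F l z‖ ^ 2 - δ l ^ 2| := by rw [le_abs]; right; linarith
    rw [if_pos hl, unitBump_eq_zero ht hu]
    simp
  · have h1 : ∀ᶠ z in nhds (0 : Cn n), ∀ l, ‖F l z‖ ^ 2 < δ l ^ 2 - t := by
      rw [Filter.eventually_all]
      intro l
      have hcont : ContinuousAt (fun z => ‖F l z‖ ^ 2) 0 :=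
        ((hdiff l 0 (mem_ball_self hR)).continuousAt.norm.pow 2)
      exact hcont.eventually_lt_const (by simpa [hF0] using htδ l)
    filter_upwards [h1, isOpen_ball.mem_nhds (mem_ball_self hR)] with z hz hzR
    rw [productCutoff, if_pos hzR]
    refine Finset.prod_eq_one fun l _ => ?_
    rw [if_neg (Finset.notMem_empty l), stepDown_of_le ht (hz l).le]
    simp
  · intro S z _
    by_cases hzR : z ∈ ball (0 : Cn n) R
    · have hprod := HasFDerivAt.finsetProd (u := Finset.univ) fun l _ =>
        hasFDerivAt_normSq_comp (hdiff l z hzR) (hder S l (‖F l z‖ ^ 2))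
      refine ⟨fun m => (∏ l ∈ Finset.univ.erase m, ((if l ∈ S then
        -unitBump (δ l ^ 2) t ht (‖F l z‖ ^ 2) else stepDown (δ l ^ 2) t ht (‖F l z‖ ^ 2) : ℝ) : ℂ)) *
        ((if m ∈ S then -deriv (unitBump (δ m ^ 2) t ht) (‖F m z‖ ^ 2)
          else -unitBump (δ m ^ 2) t ht (‖F m z‖ ^ 2) : ℝ) : ℂ), fun m hm => ?_, ?_⟩
      · rw [productCutoff, if_pos hzR, ← Finset.prod_erase_mul _ _ (Finset.mem_univ m)]
        beta_reduce
        rw [if_neg hm, if_pos (Finset.mem_insert_self m S)]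
        congr 1
        refine Finset.prod_congr rfl fun l hl => ?_
        have : l ∈ insert m S ↔ l ∈ S := by simp [Finset.ne_of_mem_erase hl]
        simp only [this]
      · rw [(hev S z hzR).fderiv_eq]
        refine hprod.fderiv.trans (Finset.sum_congr rfl fun m _ => ?_)
        rw [smul_smul]
    · have hz : ∀ S, z ∉ tsupport (productCutoff F δ R ht S) := fun S h => hzR (hsub (hts S h))
      refine ⟨fun _ => 0, fun m _ => (image_eq_zero_of_notMem_tsupport (hz _)).symm, ?_⟩
      rw [image_eq_zero_of_notMem_tsupport fun h => hz S (tsupport_fderiv_subset ℝ h)]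
      ext v
      simp

end CutoffFamily

/-! ### Real coordinates and charts adapted to the torus -/

section RealCoordinates

variable {n : ℕ}

/-- The vector of real parts of the coordinates. -/
def reVec : Cn n →L[ℝ] (Fin n → ℝ) :=
  ContinuousLinearMap.pi fun i =>
    Complex.reCLM.comp ((EuclideanSpace.proj i : Cn n →L[ℂ] ℂ).restrictScalars ℝ)

/-- The vector of imaginary parts of the coordinates. -/
def imVec : Cn n →L[ℝ] (Fin n → ℝ) :=
  ContinuousLinearMap.pi fun i =>
    Complex.imCLM.comp ((EuclideanSpace.proj i : Cn n →L[ℂ] ℂ).restrictScalars ℝ)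

@[simp] theorem reVec_apply (w : Cn n) (i : Fin n) : reVec w i = (w i).re := rfl

@[simp] theorem imVec_apply (w : Cn n) (i : Fin n) : imVec w i = (w i).im := rfl

/-- Real and imaginary parts as coordinates. -/
def realCoordEquiv (n : ℕ) : ((Fin n → ℝ) × (Fin n → ℝ)) ≃L[ℝ] Cn n :=
  LinearEquiv.toContinuousLinearEquiv
    { toFun := fun p => WithLp.toLp 2 fun i => (⟨p.1 i, p.2 i⟩ : ℂ)
      map_add' := fun _ _ => by ext i; apply Complex.ext <;> simp
      map_smul' := fun _ _ => by ext i; apply Complex.ext <;> simp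
      invFun := fun w => (reVec w, imVec w)
      left_inv := fun _ => rfl
      right_inv := fun _ => rfl }

theorem realCoordEquiv_apply (p : (Fin n → ℝ) × (Fin n → ℝ)) (i : Fin n) :
    realCoordEquiv n p i = ⟨p.1 i, p.2 i⟩ := rfl

@[simp] theorem reVec_realCoordEquiv (p : (Fin n → ℝ) × (Fin n → ℝ)) :
    reVec (realCoordEquiv n p) = p.1 := rfl

@[simp] theorem imVec_realCoordEquiv (p : (Fin n → ℝ) × (Fin n → ℝ)) :
    imVec (realCoordEquiv n p) = p.2 := rfl

@[simp] theorem realCoordEquiv_reVec_imVec (w : Cn n) : realCoordEquiv n (reVec w, imVec w) = w := rfl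

theorem measurePreserving_realCoordEquiv (n : ℕ) :
    MeasurePreserving (realCoordEquiv n) (volume.prod volume) (lebesgue n) := by
  have h1 := (volume_measurePreserving_arrowProdEquivProdArrow ℝ ℝ (Fin n)).symm
  have h2 : MeasurePreserving (fun (a : Fin n → ℝ × ℝ) i =>
      Complex.measurableEquivRealProd.symm (a i)) :=
    volume_preserving_pi fun _ => Complex.volume_preserving_equiv_real_prod.symm
  have h3 : MeasurePreserving (WithLp.toLp 2 : (Fin n → ℂ) → Cn n) volume (lebesgue n) :=
    ⟨by fun_prop, rfl⟩
  exact h3.comp (h2.comp h1)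

theorem measurableEmbedding_realCoordEquiv (n : ℕ) : MeasurableEmbedding (realCoordEquiv n) :=
  (realCoordEquiv n).toHomeomorph.measurableEmbedding

/-- The embedding of `ℝⁿ` into `ℂⁿ`. -/
def ofRealVec : (Fin n → ℝ) →L[ℝ] Cn n :=
  (realCoordEquiv n : _ →L[ℝ] Cn n).comp (ContinuousLinearMap.inl ℝ (Fin n → ℝ) (Fin n → ℝ))

theorem ofRealVec_eq (x : Fin n → ℝ) : ofRealVec x = realCoordEquiv n (x, 0) := rfl

@[simp] theorem reVec_ofRealVec (x : Fin n → ℝ) : reVec (ofRealVec x) = x := rfl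

@[simp] theorem imVec_ofRealVec (x : Fin n → ℝ) : imVec (ofRealVec x) = 0 := rfl

theorem ofRealVec_reVec {w : Cn n} (h : imVec w = 0) : ofRealVec (reVec w) = w := by
  rw [ofRealVec_eq, ← h, realCoordEquiv_reVec_imVec]

/-- The determinant of a real endomorphism of `ℂⁿ` in terms of its composition with complex linear
functionals whose real parts only depend on the imaginary parts of the coordinates. -/
theorem normSq_det_mul_abs_det (E : Cn n →L[ℝ] Cn n) (σ : Fin n → Cn n →L[ℂ] ℂ) (d : Fin n → ℝ)
    (h : ∀ i w, (σ i (E w)).re = d i * (w i).im) :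
    Complex.normSq (Matrix.det (Matrix.of fun i l => σ i (EuclideanSpace.single l 1))) * |E.det| =
      |∏ i, d i| * |Matrix.det (Matrix.of fun i a : Fin n =>
        (σ i (E (ofRealVec (Pi.single a 1)))).im)| := by
  let S : Cn n →ₗ[ℂ] Cn n :=
    { toFun := fun v => WithLp.toLp 2 fun i => σ i v
      map_add' := fun _ _ => by ext i; simp
      map_smul' := fun _ _ => by ext i; simp }
  have hS : LinearMap.det S =
      Matrix.det (Matrix.of fun i l => σ i (EuclideanSpace.single l 1)) := by
    rw [← LinearMap.det_toMatrix (EuclideanSpace.basisFun (Fin n) ℂ).toBasis S]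
    congr 1
  let c : Cn n ≃ₗ[ℝ] (Fin n ⊕ Fin n → ℝ) :=
    (realCoordEquiv n).symm.toLinearEquiv.trans
      (LinearEquiv.sumArrowLequivProdArrow (Fin n) (Fin n) ℝ ℝ).symm
  let B := Module.Basis.ofEquivFun c
  -- As a real map, S ∘ E has determinant |det S|² det E. In real and imaginary parts its matrix is
  -- block triangular up to a swap, since by h the real parts of σ_i ∘ E vanish in the real
  -- directions.
  let Q : Cn n →ₗ[ℝ] Cn n := S.restrictScalars ℝ ∘ₗ E.toLinearMap
  have hQ : LinearMap.det Q = Complex.normSq (LinearMap.det S) * E.det := by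
    rw [LinearMap.det_comp, LinearMap.det_restrictScalars, Algebra.norm_complex_apply]
  have hcl : ∀ w i, c w (Sum.inl i) = (w i).re := fun _ _ => rfl
  have hcr : ∀ w i, c w (Sum.inr i) = (w i).im := fun _ _ => rfl
  have hBl : ∀ a, B (Sum.inl a) = ofRealVec (Pi.single a 1) := by
    intro a
    rw [Module.Basis.coe_ofEquivFun, LinearEquiv.symm_apply_eq]
    ext i
    rcases i with i | i
    · rw [hcl]
      change _ = (Pi.single a (1 : ℝ) : Fin n → ℝ) i
      by_cases hi : i = a
      · subst hi; simp
      · simp [hi]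
    · rw [hcr]
      simp [ofRealVec_eq, realCoordEquiv_apply]
  have hBr : ∀ a, B (Sum.inr a) = realCoordEquiv n (0, Pi.single a 1) := by
    intro a
    rw [Module.Basis.coe_ofEquivFun, LinearEquiv.symm_apply_eq]
    ext i
    rcases i with i | i
    · rw [hcl]
      simp [realCoordEquiv_apply]
    · rw [hcr]
      change _ = (Pi.single a (1 : ℝ) : Fin n → ℝ) i
      by_cases hi : i = a
      · subst hi; simp
      · simp [hi]
  let Pm : Matrix (Fin n) (Fin n) ℝ :=
    Matrix.of fun i a => (σ i (E (ofRealVec (Pi.single a 1)))).im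
  let Bm : Matrix (Fin n) (Fin n) ℝ :=
    Matrix.of fun i a => (σ i (E (realCoordEquiv n (0, Pi.single a 1)))).im
  have hM : LinearMap.toMatrix B B Q =
      (Matrix.fromBlocks Pm Bm 0 (Matrix.diagonal d)).submatrix (Equiv.sumComm (Fin n) (Fin n)) id := by
    ext i a
    rw [LinearMap.toMatrix_apply, Module.Basis.ofEquivFun_repr_apply]
    rcases i with i | i <;> rcases a with a | a
    · rw [hcl, hBl]
      have := h i (ofRealVec (Pi.single a 1))
      simp only [Matrix.submatrix_apply, id_eq, Equiv.sumComm_apply, Sum.swap_inl,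
        Matrix.fromBlocks_apply₂₁, Matrix.zero_apply]
      refine Eq.trans this ?_
      simp [ofRealVec_eq, realCoordEquiv_apply]
    · rw [hcl, hBr]
      have := h i (realCoordEquiv n (0, Pi.single a 1))
      simp only [Matrix.submatrix_apply, id_eq, Equiv.sumComm_apply, Sum.swap_inl,
        Matrix.fromBlocks_apply₂₂]
      refine Eq.trans this ?_
      simp only [realCoordEquiv_apply, Matrix.diagonal_apply]
      by_cases hi : i = a
      · subst hi; simp
      · simp [hi]
    · rw [hcr, hBl]; rfl
    · rw [hcr, hBr]; rfl
  have hdet : |LinearMap.det Q| = |∏ i, d i| * |Matrix.det Pm| := by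
    rw [← LinearMap.det_toMatrix B, hM, Matrix.det_permute, Matrix.det_fromBlocks_zero₂₁,
      Matrix.det_diagonal, abs_mul, abs_mul]
    have : |((Equiv.Perm.sign (Equiv.sumComm (Fin n) (Fin n)) : ℤ) : ℝ)| = 1 := by
      rcases Int.units_eq_one_or (Equiv.Perm.sign (Equiv.sumComm (Fin n) (Fin n))) with h | h <;>
        simp [h]
    rw [this, one_mul, mul_comm]
  rw [← hS, ← hdet, hQ, abs_mul, abs_of_nonneg (Complex.normSq_nonneg _)]

end RealCoordinates

section Chart

variable {n : ℕ}

/-- Coordinates `x + i t` of `ℂⁿ` near a point of a submanifold parametrized by `q`, in which the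
submanifold is `t = 0` with parameter `x`, and `t` is the value of the defining functions `L`. -/
theorem exists_adapted_chart {V : Set (Cn n)} (hV : IsOpen V) {L : Cn n → Fin n → ℝ}
    (hL : ContDiffOn ℝ ∞ L V) {D : Set (Fin n → ℝ)} (hD : IsOpen D) {q : (Fin n → ℝ) → Cn n}
    (hq : ContDiffOn ℝ ∞ q D) (hqV : ∀ x ∈ D, q x ∈ V) (hLq : ∀ x ∈ D, L (q x) = 0)
    {x₀ : Fin n → ℝ} (hx₀ : x₀ ∈ D) (himm : Function.Injective (fderiv ℝ q x₀))
    (hsurj : Function.Surjective (fderiv ℝ L (q x₀))) :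
    ∃ e : OpenPartialHomeomorph (Cn n) (Cn n), ofRealVec x₀ ∈ e.source ∧
      (∀ w ∈ e.source, ContDiffAt ℝ 1 e w ∧ (fderiv ℝ e w).det ≠ 0 ∧ e w ∈ V ∧
        L (e w) = imVec w) ∧
      ∀ x, ofRealVec x ∈ e.source → x ∈ D ∧ e (ofRealVec x) = q x := by
  obtain ⟨M, hM⟩ : ∃ M : (Fin n → ℝ) →L[ℝ] Cn n, ∀ y, fderiv ℝ L (q x₀) (M y) = y := by
    obtain ⟨M, hM⟩ := (fderiv ℝ L (q x₀)).toLinearMap.exists_rightInverse_of_surjective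
      (LinearMap.range_eq_top.2 hsurj)
    exact ⟨LinearMap.toContinuousLinearMap M, fun y => LinearMap.congr_fun hM y⟩
  set w₀ : Cn n := ofRealVec x₀ with hw₀
  -- The right inverse M of dL supplies directions transverse to the submanifold, so Θ is a local
  -- diffeomorphism; but L ∘ Θ equals the imaginary part only to first order at w₀.
  let Θ : Cn n → Cn n := fun w => q (reVec w) + M (imVec w)
  have hΘ0 : Θ w₀ = q x₀ := by simp [Θ, hw₀]
  have hqa : ∀ x ∈ D, ContDiffAt ℝ ∞ q x := fun x hx => hq.contDiffAt (hD.mem_nhds hx)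
  have hLa : ContDiffAt ℝ ∞ L (q x₀) := hL.contDiffAt (hV.mem_nhds (hqV x₀ hx₀))
  have hΘc : ContDiffAt ℝ ∞ Θ w₀ :=
    ((hqa x₀ hx₀).comp w₀ reVec.contDiff.contDiffAt).add (M.comp imVec).contDiff.contDiffAt
  let T : Cn n →L[ℝ] Cn n := (fderiv ℝ q x₀).comp reVec + M.comp imVec
  have hTd : HasFDerivAt Θ T w₀ := by
    have h1 : HasFDerivAt q (fderiv ℝ q x₀) (reVec w₀) :=
      ((hqa x₀ hx₀).differentiableAt (by simp)).hasFDerivAt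
    have h2 : HasFDerivAt (fun w : Cn n => reVec w) (reVec (n := n)) w₀ :=
      (reVec (n := n)).hasFDerivAt
    have h3 : HasFDerivAt (fun w : Cn n => M (imVec w)) (M.comp (imVec (n := n))) w₀ :=
      (M.comp (imVec (n := n))).hasFDerivAt
    have h4 : HasFDerivAt (fun w : Cn n => q (reVec w)) ((fderiv ℝ q x₀).comp reVec) w₀ :=
      h1.comp w₀ h2
    exact h4.add h3
  have hLq0 : ∀ v, fderiv ℝ L (q x₀) (fderiv ℝ q x₀ v) = 0 := by
    intro v
    have h1 := (hLa.differentiableAt (by simp)).hasFDerivAt.comp x₀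
      ((hqa x₀ hx₀).differentiableAt (by simp)).hasFDerivAt
    have h2 : L ∘ q =ᶠ[nhds x₀] fun _ => 0 := by
      filter_upwards [hD.mem_nhds hx₀] with x hx using hLq x hx
    have h3 := (hasFDerivAt_const (𝕜 := ℝ) (0 : Fin n → ℝ) x₀).congr_of_eventuallyEq h2
    have := congrArg (fun A => A v) (h1.unique h3)
    simpa using this
  have hLT : ∀ w, fderiv ℝ L (q x₀) (T w) = imVec w := by
    intro w
    change fderiv ℝ L (q x₀) (fderiv ℝ q x₀ (reVec w) + M (imVec w)) = _
    rw [map_add, hLq0, hM, zero_add]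
  have hTinj : Function.Injective T := by
    rw [injective_iff_map_eq_zero]
    intro w hw
    have h1 : imVec w = 0 := by rw [← hLT, hw, map_zero]
    have h2 : fderiv ℝ q x₀ (reVec w) = 0 := by
      have : fderiv ℝ q x₀ (reVec w) + M (imVec w) = 0 := hw
      rwa [h1, map_zero, add_zero] at this
    have h3 : reVec w = 0 := himm (by rw [h2, map_zero])
    rw [← realCoordEquiv_reVec_imVec w, h1, h3]
    exact map_zero _
  let Te : Cn n ≃L[ℝ] Cn n :=
    (LinearEquiv.ofInjectiveEndo T.toLinearMap hTinj).toContinuousLinearEquiv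
  have hTe : (Te : Cn n →L[ℝ] Cn n) = T := by ext1 w; rfl
  have hTd' : HasFDerivAt Θ (Te : Cn n →L[ℝ] Cn n) w₀ := hTe ▸ hTd
  -- Λ records the exact value of L, fixes the real points and has derivative the identity at w₀.
  -- The chart Θ ∘ Λ⁻¹ therefore satisfies L(e(w)) = Im w exactly.
  let Λ : Cn n → Cn n := fun w => realCoordEquiv n (reVec w, L (Θ w))
  have hΛc : ContDiffAt ℝ ∞ Λ w₀ := by
    have hLa' : ContDiffAt ℝ ∞ L (Θ w₀) := hΘ0 ▸ hLa
    exact (realCoordEquiv n).contDiff.contDiffAt.comp w₀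
      (reVec.contDiff.contDiffAt.prodMk (hLa'.comp w₀ hΘc))
  have hΛd : HasFDerivAt Λ ((ContinuousLinearEquiv.refl ℝ (Cn n) : Cn n ≃L[ℝ] Cn n) :
      Cn n →L[ℝ] Cn n) w₀ := by
    have hLd : HasFDerivAt L (fderiv ℝ L (q x₀)) (Θ w₀) :=
      hΘ0 ▸ (hLa.differentiableAt (by simp)).hasFDerivAt
    have h := (realCoordEquiv n).hasFDerivAt.comp w₀ (reVec.hasFDerivAt.prodMk (hLd.comp w₀ hTd))
    refine h.congr_fderiv ?_
    ext1 w
    change realCoordEquiv n (reVec w, fderiv ℝ L (q x₀) (T w)) = w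
    rw [hLT, realCoordEquiv_reVec_imVec]
  have hΛ0 : Λ w₀ = w₀ := by
    change realCoordEquiv n (reVec w₀, L (Θ w₀)) = w₀
    rw [hΘ0, hLq x₀ hx₀]
    rfl
  have hone : (1 : WithTop ℕ∞) ≠ 0 := one_ne_zero
  have hΘ1 : ContDiffAt ℝ 1 Θ w₀ := hΘc.of_le (by simp)
  have hΛ1 : ContDiffAt ℝ 1 Λ w₀ := hΛc.of_le (by simp)
  let Θh := hΘ1.toOpenPartialHomeomorph Θ hTd' hone
  let Λh := hΛ1.toOpenPartialHomeomorph Λ hΛd hone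
  have hΘs : w₀ ∈ Θh.source := hΘ1.mem_toOpenPartialHomeomorph_source hTd' hone
  have hΛs : w₀ ∈ Λh.source := hΛ1.mem_toOpenPartialHomeomorph_source hΛd hone
  have hΛcoe : ∀ w, Λh w = Λ w := fun w => rfl
  have hΘcoe : ∀ w, Θh w = Θ w := fun w => rfl
  have hΛt : w₀ ∈ Λh.target := by
    have := Λh.map_source hΛs
    rwa [hΛcoe, hΛ0] at this
  have hsymm0 : Λh.symm w₀ = w₀ := by
    have := Λh.left_inv hΛs
    rwa [hΛcoe, hΛ0] at this
  let e₁ := Λh.symm.trans Θh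
  have he₁ : ∀ w, e₁ w = Θ (Λh.symm w) := fun w => rfl
  have hs1 : w₀ ∈ e₁.source := by
    rw [OpenPartialHomeomorph.trans_source]
    refine ⟨hΛt, ?_⟩
    change Λh.symm w₀ ∈ Θh.source
    rwa [hsymm0]
  have hsymmc : ContDiffAt ℝ 1 Λh.symm w₀ :=
    Λh.contDiffAt_symm hΛt (hsymm0.symm ▸ hΛd) (hsymm0.symm ▸ hΛ1)
  have hsymmd : HasFDerivAt Λh.symm ((ContinuousLinearEquiv.refl ℝ (Cn n) : Cn n ≃L[ℝ] Cn n).symm :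
      Cn n →L[ℝ] Cn n) w₀ :=
    Λh.hasFDerivAt_symm hΛt (hsymm0.symm ▸ hΛd)
  have hec : ContDiffAt ℝ 1 e₁ w₀ := by
    have : ContDiffAt ℝ 1 Θ (Λh.symm w₀) := hsymm0.symm ▸ hΘ1
    exact this.comp w₀ hsymmc
  have hed : HasFDerivAt e₁ T w₀ := by
    have h : HasFDerivAt Θ T (Λh.symm w₀) := hsymm0.symm ▸ hTd
    exact (h.comp w₀ hsymmd).congr_fderiv (by ext1 w; rfl)
  have hdet0 : (fderiv ℝ e₁ w₀).det ≠ 0 := by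
    rw [hed.fderiv, ← hTe]
    exact (LinearEquiv.isUnit_det' Te.toLinearEquiv).ne_zero
  have hcd : ∀ᶠ w in nhds w₀, ContDiffAt ℝ 1 e₁ w := hec.eventually (by simp)
  have hdet : ∀ᶠ w in nhds w₀, (fderiv ℝ e₁ w).det ≠ 0 := by
    have hcont : ContinuousAt (fun w => (fderiv ℝ e₁ w).det) w₀ :=
      ContinuousLinearMap.continuous_det.continuousAt.comp
        (hec.fderiv_right (m := 0) (by simp)).continuousAt
    exact hcont.eventually_ne hdet0
  have hVev : ∀ᶠ w in nhds w₀, e₁ w ∈ V := by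
    refine hec.continuousAt.eventually_mem (hV.mem_nhds ?_)
    rw [he₁, hsymm0, hΘ0]
    exact hqV x₀ hx₀
  have hDev : ∀ᶠ w in nhds w₀, reVec w ∈ D :=
    reVec.continuous.continuousAt.eventually_mem (hD.mem_nhds hx₀)
  have hsrc : ∀ᶠ w in nhds w₀, w ∈ Λh.source := Λh.open_source.mem_nhds hΛs
  obtain ⟨O, hO, hOopen, hOw⟩ := _root_.eventually_nhds_iff.1
    (hcd.and (hdet.and (hVev.and (hDev.and hsrc))))
  refine ⟨e₁.restrOpen O hOopen, ?_, ?_, ?_⟩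
  · rw [OpenPartialHomeomorph.restrOpen_source]
    exact ⟨hs1, hOw⟩
  · intro w hw
    rw [OpenPartialHomeomorph.restrOpen_source] at hw
    obtain ⟨h1, h2, h3, -, -⟩ := hO w hw.2
    refine ⟨h1, h2, h3, ?_⟩
    have hwt : w ∈ Λh.target := by
      have := hw.1
      rw [OpenPartialHomeomorph.trans_source] at this
      exact this.1
    have := congrArg imVec (Λh.right_inv hwt)
    exact this
  · intro x hx
    rw [OpenPartialHomeomorph.restrOpen_source] at hx
    obtain ⟨-, -, -, h4, h5⟩ := hO _ hx.2
    refine ⟨h4, ?_⟩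
    have hxD : x ∈ D := h4
    have hΘx : Θ (ofRealVec x) = q x := by simp [Θ]
    have hΛx : Λh (ofRealVec x) = ofRealVec x := by
      rw [hΛcoe]
      change realCoordEquiv n (reVec (ofRealVec x), L (Θ (ofRealVec x))) = _
      rw [hΘx, hLq x hxD]
      rfl
    have h6 : Λh.symm (ofRealVec x) = ofRealVec x := by
      have := Λh.left_inv h5
      rwa [hΛx] at this
    change Θ (Λh.symm (ofRealVec x)) = q x
    rw [h6, hΘx]

/-- Comparison of the Jacobian of adapted coordinates with the holomorphic volume form. -/
theorem conj_det_mul_abs_det (E : Cn n →L[ℝ] Cn n) (hE : E.det ≠ 0) (η : Fin n → Cn n →L[ℂ] ℂ)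
    (c : Fin n → ℂ) (hc : ∀ i, c i ≠ 0)
    (h : ∀ i w, (η i (E w) / c i).re = 1 / (2 * ‖c i‖ ^ 2) * (w i).im)
    (hpos : 0 ≤ Matrix.det (Matrix.of fun i a : Fin n =>
      (η i (E (ofRealVec (Pi.single a 1))) / c i).im)) :
    (2 * Complex.I) ^ n * ((starRingEnd ℂ) (Matrix.det (Matrix.of fun i l =>
      η i (EuclideanSpace.single l 1))) * |E.det|) =
      (1 / ∏ i, c i) * topForm n fun a => E (ofRealVec (Pi.single a 1)) := by
  set τ : Fin n → Cn n := fun a => E (ofRealVec (Pi.single a 1)) with hτ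
  set J := Matrix.det (Matrix.of fun i l => η i (EuclideanSpace.single l 1)) with hJ
  set p := Matrix.det (Matrix.of fun i a : Fin n => (η i (τ a) / c i).im) with hp
  -- For η_i = dF_i and c_i = F_i this is d log F_i, purely imaginary on the tangent vectors τ_a.
  -- Hence det(σ) det(τ) = iⁿ p with p ≥ 0 by the orientation, while the real determinant gives |det
  -- σ|² |det E| = p / (2ⁿ ∏ |c_i|²). Eliminating p proves the claim if J ≠ 0.
  let σ : Fin n → Cn n →L[ℂ] ℂ := fun i => (c i)⁻¹ • η i
  have hσ : ∀ i v, σ i v = η i v / c i := fun i v => by simp [σ, div_eq_inv_mul]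
  let T : Matrix (Fin n) (Fin n) ℂ := Matrix.of fun l a => τ a l
  have hT : topForm n τ = T.det := by
    have h : topForm n τ = (EuclideanSpace.basisFun (Fin n) ℂ).toBasis.det τ := rfl
    rw [h, Module.Basis.det_apply]
    rfl
  have hexp : ∀ (σ : Cn n →L[ℂ] ℂ) a, σ (τ a) = ∑ l, σ (EuclideanSpace.single l 1) * T l a := by
    intro σ a
    rw [clm_eq_sum]
    exact Finset.sum_congr rfl fun l _ => mul_comm _ _
  have hc' : ∏ i, c i ≠ 0 := Finset.prod_ne_zero_iff.2 fun i _ => hc i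
  have hΛ : Matrix.det (Matrix.of fun i l => σ i (EuclideanSpace.single l 1)) =
      (∏ i, c i)⁻¹ * J := by
    rw [← Finset.prod_inv_distrib, hJ, ← Matrix.det_mul_column]
    rfl
  have hre : ∀ i a, (σ i (τ a)).re = 0 := by
    intro i a
    rw [hσ, h]
    simp [ofRealVec_eq, realCoordEquiv_apply]
  have hmul : (∏ i, c i)⁻¹ * J * T.det = Complex.I ^ n * (p : ℂ) := by
    rw [← hΛ, ← Matrix.det_mul]
    have h1 : (Matrix.of fun i l => σ i (EuclideanSpace.single l 1)) * T =
        Complex.I • (Matrix.of fun i a : Fin n => (η i (τ a) / c i).im).map Complex.ofRealHom := by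
      ext i a
      rw [Matrix.mul_apply]
      refine (hexp (σ i) a).symm.trans ?_
      rw [← Complex.re_add_im (σ i (τ a)), hre, hσ]
      simp [mul_comm]
    rw [h1, Matrix.det_smul, Fintype.card_fin, hp]
    congr 1
    exact (RingHom.map_det Complex.ofRealHom _).symm
  have habs := normSq_det_mul_abs_det E σ (fun i => 1 / (2 * ‖c i‖ ^ 2))
    (fun i w => by rw [hσ]; exact h i w)
  have hp' : |Matrix.det (Matrix.of fun i a : Fin n =>
      (σ i (E (ofRealVec (Pi.single a 1)))).im)| = p := by
    rw [← abs_of_nonneg hpos]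
    simp only [hσ]
    rfl
  have hd : |∏ i, 1 / (2 * ‖c i‖ ^ 2)| = 1 / (2 ^ n * ∏ i, ‖c i‖ ^ 2) := by
    rw [abs_of_nonneg (Finset.prod_nonneg fun i _ => by positivity), Finset.prod_div_distrib,
      Finset.prod_const_one, Finset.prod_mul_distrib, Finset.prod_const, Finset.card_univ,
      Fintype.card_fin]
  rw [hp', hd, hΛ] at habs
  have habsC : ((∏ i, c i)⁻¹ * J * ((starRingEnd ℂ) ((∏ i, c i)⁻¹ * J))) * (|E.det| : ℝ) =
      1 / (2 ^ n * ((∏ i, c i) * (starRingEnd ℂ) (∏ i, c i))) * (p : ℂ) := by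
    rw [Complex.mul_conj, map_prod, ← Finset.prod_mul_distrib]
    simp only [Complex.mul_conj, Complex.normSq_eq_norm_sq (c _)]
    exact_mod_cast habs
  rw [hT]
  have hcc : (starRingEnd ℂ) (∏ i, c i) ≠ 0 := (map_ne_zero _).2 hc'
  -- If J = 0, a nonzero V is killed by all η_i, and so is iV. Both lie in the real span of the τ_a,
  -- the common kernel of the real parts of the σ_i, so the τ_a are complex dependent and both sides
  -- vanish.
  by_cases hJ0 : J = 0
  · have hT0 : T.det = 0 := by
      obtain ⟨v, hv0, hv⟩ := Matrix.exists_mulVec_eq_zero_iff.2 (hJ.symm.trans hJ0)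
      let V : Cn n := WithLp.toLp 2 v
      have hσV : ∀ i, η i V = 0 := by
        intro i
        rw [clm_eq_sum]
        refine Eq.trans ?_ (congrFun hv i)
        exact Finset.sum_congr rfl fun l _ => mul_comm _ _
      have hsurj : ∀ V : Cn n, (∀ i, η i V = 0) → ∃ x : Fin n → ℝ, V = ∑ a, (x a : ℂ) • τ a := by
        intro V hV
        let Ee := E.toContinuousLinearEquivOfDetNeZero hE
        have hEe : E (Ee.symm V) = V := Ee.apply_symm_apply V
        have him : imVec (Ee.symm V) = 0 := by
          funext i
          have h1 := h i (Ee.symm V)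
          rw [hEe, hV i, zero_div, Complex.zero_re, eq_comm, mul_eq_zero] at h1
          refine h1.resolve_left ?_
          have := norm_pos_iff.2 (hc i)
          positivity
        refine ⟨reVec (Ee.symm V), ?_⟩
        conv_lhs => rw [← hEe, ← ofRealVec_reVec him]
        conv_lhs => rw [← Finset.univ_sum_single (reVec (Ee.symm V)), map_sum, map_sum]
        refine Finset.sum_congr rfl fun a _ => ?_
        rw [hτ, ← mul_one (reVec (Ee.symm V) a), ← smul_eq_mul, Pi.single_smul, map_smul, map_smul,
          smul_eq_mul, mul_one]
        exact (Complex.coe_smul _ _).symm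
      obtain ⟨x, hx⟩ := hsurj V hσV
      obtain ⟨y, hy⟩ := hsurj (Complex.I • V) fun i => by rw [map_smul, hσV i, smul_zero]
      -- From V = ∑ x_a τ_a and iV = ∑ y_a τ_a with x, y real; if ix - y were zero, then x = 0 and V
      -- = 0.
      refine Matrix.exists_mulVec_eq_zero_iff.1 ⟨fun a => Complex.I * x a - y a, fun h0 => ?_, ?_⟩
      · have hx0 : ∀ a, x a = 0 := by
          intro a
          have := congrArg Complex.im (congrFun h0 a)
          simpa using this
        have hV0 : V = 0 := by rw [hx]; simp [hx0]
        exact hv0 (congrArg WithLp.ofLp hV0)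
      · have h1 : ∑ a, (Complex.I * x a - y a) • τ a = 0 := by
          simp only [sub_smul, mul_smul, Finset.sum_sub_distrib, ← Finset.smul_sum]
          rw [← hx, ← hy, sub_self]
        funext l
        have h2 := congrArg (fun V : Cn n => V l) h1
        refine Eq.trans ?_ h2
        simp [Matrix.mulVec, dotProduct, T, mul_comm]
    rw [hJ0, hT0]
    simp
  · have h1 : (starRingEnd ℂ) J * (|E.det| : ℝ) * (2 ^ n * Complex.I ^ n) * (∏ i, c i) = T.det := by
      have hIp : Complex.I ^ n ≠ 0 := pow_ne_zero _ Complex.I_ne_zero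
      have h2 : (2 : ℂ) ^ n ≠ 0 := pow_ne_zero _ two_ne_zero
      rw [map_mul, map_inv₀] at habsC
      generalize (starRingEnd ℂ) (∏ i, c i) = Q' at habsC hcc
      generalize (∏ i, c i) = Q at habsC hmul hc' ⊢
      field_simp at habsC hmul
      have h3 : J * ((starRingEnd ℂ) J * (|E.det| : ℝ) * (2 ^ n * Complex.I ^ n) * Q) =
          J * T.det := by
        linear_combination Complex.I ^ n * Q * habsC - hmul
      exact mul_left_cancel₀ hJ0 h3
    rw [← h1, mul_pow, one_div, mul_comm _ (∏ i, c i), inv_mul_cancel_left₀ hc']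
    ring

end Chart

/-! ### Approximate identities in a chart -/

section ChartIntegral

variable {n : ℕ}

/-- A product of bump functions with centres `c l`, as a function of the differences to them. -/
def prodBump (c : Fin n → ℝ) {t : ℝ} (ht : 0 < t) (τ : Fin n → ℝ) : ℝ :=
  ∏ l, unitBump (c l) t ht (c l + τ l)

theorem continuous_prodBump (c : Fin n → ℝ) {t : ℝ} (ht : 0 < t) : Continuous (prodBump c ht) :=
  continuous_finsetProd _ fun l _ => (contDiff_unitBump ht).continuous.comp
    (continuous_const.add (continuous_apply l))

theorem prodBump_nonneg (c : Fin n → ℝ) {t : ℝ} (ht : 0 < t) (τ : Fin n → ℝ) :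
    0 ≤ prodBump c ht τ := Finset.prod_nonneg fun _ _ => unitBump_nonneg ht _

theorem prodBump_eq_zero (c : Fin n → ℝ) {t : ℝ} (ht : 0 < t) {τ : Fin n → ℝ} {l : Fin n}
    (h : t ≤ |τ l|) : prodBump c ht τ = 0 :=
  Finset.prod_eq_zero (Finset.mem_univ l) (unitBump_eq_zero ht (by simpa using h))

theorem hasCompactSupport_prodBump (c : Fin n → ℝ) {t : ℝ} (ht : 0 < t) :
    HasCompactSupport (prodBump c ht) := by
  refine HasCompactSupport.intro (isCompact_closedBall (0 : Fin n → ℝ) t) fun τ hτ => ?_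
  rw [mem_closedBall_zero_iff, pi_norm_le_iff_of_nonneg ht.le] at hτ
  push Not at hτ
  obtain ⟨l, hl⟩ := hτ
  exact prodBump_eq_zero c ht (l := l) hl.le

theorem integral_prodBump (c : Fin n → ℝ) {t : ℝ} (ht : 0 < t) : ∫ τ, prodBump c ht τ = 1 := by
  have h := integral_fintype_prod_volume_eq_prod (𝕜 := ℝ)
    fun (l : Fin n) (u : ℝ) => unitBump (c l) t ht (c l + u)
  refine h.trans (Finset.prod_eq_one fun l _ => ?_)
  rw [integral_add_left_eq_self (fun u => unitBump (c l) t ht u), integral_unitBump]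

theorem norm_integral_prodBump_mul_sub_le (c : Fin n → ℝ) {t e : ℝ} (ht : 0 < t)
    {H : (Fin n → ℝ) → ℂ} (hH : Continuous H) (h : ∀ τ, (∀ l, |τ l| < t) → ‖H τ - H 0‖ ≤ e) :
    ‖(∫ τ, (prodBump c ht τ : ℂ) * H τ) - H 0‖ ≤ e := by
  have hB : Continuous fun τ => (prodBump c ht τ : ℂ) :=
    Complex.continuous_ofReal.comp (continuous_prodBump c ht)
  have hBs : HasCompactSupport fun τ => (prodBump c ht τ : ℂ) :=
    (hasCompactSupport_prodBump c ht).comp_left (g := fun x : ℝ => (x : ℂ)) Complex.ofReal_zero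
  have hI : Integrable (prodBump c ht) :=
    (continuous_prodBump c ht).integrable_of_hasCompactSupport (hasCompactSupport_prodBump c ht)
  have h1 : H 0 = ∫ τ, (prodBump c ht τ : ℂ) * H 0 := by
    rw [integral_mul_const, integral_complex_ofReal, integral_prodBump]; simp
  conv_lhs => rw [h1]
  have hBH : Integrable fun τ => (prodBump c ht τ : ℂ) * H τ :=
    (hB.mul hH).integrable_of_hasCompactSupport hBs.mul_right
  have hBC : Integrable fun τ => (prodBump c ht τ : ℂ) * H 0 :=
    (hB.integrable_of_hasCompactSupport hBs).mul_const _
  rw [← integral_sub hBH hBC]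
  calc _ ≤ ∫ τ, prodBump c ht τ * e := by
        refine norm_integral_le_of_norm_le (hI.mul_const e) (Filter.Eventually.of_forall fun τ => ?_)
        rw [← mul_sub, norm_mul, Complex.norm_real, Real.norm_of_nonneg (prodBump_nonneg c ht τ)]
        by_cases hτ : ∀ l, |τ l| < t
        · exact mul_le_mul_of_nonneg_left (h τ hτ) (prodBump_nonneg c ht τ)
        · push Not at hτ
          obtain ⟨l, hl⟩ := hτ
          simp [prodBump_eq_zero c ht hl]
    _ = e := by rw [integral_mul_const, integral_prodBump, one_mul]

theorem tendsto_integral_prodBump_mul (c : Fin n → ℝ) {t : ℕ → ℝ} (ht : ∀ k, 0 < t k)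
    (ht0 : Filter.Tendsto t Filter.atTop (nhds 0)) {H : (Fin n → ℝ) → ℂ} (hH : Continuous H) :
    Filter.Tendsto (fun k => ∫ τ, (prodBump c (ht k) τ : ℂ) * H τ) Filter.atTop (nhds (H 0)) := by
  rw [Metric.tendsto_nhds]
  intro e he
  obtain ⟨d, hd, hdH⟩ := Metric.continuous_iff.1 hH 0 (e / 2) (by positivity)
  filter_upwards [ht0.eventually_lt_const hd] with k hk
  rw [dist_eq_norm]
  refine lt_of_le_of_lt (norm_integral_prodBump_mul_sub_le c (ht k) hH (e := e / 2)
    fun τ hτ => ?_) (by linarith)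
  refine (dist_eq_norm (H τ) (H 0) ▸ hdH τ ?_).le
  rw [dist_zero_right, pi_norm_lt_iff hd]
  exact fun l => (hτ l).trans hk

/-- The density obtained by pulling back `G` times Lebesgue measure under a local diffeomorphism. -/
def chartPullback (e : OpenPartialHomeomorph (Cn n) (Cn n)) (G : Cn n → ℂ) : Cn n → ℂ :=
  e.source.indicator fun w => (|(fderiv ℝ e w).det| : ℝ) * G (e w)

variable {e : OpenPartialHomeomorph (Cn n) (Cn n)} {G : Cn n → ℂ} {K : Set (Cn n)}

theorem support_chartPullback (hGK : ∀ z ∉ K, G z = 0) :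
    Function.support (chartPullback e G) ⊆ e.symm '' K := by
  intro w hw
  rw [Function.mem_support, chartPullback] at hw
  have hws : w ∈ e.source := by
    by_contra h
    exact hw (Set.indicator_of_notMem h _)
  rw [Set.indicator_of_mem hws] at hw
  have : e w ∈ K := by
    by_contra h
    exact hw (by rw [hGK _ h, mul_zero])
  exact ⟨e w, this, e.left_inv hws⟩

theorem tsupport_chartPullback (hKc : IsCompact K) (hGK : ∀ z ∉ K, G z = 0) (hK : K ⊆ e.target) :
    IsCompact (tsupport (chartPullback e G)) ∧ tsupport (chartPullback e G) ⊆ e.source := by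
  have hc : IsCompact (e.symm '' K) := hKc.image_of_continuousOn (e.continuousOn_symm.mono hK)
  have hs : tsupport (chartPullback e G) ⊆ e.symm '' K :=
    closure_minimal (support_chartPullback hGK) hc.isClosed
  refine ⟨hc.of_isClosed_subset (isClosed_tsupport _) hs, hs.trans ?_⟩
  rintro _ ⟨z, hz, rfl⟩
  exact e.map_target (hK hz)

/-- The compact K inside the target keeps the support of the pullback in a compact part of the
source, so extension by zero creates no jump. -/
theorem continuous_chartPullback (he : ∀ w ∈ e.source, ContDiffAt ℝ 1 e w)
    (hG : ContinuousOn G e.target) (hKc : IsCompact K) (hGK : ∀ z ∉ K, G z = 0)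
    (hK : K ⊆ e.target) : Continuous (chartPullback e G) := by
  refine continuous_of_tsupport_subset e.open_source ?_ (tsupport_chartPullback hKc hGK hK).2
  have h1 : ContinuousOn (fun w => (fderiv ℝ e w).det) e.source := fun w hw =>
    (ContinuousLinearMap.continuous_det.continuousAt.comp
      ((he w hw).fderiv_right (m := 0) (by simp)).continuousAt).continuousWithinAt
  have h2 : ContinuousOn (fun w => ((|(fderiv ℝ e w).det| : ℝ) : ℂ) * G (e w)) e.source :=
    (Complex.continuous_ofReal.comp_continuousOn h1.abs).mul
      (hG.comp e.continuousOn e.mapsTo)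
  exact h2.congr fun w hw => Set.indicator_of_mem hw _

theorem integral_eq_integral_chartPullback (he : ∀ w ∈ e.source, ContDiffAt ℝ 1 e w)
    (hGK : ∀ z ∉ K, G z = 0) (hK : K ⊆ e.target) :
    ∫ z, G z ∂lebesgue n = ∫ w, chartPullback e G w ∂lebesgue n := by
  have h1 := integral_image_eq_integral_abs_det_fderiv_smul (lebesgue n)
    e.open_source.measurableSet (f := e) (f' := fun w => fderiv ℝ e w)
    (fun w hw => ((he w hw).differentiableAt (by simp)).hasFDerivAt.hasFDerivWithinAt)
    e.injOn G
  rw [e.image_source_eq_target, setIntegral_eq_integral_of_forall_compl_eq_zero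
    fun z hz => hGK z fun h => hz (hK h)] at h1
  rw [h1, chartPullback, integral_indicator e.open_source.measurableSet]
  simp only [Complex.real_smul]

/-- The restriction of a compactly supported function to the real subspace is integrable. -/
theorem integrable_comp_ofRealVec {g : Cn n → ℂ} (hg : Continuous g) (hgs : HasCompactSupport g) :
    Integrable fun x => g (ofRealVec x) := by
  refine (hg.comp ofRealVec.continuous).integrable_of_hasCompactSupport ?_
  refine HasCompactSupport.intro (hgs.image (reVec (n := n)).continuous) fun x hx => ?_
  by_contra h
  exact hx ⟨ofRealVec x, subset_tsupport g h, reVec_ofRealVec x⟩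

/-- Integrals against product kernels in the imaginary directions concentrate on the real
subspace. -/
theorem tendsto_integral_prodBump_imVec (c : Fin n → ℝ) {t : ℕ → ℝ} (ht : ∀ k, 0 < t k)
    (ht0 : Filter.Tendsto t Filter.atTop (nhds 0)) {g : Cn n → ℂ} (hg : Continuous g)
    (hgs : HasCompactSupport g) :
    Filter.Tendsto (fun k => ∫ w, (prodBump c (ht k) (imVec w) : ℂ) * g w ∂lebesgue n) Filter.atTop
      (nhds (∫ x, g (ofRealVec x))) := by
  have hsc : IsCompact (reVec '' tsupport g) := hgs.image (reVec (n := n)).continuous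
  have hz : ∀ τ, ∀ x ∉ reVec '' tsupport g, g (realCoordEquiv n (x, τ)) = 0 := by
    intro τ x hx
    by_contra h
    exact hx ⟨_, subset_tsupport g h, reVec_realCoordEquiv (x, τ)⟩
  -- By Fubini the integral over the real directions becomes a continuous function of the imaginary
  -- part, to which the approximate identity applies.
  have hH : Continuous fun τ => ∫ x, g (realCoordEquiv n (x, τ)) := by
    have h := continuous_parametric_integral_of_continuous (μ := (volume : Measure (Fin n → ℝ)))
      (f := fun (τ : Fin n → ℝ) (x : Fin n → ℝ) => g (realCoordEquiv n (x, τ)))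
      (hg.comp ((realCoordEquiv n).continuous.comp continuous_swap)) hsc
    refine h.congr fun τ => ?_
    exact setIntegral_eq_integral_of_forall_compl_eq_zero (hz τ)
  refine (tendsto_integral_prodBump_mul c ht ht0 hH).congr fun k => ?_
  rw [← (measurePreserving_realCoordEquiv n).integral_comp (measurableEmbedding_realCoordEquiv n)]
  rw [integral_prod_symm]
  · simp only [imVec_realCoordEquiv, integral_const_mul]
  · have hint : Integrable (fun w => (prodBump c (ht k) (imVec w) : ℂ) * g w) (lebesgue n) := by
      refine Continuous.integrable_of_hasCompactSupport ?_ hgs.mul_left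
      exact (Complex.continuous_ofReal.comp
        ((continuous_prodBump c (ht k)).comp (imVec (n := n)).continuous)).mul hg
    exact ((measurePreserving_realCoordEquiv n).integrable_comp_emb
      (measurableEmbedding_realCoordEquiv n)).2 hint

/-- Integrals against product kernels in defining functions of a submanifold concentrate on the
submanifold. -/
theorem tendsto_integral_prodBump_chart {L : Cn n → Fin n → ℝ}
    (he : ∀ w ∈ e.source, ContDiffAt ℝ 1 e w ∧ L (e w) = imVec w)
    (hG : ContinuousOn G e.target) (hKc : IsCompact K) (hGK : ∀ z ∉ K, G z = 0)
    (hK : K ⊆ e.target) (c : Fin n → ℝ) {t : ℕ → ℝ} (ht : ∀ k, 0 < t k)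
    (ht0 : Filter.Tendsto t Filter.atTop (nhds 0)) :
    Filter.Tendsto (fun k => ∫ z, (prodBump c (ht k) (L z) : ℂ) * G z ∂lebesgue n) Filter.atTop
      (nhds (∫ x, chartPullback e G (ofRealVec x))) := by
  have hcont := continuous_chartPullback (fun w hw => (he w hw).1) hG hKc hGK hK
  refine (tendsto_integral_prodBump_imVec c ht ht0 hcont
    (tsupport_chartPullback hKc hGK hK).1).congr fun k => ?_
  rw [integral_eq_integral_chartPullback (e := e) (K := K)
    (G := fun z => (prodBump c (ht k) (L z) : ℂ) * G z) (fun w hw => (he w hw).1)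
    (fun z hz => by rw [hGK z hz, mul_zero]) hK]
  refine integral_congr_ae (Filter.Eventually.of_forall fun w => ?_)
  beta_reduce
  unfold chartPullback
  by_cases hw : w ∈ e.source
  · rw [Set.indicator_of_mem hw, Set.indicator_of_mem hw]
    beta_reduce
    rw [(he w hw).2]
    ring
  · rw [Set.indicator_of_notMem hw, Set.indicator_of_notMem hw, mul_zero]

end ChartIntegral

/-! ### Charts along the level set |F_i| = δ_i -/

section LevelSet

variable {n : ℕ} {F : Fin n → Cn n → ℂ} {δ : Fin n → ℝ}

/-- The complex conjugate of the Jacobian determinant. -/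
def conjJacobian (F : Fin n → Cn n → ℂ) (z : Cn n) : ℂ :=
  (starRingEnd ℂ) (Matrix.det (Matrix.of fun m l =>
    fderiv ℂ (F m) z (EuclideanSpace.single l 1)))

/-- Defining functions for the level set `|F₁| = δ₁, …, |Fₙ| = δₙ`. -/
def levelDiff (F : Fin n → Cn n → ℂ) (δ : Fin n → ℝ) (z : Cn n) : Fin n → ℝ :=
  fun i => ‖F i z‖ ^ 2 - δ i ^ 2

theorem continuousOn_conjJacobian {V : Set (Cn n)} (hV : IsOpen V)
    (hF : ∀ i, DifferentiableOn ℂ (F i) V) : ContinuousOn (conjJacobian F) V :=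
  Complex.continuous_conj.comp_continuousOn
    (Continuous.matrix_det continuous_id |>.comp_continuousOn
      (continuousOn_pi.2 fun m => continuousOn_pi.2 fun _ =>
        (differentiableOn_fderiv_apply hV (hF m) _).continuousOn))

theorem contDiffOn_levelDiff {V : Set (Cn n)} (hV : IsOpen V)
    (hF : ∀ i, DifferentiableOn ℂ (F i) V) : ContDiffOn ℝ ∞ (levelDiff F δ) V :=
  contDiffOn_pi.2 fun i => (((contDiffOn_of_holomorphic hV (hF i)).restrict_scalars ℝ).norm_sq
    ℂ).sub contDiffOn_const

/-- Since d|F|² = 2 Re(F̄ dF), the differentials are positive multiples of d log|F_i|. The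
regularity assumption on Γ is thus the surjectivity needed for an adapted chart. -/
theorem fderiv_levelDiff {z : Cn n} (hF : ∀ i, DifferentiableAt ℂ (F i) z)
    (h0 : ∀ i, F i z ≠ 0) (v : Cn n) (i : Fin n) :
    fderiv ℝ (levelDiff F δ) z v i = 2 * ‖F i z‖ ^ 2 * (fderiv ℂ (F i) z v / F i z).re := by
  have h : HasFDerivAt (levelDiff F δ) (ContinuousLinearMap.pi fun i =>
      2 • (innerSL ℝ (F i z)).comp ((fderiv ℂ (F i) z).restrictScalars ℝ)) z := by
    rw [hasFDerivAt_pi]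
    exact fun i => (((hF i).hasFDerivAt.restrictScalars ℝ).norm_sq).sub_const _
  rw [h.fderiv]
  have h1 : (‖F i z‖ ^ 2 : ℝ) * (fderiv ℂ (F i) z v / F i z).re =
      ((starRingEnd ℂ) (F i z) * fderiv ℂ (F i) z v).re := by
    rw [← Complex.re_ofReal_mul]
    congr 1
    have := Complex.mul_conj (F i z)
    rw [Complex.normSq_eq_norm_sq] at this
    rw [← this]
    field_simp [h0 i]
  rw [mul_assoc, h1]
  simp [Complex.inner, mul_comm]
  ring

theorem surjective_fderiv_levelDiff {z : Cn n} (hF : ∀ i, DifferentiableAt ℂ (F i) z)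
    (h0 : ∀ i, F i z ≠ 0) (h : Function.Surjective
      fun (v : Cn n) (i : Fin n) => (fderiv ℂ (F i) z v / F i z).re) :
    Function.Surjective (fderiv ℝ (levelDiff F δ) z) := by
  intro y
  obtain ⟨v, hv⟩ := h fun i => y i / (2 * ‖F i z‖ ^ 2)
  refine ⟨v, funext fun i => ?_⟩
  rw [fderiv_levelDiff hF h0]
  have hi := congrFun hv i
  have := norm_pos_iff.2 (h0 i)
  beta_reduce at hi
  rw [hi]
  field_simp

/-- A coordinate system near a point of the level set, in which the level set is the real subspace
and is parametrized by `q`. -/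
structure IsLevelChart (F : Fin n → Cn n → ℂ) (δ : Fin n → ℝ) (V : Set (Cn n))
    (D : Set (Fin n → ℝ)) (q : (Fin n → ℝ) → Cn n) (e : OpenPartialHomeomorph (Cn n) (Cn n)) :
    Prop where
  contDiffAt : ∀ w ∈ e.source, ContDiffAt ℝ 1 e w
  det_ne_zero : ∀ w ∈ e.source, (fderiv ℝ e w).det ≠ 0
  mem : ∀ w ∈ e.source, e w ∈ V
  level : ∀ w ∈ e.source, levelDiff F δ (e w) = imVec w
  mem_dom : ∀ x, ofRealVec x ∈ e.source → x ∈ D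
  param : ∀ x, ofRealVec x ∈ e.source → e (ofRealVec x) = q x

variable {V : Set (Cn n)} {D : Set (Fin n → ℝ)} {q : (Fin n → ℝ) → Cn n}
  {e : OpenPartialHomeomorph (Cn n) (Cn n)}

theorem IsLevelChart.target_subset (he : IsLevelChart F δ V D q e) : e.target ⊆ V := by
  intro z hz
  rw [← e.right_inv hz]
  exact he.mem _ (e.map_target hz)

/-- A point of the level set in the target has real coordinates, say x'. Then q(x') = q(x), and
injectivity gives x' = x. So the chart sees no sheet of the parametrized piece other than its own.
-/
theorem IsLevelChart.mem_source_of_mem_target (he : IsLevelChart F δ V D q e)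
    (hq : Set.InjOn q D) (hLq : ∀ x ∈ D, levelDiff F δ (q x) = 0) {x : Fin n → ℝ} (hx : x ∈ D)
    (h : q x ∈ e.target) : ofRealVec x ∈ e.source := by
  have h1 := e.map_target h
  have h2 := he.level _ h1
  rw [e.right_inv h, hLq x hx] at h2
  have h3 : ofRealVec (reVec (e.symm (q x))) = e.symm (q x) := ofRealVec_reVec h2.symm
  have h4 := he.mem_dom _ (h3 ▸ h1)
  have h5 := he.param _ (h3 ▸ h1)
  rw [h3, e.right_inv h] at h5
  rw [hq hx h4 h5, h3]
  exact h1

/-- The density of the conjugate Jacobian on the level set. -/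
theorem IsLevelChart.chartPullback_eq (he : IsLevelChart F δ V D q e) (hV : IsOpen V)
    (hF : ∀ i, DifferentiableOn ℂ (F i) V) (hF0 : ∀ x ∈ D, ∀ i, F i (q x) ≠ 0)
    (hq : Set.InjOn q D) (hLq : ∀ x ∈ D, levelDiff F δ (q x) = 0)
    {x : Fin n → ℝ} (hx : x ∈ D) {u : Cn n → ℂ} (hu : ∀ z ∉ e.target, u z = 0)
    (hpos : 0 ≤ Matrix.det (Matrix.of fun i a : Fin n =>
      (fderiv ℂ (F i) (q x) (fderiv ℝ q x (Pi.single a 1)) / F i (q x)).im)) :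
    (2 * Complex.I) ^ n * chartPullback e (fun z => u z * conjJacobian F z) (ofRealVec x) =
      u (q x) * (1 / (∏ i, F i (q x)) * topForm n fun a => fderiv ℝ q x (Pi.single a 1)) := by
  by_cases hxs : ofRealVec x ∈ e.source
  swap
  · rw [hu (q x) fun h => hxs (he.mem_source_of_mem_target hq hLq hx h), chartPullback,
      Set.indicator_of_notMem hxs]
    simp
  have hqx := he.param x hxs
  have hqV : q x ∈ V := hqx ▸ he.mem _ hxs
  set E := fderiv ℝ e (ofRealVec x) with hE
  have hed : HasFDerivAt e E (ofRealVec x) :=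
    ((he.contDiffAt _ hxs).differentiableAt (by simp)).hasFDerivAt
  have hFd : ∀ i, DifferentiableAt ℂ (F i) (q x) := fun i =>
    (hF i).differentiableAt (hV.mem_nhds hqV)
  have hL : DifferentiableAt ℝ (levelDiff F δ) (q x) :=
    ((contDiffOn_levelDiff hV hF).contDiffAt (hV.mem_nhds hqV)).differentiableAt (by simp)
  -- Obtained by differentiating the identity levelDiff ∘ e = Im.
  have hre : ∀ i w, (fderiv ℂ (F i) (q x) (E w) / F i (q x)).re =
      1 / (2 * ‖F i (q x)‖ ^ 2) * (w i).im := by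
    intro i w
    have h1 : HasFDerivAt (levelDiff F δ) (fderiv ℝ (levelDiff F δ) (q x)) (e (ofRealVec x)) := by
      rw [hqx]; exact hL.hasFDerivAt
    have h2 := h1.comp _ hed
    have h3 : levelDiff F δ ∘ e =ᶠ[nhds (ofRealVec x)] imVec := by
      filter_upwards [e.open_source.mem_nhds hxs] with w hw using he.level w hw
    have h4 : HasFDerivAt (fun w : Cn n => imVec w) (imVec (n := n)) (ofRealVec x) :=
      (imVec (n := n)).hasFDerivAt
    have h5 := h2.unique (h4.congr_of_eventuallyEq h3)
    have h6 := congrFun (congrArg (fun A => A w) h5) i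
    have h7 : 2 * ‖F i (q x)‖ ^ 2 * (fderiv ℂ (F i) (q x) (E w) / F i (q x)).re = (w i).im := by
      rw [← fderiv_levelDiff hFd (hF0 x hx)]
      exact h6
    have := norm_pos_iff.2 (hF0 x hx i)
    rw [← h7]
    field_simp
  have htan : ∀ v, E (ofRealVec v) = fderiv ℝ q x v := by
    intro v
    have h1 := hed.comp x (ofRealVec (n := n)).hasFDerivAt
    have h2 : (e ∘ ofRealVec) =ᶠ[nhds x] q := by
      filter_upwards [(ofRealVec (n := n)).continuous.continuousAt.eventually_mem
        (e.open_source.mem_nhds hxs)] with y hy using he.param y hy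
    rw [(h1.congr_of_eventuallyEq h2.symm).fderiv]
    rfl
  simp only [← htan] at hpos ⊢
  have h := conj_det_mul_abs_det E (he.det_ne_zero _ hxs) (fun i => fderiv ℂ (F i) (q x))
    (fun i => F i (q x)) (hF0 x hx) hre hpos
  rw [chartPullback, Set.indicator_of_mem hxs, ← h, hqx, conjJacobian]
  ring

/-- Integrals against product kernels, localized near a point of the level set. -/
theorem IsLevelChart.tendsto_integral (he : IsLevelChart F δ V D q e) (hV : IsOpen V)
    (hF : ∀ i, DifferentiableOn ℂ (F i) V) (hF0 : ∀ x ∈ D, ∀ i, F i (q x) ≠ 0) (hD : IsOpen D)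
    (hq : Set.InjOn q D) (hLq : ∀ x ∈ D, levelDiff F δ (q x) = 0)
    (hpos : ∀ x ∈ D, 0 ≤ Matrix.det (Matrix.of fun i a : Fin n =>
      (fderiv ℂ (F i) (q x) (fderiv ℝ q x (Pi.single a 1)) / F i (q x)).im))
    {u : Cn n → ℂ} (hu : ContinuousOn u V) {K : Set (Cn n)} (hK : IsCompact K) (hKe : K ⊆ e.target)
    (huK : ∀ z ∉ K, u z = 0) (c : Fin n → ℝ) {t : ℕ → ℝ} (ht : ∀ k, 0 < t k)
    (ht0 : Filter.Tendsto t Filter.atTop (nhds 0)) :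
    IntegrableOn (fun x => u (q x) * (1 / (∏ i, F i (q x)) *
      topForm n fun a => fderiv ℝ q x (Pi.single a 1))) D ∧
    Filter.Tendsto (fun k => (2 * Complex.I) ^ n *
      ∫ z, (prodBump c (ht k) (levelDiff F δ z) : ℂ) * (u z * conjJacobian F z) ∂lebesgue n)
      Filter.atTop (nhds (∫ x in D, u (q x) * (1 / (∏ i, F i (q x)) *
        topForm n fun a => fderiv ℝ q x (Pi.single a 1)))) := by
  have hG : ContinuousOn (fun z => u z * conjJacobian F z) e.target :=
    (hu.mul (continuousOn_conjJacobian hV hF)).mono he.target_subset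
  have hGK : ∀ z ∉ K, u z * conjJacobian F z = 0 := fun z hz => by rw [huK z hz, zero_mul]
  have hcont := continuous_chartPullback he.contDiffAt hG hK hGK hKe
  have hint := integrable_comp_ofRealVec hcont (tsupport_chartPullback hK hGK hKe).1
  have heq : ∀ x ∈ D, (2 * Complex.I) ^ n *
      chartPullback e (fun z => u z * conjJacobian F z) (ofRealVec x) = u (q x) *
        (1 / (∏ i, F i (q x)) * topForm n fun a => fderiv ℝ q x (Pi.single a 1)) := fun x hx =>
    he.chartPullback_eq hV hF hF0 hq hLq hx (fun z hz => huK z fun h => hz (hKe h)) (hpos x hx)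
  have hlim := tendsto_integral_prodBump_chart (L := levelDiff F δ)
    (fun w hw => ⟨he.contDiffAt w hw, he.level w hw⟩) hG hK hGK hKe c ht ht0
  refine ⟨((hint.const_mul _).integrableOn (s := D)).congr_fun heq hD.measurableSet, ?_⟩
  rw [← setIntegral_congr_fun hD.measurableSet heq, integral_const_mul,
    setIntegral_eq_integral_of_forall_compl_eq_zero]
  · exact hlim.const_mul _
  · intro x hx
    rw [chartPullback, Set.indicator_of_notMem fun h => hx (he.mem_dom x h)]

end LevelSet

/-! ### Localization to compact pieces of the level set -/

section LocalizedCutoff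

variable {n : ℕ} {F : Fin n → Cn n → ℂ} {δ : Fin n → ℝ} {V : Set (Cn n)} {D : Set (Fin n → ℝ)}
  {q : (Fin n → ℝ) → Cn n}

theorem exists_isLevelChart (hV : IsOpen V) (hF : ∀ i, DifferentiableOn ℂ (F i) V)
    (hF0 : ∀ x ∈ D, ∀ i, F i (q x) ≠ 0) (hD : IsOpen D) (hqs : ContDiffOn ℝ ∞ q D)
    (himm : ∀ x ∈ D, Function.Injective (fderiv ℝ q x)) (hqV : ∀ x ∈ D, q x ∈ V)
    (hLq : ∀ x ∈ D, levelDiff F δ (q x) = 0)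
    (hsurj : ∀ x ∈ D, Function.Surjective
      fun (v : Cn n) (i : Fin n) => (fderiv ℂ (F i) (q x) v / F i (q x)).re)
    {x : Fin n → ℝ} (hx : x ∈ D) : ∃ e, IsLevelChart F δ V D q e ∧ q x ∈ e.target := by
  have hFd : ∀ i, DifferentiableAt ℂ (F i) (q x) := fun i =>
    (hF i).differentiableAt (hV.mem_nhds (hqV x hx))
  obtain ⟨e, h1, h2, h3⟩ := exists_adapted_chart hV (contDiffOn_levelDiff (δ := δ) hV hF) hD hqs hqV
    hLq hx (himm x hx) (surjective_fderiv_levelDiff hFd (hF0 x hx) (hsurj x hx))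
  refine ⟨e, ⟨fun w hw => (h2 w hw).1, fun w hw => (h2 w hw).2.1, fun w hw => (h2 w hw).2.2.1,
    fun w hw => (h2 w hw).2.2.2, fun x hx => (h3 x hx).1, fun x hx => (h3 x hx).2⟩, ?_⟩
  rw [← (h3 x h1).2]
  exact e.map_source h1

theorem integrable_of_continuousOn_of_eq_zero {G : Cn n → ℂ} {K : Set (Cn n)} (hK : IsCompact K)
    (hG : ContinuousOn G K) (h0 : ∀ z ∉ K, G z = 0) : Integrable G (lebesgue n) := by
  refine (integrableOn_iff_integrable_of_support_subset (s := K) fun z hz => ?_).1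
    (hG.integrableOn_compact hK)
  by_contra h
  exact hz (h0 z h)

theorem continuousOn_prodBump_levelDiff (hV : IsOpen V) (hF : ∀ i, DifferentiableOn ℂ (F i) V)
    (c : Fin n → ℝ) {t : ℝ} (ht : 0 < t) :
    ContinuousOn (fun z => (prodBump c ht (levelDiff F δ z) : ℂ)) V :=
  Complex.continuous_ofReal.comp_continuousOn
    ((continuous_prodBump c ht).comp_continuousOn (contDiffOn_levelDiff hV hF).continuousOn)

/-- A cutoff function near a compact piece of the level set, for which integrals against product
kernels converge to integrals over the level set. -/
theorem exists_localized_cutoff (hV : IsOpen V) (hF : ∀ i, DifferentiableOn ℂ (F i) V)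
    (hF0 : ∀ x ∈ D, ∀ i, F i (q x) ≠ 0) (hD : IsOpen D) (hqs : ContDiffOn ℝ ∞ q D)
    (hq : Set.InjOn q D) (himm : ∀ x ∈ D, Function.Injective (fderiv ℝ q x))
    (hqV : ∀ x ∈ D, q x ∈ V) (hLq : ∀ x ∈ D, levelDiff F δ (q x) = 0)
    (hsurj : ∀ x ∈ D, Function.Surjective
      fun (v : Cn n) (i : Fin n) => (fderiv ℂ (F i) (q x) v / F i (q x)).re)
    (hpos : ∀ x ∈ D, 0 ≤ Matrix.det (Matrix.of fun i a : Fin n =>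
      (fderiv ℂ (F i) (q x) (fderiv ℝ q x (Pi.single a 1)) / F i (q x)).im))
    {C : Set (Fin n → ℝ)} (hC : IsCompact C) (hCD : C ⊆ D) (c : Fin n → ℝ) {t : ℕ → ℝ}
    (ht : ∀ k, 0 < t k) (ht0 : Filter.Tendsto t Filter.atTop (nhds 0)) :
    ∃ (θ : Cn n → ℝ) (K : Set (Cn n)), Continuous θ ∧ (∀ z, 0 ≤ θ z) ∧ IsCompact K ∧ K ⊆ V ∧
      (∀ z ∉ K, θ z = 0) ∧ (∀ x ∈ C, θ (q x) = 1) ∧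
      (∃ M, Filter.Tendsto (fun k => ∫ z, (prodBump c (ht k) (levelDiff F δ z) : ℂ) * θ z
        ∂lebesgue n) Filter.atTop (nhds M)) ∧
      ∀ u : Cn n → ℂ, ContinuousOn u V →
        Filter.Tendsto (fun k => (2 * Complex.I) ^ n *
          ∫ z, (prodBump c (ht k) (levelDiff F δ z) : ℂ) * (θ z * u z * conjJacobian F z)
            ∂lebesgue n) Filter.atTop
          (nhds (∫ x in D, θ (q x) * u (q x) * (1 / (∏ i, F i (q x)) *
            topForm n fun a => fderiv ℝ q x (Pi.single a 1)))) := by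
  -- Finitely many chart targets cover the compact q(C). The cutoff θ is the sum of a partition of
  -- unity subordinate to them, so that each summand is treated in a single chart.
  choose e he hqe using fun x : C =>
    exists_isLevelChart hV hF hF0 hD hqs himm hqV hLq hsurj (hCD x.2)
  have hqc : IsCompact (q '' C) := hC.image_of_continuousOn (hqs.continuousOn.mono hCD)
  obtain ⟨T, hT⟩ := hqc.elim_finite_subcover (fun x : C => (e x).target)
    (fun x => (e x).open_target) (by
      rintro _ ⟨x, hx, rfl⟩
      exact Set.mem_iUnion.2 ⟨⟨x, hx⟩, hqe ⟨x, hx⟩⟩)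
  obtain ⟨η, hη1, hη2, hη3, hη4⟩ := exists_continuous_sum_one_of_isOpen_isCompact
    (s := fun i : Fin T.card => (e (T.equivFin.symm i)).target)
    (fun i => (e _).open_target) hqc (by
      intro z hz
      obtain ⟨x, hx, hzx⟩ := Set.mem_iUnion₂.1 (hT hz)
      refine Set.mem_iUnion.2 ⟨T.equivFin ⟨x, hx⟩, ?_⟩
      simpa using hzx)
  have htV : ∀ i, tsupport (η i) ⊆ V := fun i => (hη1 i).trans (he _).target_subset
  have hη0 : ∀ i, ∀ z ∉ tsupport (η i), η i z = 0 := fun i z hz =>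
    image_eq_zero_of_notMem_tsupport hz
  have hηc : ∀ i, Continuous fun z => (η i z : ℂ) := fun i =>
    Complex.continuous_ofReal.comp (η i).continuous
  have hlim : ∀ u : Cn n → ℂ, ContinuousOn u V → ∀ i, _ := fun u hu i =>
    (he (T.equivFin.symm i)).tendsto_integral hV hF hF0 hD hq hLq hpos
      (u := fun z => (η i z : ℂ) * u z) ((hηc i).continuousOn.mul hu) (hη4 i) (hη1 i)
      (fun z hz => by rw [hη0 i z hz, Complex.ofReal_zero, zero_mul]) c ht ht0
  refine ⟨fun z => ∑ i, η i z, ⋃ i, tsupport (η i), continuous_finsetSum _ fun i _ =>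
    (η i).continuous, fun z => Finset.sum_nonneg fun i _ => (hη3 i z).1,
    isCompact_iUnion fun i => hη4 i, Set.iUnion_subset htV, fun z hz => ?_, fun x hx => ?_, ?_,
    fun u hu => ?_⟩
  · rw [Set.mem_iUnion, not_exists] at hz
    exact Finset.sum_eq_zero fun i _ => hη0 i z (hz i)
  · have := hη2 ⟨x, hx, rfl⟩
    simpa using this
  -- The limit of the total mass is recorded because it bounds the error away from the partition of
  -- unity.
  · refine ⟨_, (tendsto_finsetSum Finset.univ fun i _ => tendsto_integral_prodBump_chart
      (L := levelDiff F δ) (G := fun z => (η i z : ℂ))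
      (fun w hw => ⟨(he (T.equivFin.symm i)).contDiffAt w hw, (he _).level w hw⟩)
      (hηc i).continuousOn (hη4 i) (fun z hz => by rw [hη0 i z hz, Complex.ofReal_zero]) (hη1 i)
      c ht ht0).congr fun k => ?_⟩
    rw [← integral_finsetSum]
    · simp only [Complex.ofReal_sum, Finset.mul_sum]
    · intro i _
      refine integrable_of_continuousOn_of_eq_zero (hη4 i) ?_ fun z hz => by
        rw [hη0 i z hz, Complex.ofReal_zero, mul_zero]
      exact ((continuousOn_prodBump_levelDiff hV hF c (ht k)).mono (htV i)).mul
        (hηc i).continuousOn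
  · have h := tendsto_finsetSum Finset.univ fun i _ => (hlim u hu i).2
    rw [← integral_finsetSum _ fun i _ => (hlim u hu i).1] at h
    have hr : ∀ x, ∑ i, (η i (q x) : ℂ) * u (q x) * (1 / (∏ i, F i (q x)) *
        topForm n fun a => fderiv ℝ q x (Pi.single a 1)) = ((∑ i, η i (q x) : ℝ) : ℂ) * u (q x) *
        (1 / (∏ i, F i (q x)) * topForm n fun a => fderiv ℝ q x (Pi.single a 1)) := by
      intro x
      rw [Complex.ofReal_sum, Finset.sum_mul, Finset.sum_mul]
    simp only [hr] at h
    refine h.congr fun k => ?_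
    rw [← Finset.mul_sum, ← integral_finsetSum]
    · simp only [Complex.ofReal_sum, Finset.mul_sum, Finset.sum_mul]
    · intro i _
      refine integrable_of_continuousOn_of_eq_zero (hη4 i) ?_ fun z hz => by
        rw [hη0 i z hz, Complex.ofReal_zero, zero_mul, zero_mul, mul_zero]
      exact ((continuousOn_prodBump_levelDiff hV hF c (ht k)).mono (htV i)).mul
        (((hηc i).continuousOn.mul (hu.mono (htV i))).mul
          ((continuousOn_conjJacobian hV hF).mono (htV i)))

end LocalizedCutoff

/-! ### Concentration on the torus Γ -/

section LevelTorus

variable {n : ℕ} {ε R : ℝ} {F : Fin n → Cn n → ℂ} {δ : Fin n → ℝ} {φ : Cn n → ℂ}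

theorem levelTorus_subset_ball (hsep : ∀ z : Cn n, ‖z‖ = R → ∃ i, δ i < ‖F i z‖) :
    levelTorus F R δ ⊆ ball 0 R := by
  intro z hz
  rw [mem_ball_zero_iff]
  refine lt_of_le_of_ne hz.1 fun h => ?_
  obtain ⟨i, hi⟩ := hsep z h
  exact absurd (hz.2 i) hi.ne'

theorem mem_levelTorus_iff (hδ : ∀ i, 0 < δ i) {z : Cn n} (hz : ‖z‖ ≤ R) :
    z ∈ levelTorus F R δ ↔ levelDiff F δ z = 0 := by
  refine ⟨fun h => funext fun i => ?_, fun h => ⟨hz, fun i => ?_⟩⟩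
  · simp [levelDiff, h.2 i]
  · have hi : ‖F i z‖ ^ 2 - δ i ^ 2 = 0 := congrFun h i
    exact (pow_left_inj₀ (norm_nonneg _) (hδ i).le two_ne_zero).1 (sub_eq_zero.1 hi)

theorem isCompact_levelTorus (hF : ∀ m, ContinuousOn (F m) (closedBall 0 R)) :
    IsCompact (levelTorus F R δ) := by
  refine (isCompact_closedBall (0 : Cn n) R).of_isClosed_subset ?_
    fun z hz => mem_closedBall_zero_iff.2 hz.1
  have : levelTorus F R δ = closedBall 0 R ∩
      ⋂ l, (closedBall 0 R ∩ (fun z => ‖F l z‖) ⁻¹' {δ l}) := by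
    ext z
    simp only [levelTorus, Set.mem_ofPred_eq, Set.mem_inter_iff, Set.mem_iInter, Set.mem_preimage,
      Set.mem_singleton_iff, mem_closedBall_zero_iff]
    exact ⟨fun h => ⟨h.1, fun l => ⟨h.1, h.2 l⟩⟩, fun h => ⟨h.1, fun l => (h.2 l).2⟩⟩
  rw [this]
  exact isClosed_closedBall.inter (isClosed_iInter fun l =>
    (hF l).norm.preimage_isClosed_of_isClosed isClosed_closedBall isClosed_singleton)

theorem ParamPartition.param_mem {k : ℕ} {Γ : Set (Cn n)} (P : ParamPartition k Γ) (l : Fin P.card)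
    {x : Fin k → ℝ} (hx : x ∈ P.dom l) : P.param l x ∈ Γ := by
  obtain ⟨O, -, hO⟩ := P.open_image l (P.dom l) subset_rfl (P.isOpen_dom l)
  have : P.param l x ∈ Γ ∩ O := hO ▸ ⟨x, hx, rfl⟩
  exact this.1

/-- Integrals against product kernels concentrate near the level set. -/
theorem tendsto_integral_prodBump_of_eq_zero (hRε : R < ε)
    (hF : ∀ i, DifferentiableOn ℂ (F i) (ball 0 ε)) (hδ : ∀ i, 0 < δ i)
    {g : Cn n → ℂ} (hg : ContinuousOn g (closedBall 0 R)) (hg0 : ∀ z ∈ levelTorus F R δ, g z = 0)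
    {Θ : Cn n → ℝ} (hΘ : Continuous Θ) (hΘV : ∀ z ∉ ball (0 : Cn n) R, Θ z = 0)
    (hΘ1 : ∀ z ∈ levelTorus F R δ, 1 ≤ Θ z) (c : Fin n → ℝ) {t : ℕ → ℝ}
    (ht : ∀ k, 0 < t k) (ht0 : Filter.Tendsto t Filter.atTop (nhds 0)) {M : ℂ}
    (hM : Filter.Tendsto (fun k => ∫ z, (prodBump c (ht k) (levelDiff F δ z) : ℂ) * Θ z
      ∂lebesgue n) Filter.atTop (nhds M)) :
    Filter.Tendsto (fun k => ∫ z in ball 0 R, (prodBump c (ht k) (levelDiff F δ z) : ℂ) * g z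
      ∂lebesgue n) Filter.atTop (nhds 0) := by
  have hsub : closedBall (0 : Cn n) R ⊆ ball 0 ε := closedBall_subset_ball hRε
  have hL : ContinuousOn (levelDiff F δ) (closedBall 0 R) :=
    (contDiffOn_levelDiff isOpen_ball hF).continuousOn.mono hsub
  rw [Metric.tendsto_nhds]
  intro e he
  have hM0 : 0 < ‖M‖ + 1 := by positivity
  -- Chosen so that 2e'(‖M‖ + 1) = e/2.
  set e' := e / (4 * (‖M‖ + 1)) with he'
  have he'0 : 0 < e' := by positivity
  -- The bad set, where |g| ≥ e' or Θ ≤ 1/2, is compact and misses Γ, so `levelDiff` is bounded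
  -- below on it and narrow kernels vanish there. Elsewhere |g| < e' < 2e'Θ, and the mass of the
  -- kernel against Θ is bounded.
  have hB : IsCompact ((closedBall (0 : Cn n) R ∩ (fun z => ‖g z‖) ⁻¹' Set.Ici e') ∪
      (closedBall (0 : Cn n) R ∩ Θ ⁻¹' Set.Iic (1 / 2))) := by
    refine ((isCompact_closedBall (0 : Cn n) R).of_isClosed_subset
      (hg.norm.preimage_isClosed_of_isClosed isClosed_closedBall isClosed_Ici)
      Set.inter_subset_left).union ((isCompact_closedBall (0 : Cn n) R).inter_right
        (isClosed_Iic.preimage hΘ))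
  obtain ⟨m, hm0, hm⟩ := hB.exists_forall_le' (a := 0) (f := fun z => ‖levelDiff F δ z‖)
    ((hL.mono (Set.union_subset Set.inter_subset_left Set.inter_subset_left)).norm) (by
      intro z hz
      refine norm_pos_iff.2 fun h0 => ?_
      rcases hz with ⟨hzR, hz⟩ | ⟨hzR, hz⟩
      · have := hg0 z ((mem_levelTorus_iff hδ (mem_closedBall_zero_iff.1 hzR)).2 h0)
        rw [Set.mem_preimage, this, norm_zero] at hz
        exact absurd (Set.mem_Ici.1 hz) (not_le.2 he'0)
      · have := hΘ1 z ((mem_levelTorus_iff hδ (mem_closedBall_zero_iff.1 hzR)).2 h0)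
        rw [Set.mem_preimage, Set.mem_Iic] at hz
        linarith)
  filter_upwards [ht0.eventually_lt_const hm0, (hM.norm.eventually_lt_const (lt_add_one ‖M‖))]
    with k hk hkM
  rw [dist_zero_right]
  have hpw : ∀ z ∈ ball (0 : Cn n) R, ‖(prodBump c (ht k) (levelDiff F δ z) : ℂ) * g z‖ ≤
      2 * e' * (prodBump c (ht k) (levelDiff F δ z) * Θ z) := by
    intro z hz
    have hb := prodBump_nonneg c (ht k) (levelDiff F δ z)
    rw [norm_mul, Complex.norm_real, Real.norm_of_nonneg hb]
    by_cases hzB : z ∈ (closedBall (0 : Cn n) R ∩ (fun z => ‖g z‖) ⁻¹' Set.Ici e') ∪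
      (closedBall (0 : Cn n) R ∩ Θ ⁻¹' Set.Iic (1 / 2))
    · have h1 : ¬ ‖levelDiff F δ z‖ < t k := not_lt.2 (hk.le.trans (hm z hzB))
      rw [pi_norm_lt_iff (ht k)] at h1
      push Not at h1
      obtain ⟨i, hi⟩ := h1
      rw [prodBump_eq_zero c (ht k) hi]
      simp
    · rw [Set.mem_union, not_or] at hzB
      have h1 : ‖g z‖ < e' := by
        by_contra h
        exact hzB.1 ⟨ball_subset_closedBall hz, not_lt.1 h⟩
      have h2 : 1 / 2 < Θ z := by
        by_contra h
        exact hzB.2 ⟨ball_subset_closedBall hz, not_lt.1 h⟩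
      have h3 : ‖g z‖ ≤ 2 * e' * Θ z := by nlinarith
      calc _ ≤ prodBump c (ht k) (levelDiff F δ z) * (2 * e' * Θ z) :=
            mul_le_mul_of_nonneg_left h3 hb
        _ = _ := by ring
  have hint : IntegrableOn (fun z => prodBump c (ht k) (levelDiff F δ z) * Θ z) (ball 0 R)
      (lebesgue n) := by
    refine IntegrableOn.mono_set ?_ ball_subset_closedBall
    exact (((continuous_prodBump c (ht k)).comp_continuousOn hL).mul
      hΘ.continuousOn).integrableOn_compact (isCompact_closedBall _ _)
  have hle : ‖∫ z in ball 0 R, (prodBump c (ht k) (levelDiff F δ z) : ℂ) * g z ∂lebesgue n‖ ≤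
      ∫ z in ball 0 R, 2 * e' * (prodBump c (ht k) (levelDiff F δ z) * Θ z) ∂lebesgue n := by
    refine norm_integral_le_of_norm_le (hint.const_mul _) ?_
    filter_upwards [ae_restrict_mem measurableSet_ball] with z hz using hpw z hz
  have hext : ∫ z in ball 0 R, prodBump c (ht k) (levelDiff F δ z) * Θ z ∂lebesgue n =
      ∫ z, prodBump c (ht k) (levelDiff F δ z) * Θ z ∂lebesgue n :=
    setIntegral_eq_integral_of_forall_compl_eq_zero fun z hz => by rw [hΘV z hz, mul_zero]
  rw [integral_const_mul, hext] at hle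
  have hreal : ∫ z, prodBump c (ht k) (levelDiff F δ z) * Θ z ∂lebesgue n < ‖M‖ + 1 := by
    refine lt_of_le_of_lt ?_ hkM
    have h1 : ∫ z, (prodBump c (ht k) (levelDiff F δ z) : ℂ) * Θ z ∂lebesgue n =
        ((∫ z, prodBump c (ht k) (levelDiff F δ z) * Θ z ∂lebesgue n : ℝ) : ℂ) := by
      rw [← integral_complex_ofReal]
      simp only [Complex.ofReal_mul]
    rw [h1, Complex.norm_real]
    exact Real.le_norm_self _
  calc _ ≤ _ := hle
    _ ≤ 2 * e' * (‖M‖ + 1) := by gcongr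
    _ = e / 2 := by rw [he']; field_simp; norm_num
    _ < e := by linarith

/-- The functions `P.bump l` are controlled only on Γ. A Tietze extension b_l times the cutoff θ_l,
which is one on the image of the compact set that carries `P.bump l`, agrees with `P.bump l` on Γ
and is treated by charts. The sum χ of these products is one on Γ but not nearby; the remainder with
factor 1 - χ vanishes on Γ and has limit zero. -/
theorem tendsto_integral_levelTorus (hRε : R < ε)
    (hF : ∀ i, DifferentiableOn ℂ (F i) (ball 0 ε)) (hφ : ContinuousOn φ (ball 0 ε))
    (hδ : ∀ i, 0 < δ i) (hsep : ∀ z : Cn n, ‖z‖ = R → ∃ i, δ i < ‖F i z‖)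
    (hreg : ∀ z ∈ levelTorus F R δ, Function.Surjective
      fun (v : Cn n) (i : Fin n) => (fderiv ℂ (F i) z v / F i z).re)
    (P : ParamPartition n (levelTorus F R δ))
    (hpos : ∀ l, ∀ x ∈ P.dom l, 0 ≤ Matrix.det (Matrix.of fun i a : Fin n =>
      (fderiv ℂ (F i) (P.param l x) (P.tangent l x a) / F i (P.param l x)).im))
    (c : Fin n → ℝ) {t : ℕ → ℝ} (ht : ∀ k, 0 < t k)
    (ht0 : Filter.Tendsto t Filter.atTop (nhds 0)) :
    Filter.Tendsto (fun k => (2 * Complex.I) ^ n * ∫ z in ball 0 R,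
      (prodBump c (ht k) (levelDiff F δ z) : ℂ) * (φ z * conjJacobian F z) ∂lebesgue n)
      Filter.atTop (nhds (P.integral fun z v => φ z / (∏ i, F i z) * topForm n v)) := by
  have hsub : closedBall (0 : Cn n) R ⊆ ball 0 ε := closedBall_subset_ball hRε
  have hbε : ball (0 : Cn n) R ⊆ ball 0 ε := ball_subset_ball hRε.le
  have hFV : ∀ i, DifferentiableOn ℂ (F i) (ball 0 R) := fun i => (hF i).mono hbε
  have hΓV := levelTorus_subset_ball hsep
  have hΓc : IsCompact (levelTorus F R δ) :=
    isCompact_levelTorus fun i => (hF i).continuousOn.mono hsub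
  have hF0 : ∀ z ∈ levelTorus F R δ, ∀ i, F i z ≠ 0 := fun z hz i => by
    rw [← norm_pos_iff, hz.2 i]
    exact hδ i
  choose C hCd hCc hCs using P.bump_support
  choose θ K hθc hθ0 hKc hKV hθK hθ1 hθM hθlim using fun l =>
    exists_localized_cutoff (δ := δ) isOpen_ball hFV (fun x hx => hF0 _ (P.param_mem l hx))
      (P.isOpen_dom l) (P.smooth l) (P.injOn l) (P.immersion l)
      (fun x hx => hΓV (P.param_mem l hx))
      (fun x hx => (mem_levelTorus_iff hδ (P.param_mem l hx).1).1 (P.param_mem l hx))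
      (fun x hx => hreg _ (P.param_mem l hx)) (hpos l) (hCc l) (hCd l) c ht ht0
  choose b hb using fun l => ContinuousMap.exists_restrict_eq hΓc.isClosed
    (⟨_, (P.bump_continuous l).domRestrict⟩ : C(levelTorus F R δ, ℝ))
  have hb' : ∀ l, ∀ z ∈ levelTorus F R δ, b l z = P.bump l z := fun l z hz =>
    DFunLike.congr_fun (hb l) ⟨z, hz⟩
  have hbθ : ∀ l, ∀ z ∈ levelTorus F R δ, θ l z * b l z = P.bump l z := by
    intro l z hz
    rw [hb' l z hz]
    by_cases h : P.bump l z = 0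
    · rw [h, mul_zero]
    · obtain ⟨x, hx, rfl⟩ := hCs l z hz h
      rw [hθ1 l x hx, one_mul]
  let χ : Cn n → ℝ := fun z => ∑ l, θ l z * b l z
  have hχ : Continuous χ := continuous_finsetSum _ fun l _ => (hθc l).mul (b l).continuous
  have hχ1 : ∀ z ∈ levelTorus F R δ, χ z = 1 := fun z hz => by
    rw [← P.bump_sum z hz]
    exact Finset.sum_congr rfl fun l _ => hbθ l z hz
  have hJ : ContinuousOn (conjJacobian F) (ball 0 ε) := continuousOn_conjJacobian isOpen_ball hF
  have hint : ∀ k (G : Cn n → ℂ), ContinuousOn G (closedBall 0 R) →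
      IntegrableOn (fun z => (prodBump c (ht k) (levelDiff F δ z) : ℂ) * G z) (ball 0 R)
        (lebesgue n) := by
    intro k G hG
    refine IntegrableOn.mono_set ?_ ball_subset_closedBall
    exact (((continuousOn_prodBump_levelDiff isOpen_ball hF c (ht k)).mono hsub).mul
      hG).integrableOn_compact (isCompact_closedBall _ _)
  have hc : ∀ {f : Cn n → ℝ}, Continuous f → Continuous fun z => (f z : ℂ) := fun hf =>
    Complex.continuous_ofReal.comp hf
  have hmain : Filter.Tendsto (fun k => (2 * Complex.I) ^ n * ∫ z in ball 0 R,
      (prodBump c (ht k) (levelDiff F δ z) : ℂ) * (χ z * (φ z * conjJacobian F z)) ∂lebesgue n)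
      Filter.atTop (nhds (P.integral fun z v => φ z / (∏ i, F i z) * topForm n v)) := by
    have h := tendsto_finsetSum Finset.univ fun l _ => hθlim l (fun z => (b l z : ℂ) * φ z)
      ((hc (b l).continuous).continuousOn.mul (hφ.mono hbε))
    have hr : ∑ l, ∫ x in P.dom l, θ l (P.param l x) * ((b l (P.param l x) : ℂ) *
        φ (P.param l x)) * (1 / (∏ i, F i (P.param l x)) *
          topForm n fun a => fderiv ℝ (P.param l) x (Pi.single a 1)) =
        P.integral fun z v => φ z / (∏ i, F i z) * topForm n v := by
      refine Finset.sum_congr rfl fun l _ => setIntegral_congr_fun (P.isOpen_dom l).measurableSet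
        fun x hx => ?_
      beta_reduce
      rw [← hbθ l _ (P.param_mem l hx), Complex.ofReal_mul]
      change _ = _ * (_ * topForm n fun a => fderiv ℝ (P.param l) x (Pi.single a 1))
      ring
    rw [hr] at h
    refine h.congr fun k => ?_
    rw [← Finset.mul_sum]
    congr 1
    have hz : ∀ l, ∫ z, (prodBump c (ht k) (levelDiff F δ z) : ℂ) *
        (θ l z * (b l z * φ z) * conjJacobian F z) ∂lebesgue n = ∫ z in ball 0 R,
        (prodBump c (ht k) (levelDiff F δ z) : ℂ) *
        (θ l z * (b l z * φ z) * conjJacobian F z) ∂lebesgue n := by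
      intro l
      rw [setIntegral_eq_integral_of_forall_compl_eq_zero]
      intro z hz
      rw [hθK l z fun h => hz (hKV l h)]
      simp
    simp only [hz]
    rw [← integral_finsetSum]
    · refine setIntegral_congr_fun measurableSet_ball fun z _ => ?_
      simp only [χ, Complex.ofReal_sum, Complex.ofReal_mul, Finset.mul_sum, Finset.sum_mul]
      exact Finset.sum_congr rfl fun l _ => by ring
    · exact fun l _ => hint k _ (((hc (hθc l)).continuousOn.mul
        ((hc (b l).continuous).continuousOn.mul (hφ.mono hsub))).mul (hJ.mono hsub))
  choose M hM using hθM
  have hΘM : Filter.Tendsto (fun k => ∫ z, (prodBump c (ht k) (levelDiff F δ z) : ℂ) *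
      (∑ l, θ l z : ℝ) ∂lebesgue n) Filter.atTop (nhds (∑ l, M l)) := by
    refine (tendsto_finsetSum Finset.univ fun l _ => hM l).congr fun k => ?_
    rw [← integral_finsetSum]
    · simp only [Complex.ofReal_sum, Finset.mul_sum]
    · intro l _
      refine integrable_of_continuousOn_of_eq_zero (hKc l) ?_ fun z hz => by
        rw [hθK l z hz, Complex.ofReal_zero, mul_zero]
      exact ((continuousOn_prodBump_levelDiff isOpen_ball hFV c (ht k)).mono (hKV l)).mul
        (hc (hθc l)).continuousOn
  have herr := tendsto_integral_prodBump_of_eq_zero (g := fun z => (1 - χ z : ℝ) *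
      (φ z * conjJacobian F z)) (Θ := fun z => ∑ l, θ l z) hRε hF hδ
    ((hc (continuous_const.sub hχ)).continuousOn.mul ((hφ.mono hsub).mul (hJ.mono hsub)))
    (fun z hz => by rw [hχ1 z hz]; simp)
    (continuous_finsetSum _ fun l _ => hθc l)
    (fun z hz => Finset.sum_eq_zero fun l _ => hθK l z fun h => hz (hKV l h))
    (fun z hz => by
      obtain ⟨l, hl⟩ : ∃ l, P.bump l z ≠ 0 := by
        by_contra h
        push Not at h
        have := P.bump_sum z hz
        simp [h] at this
      obtain ⟨x, hx, hxz⟩ := hCs l z hz hl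
      rw [← hθ1 l x hx, hxz]
      exact Finset.single_le_sum (f := fun l => θ l z) (fun l _ => hθ0 l z) (Finset.mem_univ l))
    c ht ht0 hΘM
  have hsum := hmain.add (herr.const_mul ((2 * Complex.I) ^ n))
  rw [mul_zero, add_zero] at hsum
  refine hsum.congr fun k => ?_
  rw [← mul_add, ← integral_add
    (hint k (fun z => χ z * (φ z * conjJacobian F z))
      ((hc hχ).continuousOn.mul ((hφ.mono hsub).mul (hJ.mono hsub))))
    (hint k (fun z => (1 - χ z : ℝ) * (φ z * conjJacobian F z))
      ((hc (continuous_const.sub hχ)).continuousOn.mul ((hφ.mono hsub).mul (hJ.mono hsub))))]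
  congr 1
  refine setIntegral_congr_fun measurableSet_ball fun z _ => ?_
  simp only [Complex.ofReal_sub, Complex.ofReal_one]
  ring

end LevelTorus

/-! ### Comparison of the two residues -/

section Residue

variable {n N : ℕ} {ε R : ℝ}

theorem productCutoff_univ (F : Fin n → Cn n → ℂ) (δ : Fin n → ℝ) {t : ℝ} (ht : 0 < t) (z : Cn n) :
    productCutoff F δ R ht Finset.univ z = (ball (0 : Cn n) R).indicator
      (fun z => (-1 : ℂ) ^ n * prodBump (fun i => δ i ^ 2) ht (levelDiff F δ z)) z := by
  rw [productCutoff]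
  by_cases hz : z ∈ ball (0 : Cn n) R
  · rw [if_pos hz, Set.indicator_of_mem hz, prodBump, Complex.ofReal_prod]
    have h : ((-1 : ℂ)) ^ n = ∏ _l : Fin n, (-1 : ℂ) := by simp
    rw [h, ← Finset.prod_mul_distrib]
    refine Finset.prod_congr rfl fun l _ => ?_
    rw [if_pos (Finset.mem_univ l), levelDiff, add_sub_cancel]
    push_cast
    ring
  · rw [if_neg hz, Set.indicator_of_notMem hz]

/-- The integral of the last form of a Koszul lift over a sphere is the integral of the
Grothendieck residue form over the level torus, up to sign. -/
theorem sphereIntegral_lastForm_eq_integral_levelTorus {F : Fin (N + 1) → Cn (N + 1) → ℂ}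
    {s : Cn (N + 1) → Cn (N + 1) →L[ℂ] ℂ} {φ : Cn (N + 1) → ℂ}
    {β : ∀ k j : ℕ, ExtForm (N + 1) (N + 1 + k) j} {δ : Fin (N + 1) → ℝ}
    (hF : ∀ m, DifferentiableOn ℂ (F m) (ball 0 ε)) (hF0 : ∀ m, F m 0 = 0)
    (hFs : ∀ m z, F m z = s z (EuclideanSpace.single m 1))
    (hs : ContDiffOn ℝ ∞ s (ball 0 ε)) (hsh : ∀ v, DifferentiableOn ℂ (fun z => s z v) (ball 0 ε))
    (h0 : ∀ z ∈ ball 0 ε \ {0}, s z ≠ 0) (hφ : DifferentiableOn ℂ φ (ball 0 ε))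
    (hβ : IsKoszulLift (ball 0 ε \ {0}) s (topSection φ) β) {r : ℝ} (hr : 0 < r) (hrε : r < ε)
    (hR : 0 < R) (hRε : R < ε) (hδ : ∀ i, 0 < δ i)
    (hsep : ∀ z : Cn (N + 1), ‖z‖ = R → ∃ i, δ i < ‖F i z‖)
    (hreg : ∀ z ∈ levelTorus F R δ, Function.Surjective
      fun (v : Cn (N + 1)) (i : Fin (N + 1)) => (fderiv ℂ (F i) z v / F i z).re)
    (P : ParamPartition (N + 1) (levelTorus F R δ))
    (hpos : ∀ l, ∀ x ∈ P.dom l, 0 ≤ Matrix.det (Matrix.of fun i a : Fin (N + 1) =>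
      (fderiv ℂ (F i) (P.param l x) (P.tangent l x a) / F i (P.param l x)).im)) :
    sphereIntegral r (lastForm β) = (-1 : ℂ) ^ ((N + 1) * (N + 1 + 1) / 2) *
      P.integral fun z v => φ z / (∏ i, F i z) * topForm (N + 1) v := by
  obtain ⟨t₀, ht₀, hsep'⟩ := exists_separation (Nat.succ_pos N) (fun m => (hF m).continuousOn) hRε
    hδ hsep
  let t : ℕ → ℝ := fun k => 1 / ((k : ℝ) + 1)
  have ht : ∀ k, 0 < t k := fun k => Nat.one_div_pos_of_nat
  have ht0 : Filter.Tendsto t Filter.atTop (nhds 0) := tendsto_one_div_add_atTop_nhds_zero_nat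
  have hlim := (tendsto_integral_levelTorus hRε hF hφ.continuousOn hδ hsep hreg P hpos
    (fun i => δ i ^ 2) ht ht0).const_mul ((-1 : ℂ) ^ ((N + 1) * (N + 1 + 1) / 2))
  -- Once the width is below the margin t₀ and all δ_i², the identity with the sphere integral is
  -- exact, so the sequence is eventually constant.
  refine tendsto_nhds_unique (Filter.Tendsto.congr' ?_ tendsto_const_nhds) hlim
  filter_upwards [ht0.eventually_lt_const ht₀,
    Filter.eventually_all.2 fun i => ht0.eventually_lt_const (pow_pos (hδ i) 2)] with k hk hkδ
  rw [sphereIntegral_lastForm (isCutoffFamily_productCutoff hF hR hRε (ht k) hF0 hkδ fun z hz => by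
    obtain ⟨i, hi⟩ := hsep' z hz
    exact ⟨i, by linarith⟩) hF hFs hs hsh h0 hφ hβ hr hrε]
  -- The first factor comes from ordering the real basis, the second from the minus sign of each of
  -- the N + 1 bumps.
  have hsign : (-1 : ℂ) ^ ((N + 1) * (N + 1 + 1) / 2) =
      (-1 : ℂ) ^ ((N + 1) * N / 2) * (-1) ^ (N + 1) := by
    rw [← pow_add]
    congr 1
    have : (N + 1) * (N + 1 + 1) = (N + 1) * N + (N + 1) * 2 := by ring
    rw [this, Nat.add_mul_div_right _ _ two_pos]
  have hint : ∫ z, productCutoff F δ R (ht k) Finset.univ z * (φ z * (starRingEnd ℂ)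
      (Matrix.det (Matrix.of fun m l => fderiv ℂ (F m) z (EuclideanSpace.single l 1))))
        ∂lebesgue (N + 1) = (-1) ^ (N + 1) * ∫ z in ball 0 R,
      (prodBump (fun i => δ i ^ 2) (ht k) (levelDiff F δ z) : ℂ) * (φ z * conjJacobian F z)
        ∂lebesgue (N + 1) := by
    rw [← integral_const_mul, ← integral_indicator measurableSet_ball]
    refine integral_congr_ae (Filter.Eventually.of_forall fun z => ?_)
    beta_reduce
    rw [productCutoff_univ]
    by_cases hz : z ∈ ball (0 : Cn (N + 1)) R
    · rw [Set.indicator_of_mem hz, Set.indicator_of_mem hz, conjJacobian]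
      ring
    · rw [Set.indicator_of_notMem hz, Set.indicator_of_notMem hz, zero_mul]
  rw [hint, hsign]
  ring

end Residue

end VirtualResidue

end

theorem mainTheorem7 (n : ℕ) (hn : 1 ≤ n) (ε : ℝ) (hε : 0 < ε)
    (f g h : EuclideanSpace ℂ (Fin n) → ℂ)
    (hf : DifferentiableOn ℂ f (ball 0 ε))
    (hg : DifferentiableOn ℂ g (ball 0 ε))
    (hh : DifferentiableOn ℂ h (ball 0 ε))
    (hZ : ∀ z ∈ ball (0 : EuclideanSpace ℂ (Fin n)) ε, fderiv ℂ f z = 0 ↔ z = 0) :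
    (∃ w : ℂ, VirtualResidue.IsVirtualResidue ε (fun z => fderiv ℂ f z)
      (VirtualResidue.topSection fun z => g z * h z) w) ∧
    ∀ w ρ : ℂ,
      VirtualResidue.IsVirtualResidue ε (fun z => fderiv ℂ f z)
        (VirtualResidue.topSection fun z => g z * h z) w →
      VirtualResidue.IsGrothendieckResidue ε
        (fun i z => fderiv ℂ f z (EuclideanSpace.single i 1)) (fun z => g z * h z) ρ →
      w = (-1 : ℂ) ^ (n * (n + 1) / 2) * ρ := by
  have hU : ball (0 : EuclideanSpace ℂ (Fin n)) ε \ {z | fderiv ℂ f z = 0} = ball 0 ε \ {0} := by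
    ext z
    simp only [Set.mem_sdiff, Set.mem_ofPred_eq, Set.mem_singleton_iff]
    exact and_congr_right fun hz => not_congr (hZ z hz)
  have hs : ContDiffOn ℝ ∞ (fun z => fderiv ℂ f z) (ball 0 ε) :=
    (((VirtualResidue.contDiffOn_of_holomorphic isOpen_ball hf).fderiv_of_isOpen isOpen_ball
      (m := ∞) (by simp)).restrict_scalars ℝ)
  have hsh : ∀ v, DifferentiableOn ℂ (fun z => fderiv ℂ f z v) (ball 0 ε) :=
    VirtualResidue.differentiableOn_fderiv_apply isOpen_ball hf
  have h0 : ∀ z ∈ ball (0 : EuclideanSpace ℂ (Fin n)) ε \ {0}, fderiv ℂ f z ≠ 0 :=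
    fun z hz h => hz.2 ((hZ z hz.1).1 h)
  have hφ : DifferentiableOn ℂ (fun z => g z * h z) (ball 0 ε) := hg.mul hh
  refine ⟨?_, ?_⟩
  · have hsub : ball (0 : EuclideanSpace ℂ (Fin n)) ε \ {0} ⊆ ball 0 ε := Set.sdiff_subset
    obtain ⟨β, hβ⟩ := VirtualResidue.exists_isKoszulLift
      (isOpen_ball.sdiff isClosed_singleton) (hs.mono hsub) (fun v => (hsh v).mono hsub) h0
      (((VirtualResidue.contDiffOn_of_holomorphic isOpen_ball hφ).restrict_scalars ℝ).mono hsub)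
      (hφ.mono hsub)
    -- Any radius below ε would serve for the sphere.
    exact ⟨_, β, hU ▸ hβ, ε / 2, by positivity, by linarith, rfl⟩
  · rintro w ρ ⟨β, hβ, r, hr, hrε, rfl⟩ ⟨R, δ, P, hR, hRε, hδ, hsep, hreg, hpos, rfl⟩
    rw [hU] at hβ
    obtain ⟨N, rfl⟩ := Nat.exists_eq_add_of_le' hn
    have hF0 : ∀ m : Fin (N + 1), fderiv ℂ f 0 (EuclideanSpace.single m 1) = 0 := fun m => by
      rw [(hZ 0 (mem_ball_self hε)).2 rfl]
      rfl
    rw [VirtualResidue.sphereIntegral_lastForm_eq_integral_levelTorus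
      (fun m => hsh (EuclideanSpace.single m 1)) hF0 (fun _ _ => rfl) hs hsh h0 hφ hβ hr hrε hR hRε
      hδ hsep hreg P hpos]
    ring
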